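/- Let $X$ be a compact connected smooth manifold (without boundary), $\mathcal U=\{U_i\}$ an open cover of $X$, and $\widehat\lambda=(\{\lambda_{kji}\},\{A_{ji}\},\{B_i\})$ a $U(1)$-gerbe with connection on $\mathcal U$: $\lambda$ is a smooth completely normalized $U(1)$-valued Čech 2-cocycle, $A_{ji}\in\Omega^1(U_{ij};i\mathbb R)$ and $B_i\in\Omega^2(U_i;i\mathbb R)$ satisfy $\lambda_{kji}^{-1}d\lambda_{kji}=A_{ji}+A_{ik}+A_{kj}$ and $B_j-B_i=dA_{ji}$. Let $H$ be its curvature 3-form, $H|_{U_i}=dB_i$. A $\lambda$-twisted vector bundle $E$ of rank $n$ on $\mathcal U$ is a family of smooth maps $g_{ji}:U_{ij}\to U(n)$ with $g_{ii}=1$, $g_{ij}=g_{ji}^{-1}$, $g_{kj}g_{ji}=g_{ki}\lambda_{kji}$; an isomorphism $\{g_{ji}\}\to\{h_{ji}\}$ is a family of smooth maps $\varphi_i:U_i\to U(n)$ with $\varphi_jg_{ji}=h_{ji}\varphi_i$; direct sums are block sums, and $\mathscr O$ denotes the bundle of rank $0$. $K^0(\mathcal U,\lambda)$ is the Grothendieck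 group of the monoid of isomorphism classes. A connection on $E$ compatible with $\widehat\lambda$ is a family $\Gamma_i\in\Omega^1(U_i;\mathfrak u(n))$ with $\Gamma_i-g_{ji}^{-1}\Gamma_jg_{ji}-g_{ji}^{-1}dg_{ji}=-A_{ji}\cdot\mathbf 1$; its pull-back along an isomorphism $\varphi$ is $(\varphi^*\Gamma)_i=\varphi_i^{-1}\Gamma_i\varphi_i+\varphi_i^{-1}d\varphi_i$. For two compatible connections $\Gamma_0,\Gamma_1$ on $E$, let $\widetilde\Gamma$ be the connection on the pull-back of $E$ along $p:X\times[0,1]\to X$ given by $(1-t)\Gamma_0+t\Gamma_1$, with curvature $\widetilde R=d\widetilde\Gamma+\widetilde\Gamma\wedge\widetilde\Gamma$, and let $$\mathrm{cs}(\Gamma_0,\Gamma_1)=\int_{[0,1]}\sum_{m\ge 0}\frac1{m!}\operatorname{tr}\big((\widetilde R_i-p^*B_i\cdot\mathbf 1)^m\big)\in\Omega^{\mathrm{odd}}(X;\mathbb C)$$ (integration along the fibre of $p$). Put $\mathrm{CS}(\Gamma_0,\Gamma_1)=\mathrm{cs}(\Gamma_0,\Gamma_1)\bmod \mathrm{Im}(d+H)$.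 For an automorphism $\phi$ of $E$, the form $\mathrm{cs}(\Gamma,\phi^*\Gamma)$ is called an odd twisted Chern character form; let $\mathrm{Im}(\mathrm{Ch})$ be the group generated by all of these forms, and $\Omega_{H,\mathrm{Ch}}=\mathrm{Im}(\mathrm{Ch})+\mathrm{Im}(d+H)\subseteq\Omega^{\mathrm{odd}}(X;\mathbb C)$. Consider triples $(E,\Gamma,\omega)$ of a $\lambda$-twisted vector bundle, a compatible connection and $\omega\in\Omega^{\mathrm{odd}}(X;\mathbb C)/\mathrm{Im}(d+H)$. Call $(E,\Gamma,\omega)$ and $(E',\Gamma',\omega')$ equivalent if there are a bundle $F$ with compatible connection $\Gamma^F$ and an isomorphism $\varphi:E\oplus F\to E'\oplus F$ with $\mathrm{CS}(\Gamma\oplus\Gamma^F,\varphi^*(\Gamma'\oplus\Gamma^F))=\omega-\omega'$. The group $\widehat K^0(\mathcal U,\widehat\lambda)$ is the group completion of the monoid of equivalence classes of triples under $(E,\Gamma,\omega)+(F,\Delta,\eta)=(E\oplus F,\Gamma\oplus\Delta,\omega+\eta)$. Then the assignments $a(\theta)=[(\mathscr O,0,\theta)]$ and $I\big([(E,\Gamma,\omega)]-[(F,\Delta,\eta)]\big)=[E]-[F]$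 define group homomorphisms, and the sequence $$0\to\Omega^{\mathrm{odd}}(X;\mathbb C)/\Omega_{H,\mathrm{Ch}}\xrightarrow{\ a\ }\widehat K^0(\mathcal U,\widehat\lambda)\xrightarrow{\ I\ }K^0(\mathcal U,\lambda)\to 0$$ is exact. -/

import Mathlib

open scoped Manifold ContDiff Matrix

set_option linter.unusedSectionVars false

noncomputable section

namespace TwistedK

/-! ### Exterior algebra of complex-valued covectors -/

/-- The model space of a `d`-dimensional manifold. -/
abbrev Eucl (d : ℕ) : Type := EuclideanSpace ℝ (Fin d)

/-- The algebra `Λ^*(V^* ⊗ ℂ)` of complex-valued alternating forms on a real vector space `V`: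
the exterior algebra over `ℂ` of the space of real-linear maps `V → ℂ`.
The product is the wedge product. -/
abbrev Ext (V : Type) [AddCommGroup V] [Module ℝ V] : Type := ExteriorAlgebra ℂ (V →ₗ[ℝ] ℂ)

/-- A complex-valued covector, as a form of degree one. -/
abbrev oneForm {V : Type} [AddCommGroup V] [Module ℝ V] (α : V →ₗ[ℝ] ℂ) : Ext V :=
  ExteriorAlgebra.ι ℂ α

/-- Pull-back of alternating forms along a real-linear map. -/
def pullback {V W : Type} [AddCommGroup V] [Module ℝ V] [AddCommGroup W] [Module ℝ W]
    (f : V →ₗ[ℝ] W) : Ext W →ₐ[ℂ] Ext V :=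
  ExteriorAlgebra.map (LinearMap.lcomp ℂ ℂ f)

/-- The forms of even degree (`s = 0`) and of odd degree (`s = 1`). -/
abbrev parity (V : Type) [AddCommGroup V] [Module ℝ V] (s : ZMod 2) : Submodule ℂ (Ext V) :=
  CliffordAlgebra.evenOdd (0 : QuadraticForm ℂ (V →ₗ[ℝ] ℂ)) s

/-- The degree-one forms with values in `iℝ`. -/
def IsImagOneForm {V : Type} [AddCommGroup V] [Module ℝ V] (a : Ext V) : Prop :=
  ∃ α : V →ₗ[ℝ] ℂ, (∀ v, (α v).re = 0) ∧ a = oneForm α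

/-- The degree-two forms with values in `iℝ`: the real span of the forms `i (α ∧ β)`
with `α` and `β` real covectors. -/
def IsImagTwoForm {V : Type} [AddCommGroup V] [Module ℝ V] (b : Ext V) : Prop :=
  b ∈ Submodule.span ℝ {c : Ext V | ∃ α β : V →ₗ[ℝ] ℂ,
    (∀ v, (α v).im = 0) ∧ (∀ v, (β v).im = 0) ∧ c = Complex.I • (oneForm α * oneForm β)}

/-- The degree-one forms with values in the Lie algebra `𝔲(n)` of skew-Hermitian matrices. -/
def IsSkewOneForm {V : Type} [AddCommGroup V] [Module ℝ V] {n : ℕ}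
    (M : Matrix (Fin n) (Fin n) (Ext V)) : Prop :=
  ∃ α : Matrix (Fin n) (Fin n) (V →ₗ[ℝ] ℂ),
    (∀ v a b, α b a v = -(starRingEnd ℂ) (α a b v)) ∧ M = α.map fun β => oneForm β

/-- The coordinate covectors `dx¹, …, dxᵈ`, a basis of the complex-valued covectors. -/
def dx (d : ℕ) : Module.Basis (Fin d) ℂ (Eucl d →ₗ[ℝ] ℂ) :=
  Module.Basis.ofEquivFun ((EuclideanSpace.basisFun (Fin d) ℝ).toBasis.constr ℂ).symm

lemma dx_apply (d : ℕ) (j : Fin d) (v : Eucl d) : dx d j v = (v j : ℂ) := by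
  simp [dx, Module.Basis.constr_apply_fintype, Pi.single_apply]

/-- The coordinates `(f_S)` of a form `∑_S f_S dx^S`. -/
def coords (d : ℕ) : Ext (Eucl d) ≃ₗ[ℂ] (Finset (Fin d) → ℂ) :=
  (dx d).ExteriorAlgebra.equivFun

/-- The exterior derivative `∑_j dx^j ∧ ∂_j f` of a (not necessarily homogeneous) form `f`
on Euclidean space, where `∂_j` acts on the coordinates of `f`. -/
def flatD {d : ℕ} (f : Eucl d → Ext (Eucl d)) (y : Eucl d) : Ext (Eucl d) :=
  ∑ j, oneForm (dx d j) *
    (coords d).symm (fderiv ℝ (fun z => coords d (f z)) y (EuclideanSpace.single j 1))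

/-! ### Differential forms on a manifold -/

section Forms

variable {d : ℕ} {X : Type*} [TopologicalSpace X] [ChartedSpace (Eucl d) X]

/- As in Mathlib, the tangent space of `X` at `x` is `Eucl d` by definition, through the preferred
chart at `x`. So a complex differential form on `X` (of mixed degree, not yet smooth) is a function
`X → Ext (Eucl d)`. A form on an open set `S` is given by such a function, whose values outside `S`
are never used. -/

/-- The expression of a form in the preferred chart at `c`: at a point `y` of the target of that
chart, which corresponds to the point `z` of `X`, it is the pull-back of `w z` along the derivative
of the transition map from the chart at `c` to the chart at `z`. -/
def localRep (c : X) (w : X → Ext (Eucl d)) (y : Eucl d) : Ext (Eucl d) :=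
  pullback (fderiv ℝ (extChartAt (𝓡 d) ((extChartAt (𝓡 d) c).symm y) ∘
      (extChartAt (𝓡 d) c).symm) y).toLinearMap
    (w ((extChartAt (𝓡 d) c).symm y))

/-- `w` is a smooth form on the open set `S`. -/
def IsSmoothOn (w : X → Ext (Eucl d)) (S : Set X) : Prop :=
  ∀ c : X, ContDiffOn ℝ ∞ (fun y => coords d (localRep c w y))
    ((extChartAt (𝓡 d) c).target ∩ (extChartAt (𝓡 d) c).symm ⁻¹' S)

/-- The exterior derivative of a form: at `x`, it is computed in the preferred chart at `x`. -/
def extD (w : X → Ext (Eucl d)) (x : X) : Ext (Eucl d) :=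
  flatD (localRep x w) (extChartAt (𝓡 d) x x)

/-- The entrywise exterior derivative of a matrix of forms. -/
def extDMat {m n : Type*} (M : X → Matrix m n (Ext (Eucl d))) (x : X) :
    Matrix m n (Ext (Eucl d)) :=
  Matrix.of fun a b => extD (fun y => M y a b) x

/-- A matrix of complex numbers as a matrix of forms of degree zero. -/
abbrev toForm (d : ℕ) {m n : Type*} (M : Matrix m n ℂ) : Matrix m n (Ext (Eucl d)) :=
  M.map (algebraMap ℂ (Ext (Eucl d)))

/-- A function `f` with values in complex matrices is smooth on `S`. -/
def MatSmoothOn (d : ℕ) {X : Type*} [TopologicalSpace X] [ChartedSpace (Eucl d) X]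
    {m n : Type*} (f : X → Matrix m n ℂ) (S : Set X) : Prop :=
  ∀ a b, ContMDiffOn (𝓡 d) 𝓘(ℝ, ℂ) ∞ (fun x => f x a b) S

lemma localRep_zero (c : X) : localRep c (fun _ => (0 : Ext (Eucl d))) = fun _ => 0 := by
  funext y; simp [localRep]

lemma localRep_add (c : X) (w u : X → Ext (Eucl d)) (y : Eucl d) :
    localRep c (fun x => w x + u x) y = localRep c w y + localRep c u y := by
  simp [localRep]

lemma localRep_neg (c : X) (w : X → Ext (Eucl d)) (y : Eucl d) :
    localRep c (fun x => -w x) y = -localRep c w y := by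
  simp [localRep]

lemma IsSmoothOn.zero (S : Set X) : IsSmoothOn (fun _ => (0 : Ext (Eucl d))) S := by
  intro c
  simp only [localRep_zero, map_zero]
  exact contDiffOn_const

lemma IsSmoothOn.add {w u : X → Ext (Eucl d)} {S : Set X} (hw : IsSmoothOn w S)
    (hu : IsSmoothOn u S) : IsSmoothOn (fun x => w x + u x) S := by
  intro c
  simp only [localRep_add, map_add]
  exact (hw c).add (hu c)

lemma IsSmoothOn.neg {w : X → Ext (Eucl d)} {S : Set X} (hw : IsSmoothOn w S) :
    IsSmoothOn (fun x => -w x) S := by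
  intro c
  simp only [localRep_neg, map_neg]
  exact (hw c).neg

lemma IsSmoothOn.differentiableAt {w : X → Ext (Eucl d)} (hw : IsSmoothOn w Set.univ) (x : X) :
    DifferentiableAt ℝ (fun y => coords d (localRep x w y)) (extChartAt (𝓡 d) x x) := by
  have h := (hw x).contDiffAt (x := extChartAt (𝓡 d) x x) (by
    simpa using extChartAt_target_mem_nhds (I := 𝓡 d) x)
  exact h.differentiableAt (by simp)

lemma extD_const (r : ℂ) (x : X) : extD (fun _ => algebraMap ℂ (Ext (Eucl d)) r) x = 0 := by
  have : localRep x (fun _ => algebraMap ℂ (Ext (Eucl d)) r) =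
      fun _ => algebraMap ℂ (Ext (Eucl d)) r := by
    funext y; simp [localRep]
  simp [extD, flatD, this]

lemma extD_zero (x : X) : extD (fun _ => (0 : Ext (Eucl d))) x = 0 := by
  simpa using extD_const (0 : ℂ) x

lemma extD_add {w u : X → Ext (Eucl d)} (hw : IsSmoothOn w Set.univ)
    (hu : IsSmoothOn u Set.univ) (x : X) :
    extD (fun x => w x + u x) x = extD w x + extD u x := by
  simp only [extD, flatD, localRep_add, map_add]
  rw [fderiv_fun_add (hw.differentiableAt x) (hu.differentiableAt x)]
  simp [mul_add, Finset.sum_add_distrib]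

lemma extD_neg (w : X → Ext (Eucl d)) (x : X) :
    extD (fun x => -w x) x = -extD w x := by
  simp only [extD, flatD, localRep_neg, map_neg]
  rw [fderiv_fun_neg]
  simp

lemma extDMat_toForm_const {m n : Type*} (M : Matrix m n ℂ) (x : X) :
    extDMat (fun _ : X => (toForm d M : Matrix m n (Ext (Eucl d)))) x = 0 := by
  ext a b
  simpa [extDMat] using extD_const (M a b) x

end Forms

/-! ### Block sums of matrices -/

/-- The block sum of two matrices. -/
def blockSum {R : Type*} [Zero R] {n m n' m' : ℕ} (A : Matrix (Fin n) (Fin m) R)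
    (D : Matrix (Fin n') (Fin m') R) : Matrix (Fin (n + n')) (Fin (m + m')) R :=
  (Matrix.fromBlocks A 0 0 D).submatrix finSumFinEquiv.symm finSumFinEquiv.symm

section Block

variable {R S : Type*} {n m k n' m' k' n'' m'' : ℕ}

lemma blockSum_mul [Semiring R] (A : Matrix (Fin n) (Fin m) R) (D : Matrix (Fin n') (Fin m') R)
    (A' : Matrix (Fin m) (Fin k) R) (D' : Matrix (Fin m') (Fin k') R) :
    blockSum A D * blockSum A' D' = blockSum (A * A') (D * D') := by
  simp only [blockSum, Matrix.submatrix_mul_equiv, Matrix.fromBlocks_multiply]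
  simp

lemma blockSum_add [AddZeroClass R] (A A' : Matrix (Fin n) (Fin m) R)
    (D D' : Matrix (Fin n') (Fin m') R) :
    blockSum A D + blockSum A' D' = blockSum (A + A') (D + D') := by
  ext i j
  obtain ⟨i, rfl⟩ := finSumFinEquiv.surjective i
  obtain ⟨j, rfl⟩ := finSumFinEquiv.surjective j
  rcases i with i | i <;> rcases j with j | j <;> simp [blockSum]

lemma blockSum_sub [AddGroup R] (A A' : Matrix (Fin n) (Fin m) R)
    (D D' : Matrix (Fin n') (Fin m') R) :
    blockSum A D - blockSum A' D' = blockSum (A - A') (D - D') := by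
  ext i j
  obtain ⟨i, rfl⟩ := finSumFinEquiv.surjective i
  obtain ⟨j, rfl⟩ := finSumFinEquiv.surjective j
  rcases i with i | i <;> rcases j with j | j <;> simp [blockSum]

lemma blockSum_one [Semiring R] :
    blockSum (1 : Matrix (Fin n) (Fin n) R) (1 : Matrix (Fin n') (Fin n') R) = 1 := by
  simp [blockSum]

lemma blockSum_zero [Zero R] :
    blockSum (0 : Matrix (Fin n) (Fin m) R) (0 : Matrix (Fin n') (Fin m') R) = 0 := by
  simp [blockSum]

lemma blockSum_map [Zero R] [Zero S] (f : R → S) (hf : f 0 = 0) (A : Matrix (Fin n) (Fin m) R)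
    (D : Matrix (Fin n') (Fin m') R) :
    (blockSum A D).map f = blockSum (A.map f) (D.map f) := by
  simp only [blockSum, ← Matrix.submatrix_map, Matrix.fromBlocks_map]
  congr 2 <;> (ext; simp [hf])

lemma blockSum_conjTranspose (A : Matrix (Fin n) (Fin m) ℂ) (D : Matrix (Fin n') (Fin m') ℂ) :
    (blockSum A D)ᴴ = blockSum Aᴴ Dᴴ := by
  simp [blockSum, Matrix.fromBlocks_conjTranspose]

lemma blockSum_smul [Semiring R] (c : R) (A : Matrix (Fin n) (Fin m) R)
    (D : Matrix (Fin n') (Fin m') R) : c • blockSum A D = blockSum (c • A) (c • D) := by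
  ext i j
  obtain ⟨i, rfl⟩ := finSumFinEquiv.surjective i
  obtain ⟨j, rfl⟩ := finSumFinEquiv.surjective j
  rcases i with i | i <;> rcases j with j | j <;> simp [blockSum]

lemma blockSum_diagonal [Zero R] (c : R) :
    blockSum (Matrix.diagonal fun _ : Fin n => c) (Matrix.diagonal fun _ : Fin n' => c) =
      Matrix.diagonal fun _ => c := by
  rw [blockSum, Matrix.fromBlocks_diagonal, Matrix.submatrix_diagonal_equiv]
  congr 1
  funext i
  obtain ⟨i, rfl⟩ := finSumFinEquiv.surjective i
  rcases i with i | i <;> simp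

lemma blockSum_trace [AddCommMonoid R] (A : Matrix (Fin n) (Fin n) R)
    (D : Matrix (Fin n') (Fin n') R) :
    (blockSum A D).trace = A.trace + D.trace := by
  simp only [Matrix.trace, Matrix.diag, blockSum]
  rw [← finSumFinEquiv.sum_comp]
  simp [Fintype.sum_sum_type]

/-- The identification of the index sets of `(A ⊕ D) ⊕ C` and `(A ⊕ C) ⊕ D`. -/
def swapEquiv (n g f : ℕ) : Fin (n + g + f) ≃ Fin (n + f + g) :=
  (finSumFinEquiv.symm.trans ((Equiv.sumCongr finSumFinEquiv.symm (Equiv.refl _)).trans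
    (((Equiv.sumAssoc _ _ _).trans ((Equiv.sumCongr (Equiv.refl _) (Equiv.sumComm _ _)).trans
      (Equiv.sumAssoc _ _ _).symm)).trans
    (Equiv.sumCongr finSumFinEquiv (Equiv.refl _))))).trans finSumFinEquiv

lemma blockSum_swap [Zero R] (A : Matrix (Fin n) (Fin m) R) (D : Matrix (Fin n') (Fin m') R)
    (C : Matrix (Fin n'') (Fin m'') R) :
    blockSum (blockSum A D) C =
      (blockSum (blockSum A C) D).submatrix (swapEquiv n n' n'') (swapEquiv m m' m'') := by
  ext i j
  obtain ⟨i, rfl⟩ := finSumFinEquiv.surjective i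
  obtain ⟨j, rfl⟩ := finSumFinEquiv.surjective j
  rcases i with i | i <;> rcases j with j | j
  · obtain ⟨i, rfl⟩ := finSumFinEquiv.surjective i
    obtain ⟨j, rfl⟩ := finSumFinEquiv.surjective j
    rcases i with i | i <;> rcases j with j | j <;>
      simp [blockSum, swapEquiv]
  · obtain ⟨i, rfl⟩ := finSumFinEquiv.surjective i
    rcases i with i | i <;> simp [blockSum, swapEquiv]
  · obtain ⟨j, rfl⟩ := finSumFinEquiv.surjective j
    rcases j with j | j <;> simp [blockSum, swapEquiv]
  · simp [blockSum, swapEquiv]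

/-- The identification of the index sets of `A ⊕ D` and `D ⊕ A`. -/
def commEquiv (n g : ℕ) : Fin (n + g) ≃ Fin (g + n) :=
  finSumFinEquiv.symm.trans ((Equiv.sumComm _ _).trans finSumFinEquiv)

lemma blockSum_comm [Zero R] (A : Matrix (Fin n) (Fin m) R) (D : Matrix (Fin n') (Fin m') R) :
    blockSum D A = (blockSum A D).submatrix (commEquiv n n').symm (commEquiv m m').symm := by
  ext i j
  obtain ⟨i, rfl⟩ := finSumFinEquiv.surjective i
  obtain ⟨j, rfl⟩ := finSumFinEquiv.surjective j
  rcases i with i | i <;> rcases j with j | j <;>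
    simp [blockSum, commEquiv]

/-- The identification of the index sets of `(A ⊕ D) ⊕ C` and `A ⊕ (D ⊕ C)`. -/
def assocEquiv (n g f : ℕ) : Fin (n + g + f) ≃ Fin (n + (g + f)) :=
  finSumFinEquiv.symm.trans ((Equiv.sumCongr finSumFinEquiv.symm (Equiv.refl _)).trans
    ((Equiv.sumAssoc _ _ _).trans ((Equiv.sumCongr (Equiv.refl _) finSumFinEquiv).trans
      finSumFinEquiv)))

lemma blockSum_assoc [Zero R] (A : Matrix (Fin n) (Fin m) R) (D : Matrix (Fin n') (Fin m') R)
    (C : Matrix (Fin n'') (Fin m'') R) :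
    blockSum A (blockSum D C) = (blockSum (blockSum A D) C).submatrix
      (assocEquiv n n' n'').symm (assocEquiv m m' m'').symm := by
  ext i j
  obtain ⟨i, rfl⟩ := finSumFinEquiv.surjective i
  obtain ⟨j, rfl⟩ := finSumFinEquiv.surjective j
  rcases i with i | i <;> rcases j with j | j
  · simp [blockSum, assocEquiv]
  · obtain ⟨j, rfl⟩ := finSumFinEquiv.surjective j
    rcases j with j | j <;> simp [blockSum, assocEquiv]
  · obtain ⟨i, rfl⟩ := finSumFinEquiv.surjective i
    rcases i with i | i <;> simp [blockSum, assocEquiv]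
  · obtain ⟨i, rfl⟩ := finSumFinEquiv.surjective i
    obtain ⟨j, rfl⟩ := finSumFinEquiv.surjective j
    rcases i with i | i <;> rcases j with j | j <;> simp [blockSum, assocEquiv]

/-- The identification of the index sets of `0 ⊕ A` and `A`. -/
def zeroEquiv (n : ℕ) : Fin (0 + n) ≃ Fin n :=
  finSumFinEquiv.symm.trans (Equiv.emptySum _ _)

lemma blockSum_zero_left [Zero R] (O : Matrix (Fin 0) (Fin 0) R) (A : Matrix (Fin n) (Fin m) R) :
    A = (blockSum O A).submatrix (zeroEquiv n).symm (zeroEquiv m).symm := by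
  ext i j
  change A i j = Matrix.fromBlocks O 0 0 A (finSumFinEquiv.symm (finSumFinEquiv (Sum.inr i)))
    (finSumFinEquiv.symm (finSumFinEquiv (Sum.inr j)))
  simp only [Equiv.symm_apply_apply, Matrix.fromBlocks_apply₂₂]

end Block

/-! ### Gerbes with connection, twisted vector bundles, connections -/

/-- An open cover `{U_i}` of `X` indexed by `ι`. -/
structure OpenCover (ι X : Type*) [TopologicalSpace X] where
  U : ι → Set X
  isOpen : ∀ i, IsOpen (U i)
  exists_mem : ∀ x, ∃ i, x ∈ U i

section Twists

variable {d : ℕ} {X : Type*} [TopologicalSpace X] [ChartedSpace (Eucl d) X] {ι : Type*}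

/-- A `U(1)`-gerbe subordinate to an open cover: a smooth, completely normalized Čech 2-cocycle
`{λ_kji}` with values in `U(1)`. Values of `lam k j i` outside `U_k ∩ U_j ∩ U_i` are not used.
Invariance under permutations up to sign is required for two transpositions that generate
the symmetric group. -/
structure Gerbe (d : ℕ) {X : Type*} [TopologicalSpace X] [ChartedSpace (Eucl d) X] {ι : Type*}
    (C : OpenCover ι X) where
  lam : ι → ι → ι → X → ℂ
  norm_eq_one : ∀ k j i, ∀ x ∈ C.U k ∩ C.U j ∩ C.U i, ‖lam k j i x‖ = 1
  smooth : ∀ k j i, ContMDiffOn (𝓡 d) 𝓘(ℝ, ℂ) ∞ (lam k j i) (C.U k ∩ C.U j ∩ C.U i)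
  eq_one : ∀ k j i, k = j ∨ j = i ∨ k = i → ∀ x ∈ C.U k ∩ C.U j ∩ C.U i, lam k j i x = 1
  swap_left : ∀ k j i, ∀ x ∈ C.U k ∩ C.U j ∩ C.U i, lam j k i x = (lam k j i x)⁻¹
  swap_right : ∀ k j i, ∀ x ∈ C.U k ∩ C.U j ∩ C.U i, lam k i j x = (lam k j i x)⁻¹
  cocycle : ∀ l k j i, ∀ x ∈ C.U l ∩ C.U k ∩ C.U j ∩ C.U i,
    lam k j i x * (lam l j i x)⁻¹ * lam l k i x * (lam l k j x)⁻¹ = 1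

/-- A `U(1)`-gerbe with connection `({λ_kji}, {A_ji}, {B_i})`, where `A_ji` is an `iℝ`-valued
1-form on `U_ij` and `B_i` is an `iℝ`-valued 2-form on `U_i`, such that
`d log λ_kji = A_ji + A_ik + A_kj` and `B_j - B_i = d A_ji`. -/
structure GerbeConn (d : ℕ) {X : Type*} [TopologicalSpace X] [ChartedSpace (Eucl d) X]
    {ι : Type*} (C : OpenCover ι X) extends Gerbe d C where
  A : ι → ι → X → Ext (Eucl d)
  B : ι → X → Ext (Eucl d)
  A_imag : ∀ j i, ∀ x ∈ C.U j ∩ C.U i, IsImagOneForm (A j i x)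
  A_smooth : ∀ j i, IsSmoothOn (A j i) (C.U j ∩ C.U i)
  B_imag : ∀ i, ∀ x ∈ C.U i, IsImagTwoForm (B i x)
  B_smooth : ∀ i, IsSmoothOn (B i) (C.U i)
  dlog_lam : ∀ k j i, ∀ x ∈ C.U k ∩ C.U j ∩ C.U i,
    algebraMap ℂ (Ext (Eucl d)) (lam k j i x)⁻¹ *
      extD (fun y => algebraMap ℂ (Ext (Eucl d)) (lam k j i y)) x = A j i x + A i k x + A k j x
  B_sub_B : ∀ j i, ∀ x ∈ C.U j ∩ C.U i, B j x - B i x = extD (A j i) x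

variable {C : OpenCover ι X}

/-- The curvature 3-form `H` of a gerbe with connection: `H = dB_i` on `U_i`
(the choice of `i` at each point does not matter). -/
def GerbeConn.H (T : GerbeConn d C) (x : X) : Ext (Eucl d) :=
  extD (T.B (C.exists_mem x).choose) x

/-- A `λ`-twisted vector bundle of rank `n`: smooth transition maps `g_ji : U_ij → U(n)` with
`g_ii = 1`, `g_ji = g_ij⁻¹` and `g_kj g_ji = g_ki λ_kji`. -/
structure TwistedBundle (L : Gerbe d C) where
  rank : ℕ
  g : ι → ι → X → Matrix (Fin rank) (Fin rank) ℂ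
  unitary : ∀ j i, ∀ x ∈ C.U j ∩ C.U i, g j i x ∈ Matrix.unitaryGroup (Fin rank) ℂ
  smooth : ∀ j i, MatSmoothOn d (g j i) (C.U j ∩ C.U i)
  g_self : ∀ i, ∀ x ∈ C.U i, g i i x = 1
  g_inv : ∀ j i, ∀ x ∈ C.U j ∩ C.U i, g j i x * g i j x = 1
  g_mul : ∀ k j i, ∀ x ∈ C.U k ∩ C.U j ∩ C.U i, g k j x * g j i x = L.lam k j i x • g k i x

variable {L : Gerbe d C}

/-- An isomorphism of `λ`-twisted vector bundles of the same rank `n`: smooth maps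
`f_i : U_i → U(n)` with `f_j g_ji = h_ji f_i`. The two ranks, which are a priori different
natural numbers, are forced to agree by the two unitarity conditions (if some `U_i` is
non-empty). -/
structure Iso (E F : TwistedBundle L) where
  f : (i : ι) → X → Matrix (Fin F.rank) (Fin E.rank) ℂ
  unitary_left : ∀ i, ∀ x ∈ C.U i, (f i x)ᴴ * f i x = 1
  unitary_right : ∀ i, ∀ x ∈ C.U i, f i x * (f i x)ᴴ = 1
  smooth : ∀ i, MatSmoothOn d (f i) (C.U i)
  comm : ∀ j i, ∀ x ∈ C.U j ∩ C.U i, f j x * E.g j i x = F.g j i x * f i x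

lemma MatSmoothOn.mul {m n k : Type*} [Fintype n] {f : X → Matrix m n ℂ} {g : X → Matrix n k ℂ}
    {S : Set X} (hf : MatSmoothOn d f S) (hg : MatSmoothOn d g S) :
    MatSmoothOn d (fun x => f x * g x) S := by
  intro a b
  simp only [Matrix.mul_apply]
  exact contMDiffOn_finsetSum fun c _ => contDiff_mul.contMDiff.comp_contMDiffOn
    ((hf a c).prodMk_space (hg c b))

lemma MatSmoothOn.conjTranspose {m n : Type*} {f : X → Matrix m n ℂ}
    {S : Set X} (hf : MatSmoothOn d f S) : MatSmoothOn d (fun x => (f x)ᴴ) S := by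
  intro a b
  exact Complex.conjCLE.contDiff.contMDiff.comp_contMDiffOn (hf b a)

lemma MatSmoothOn.const {m n : Type*} (M : Matrix m n ℂ) (S : Set X) :
    MatSmoothOn d (fun _ => M) S :=
  fun _ _ => contMDiffOn_const

lemma MatSmoothOn.blockSum {m n m' n' : ℕ} {f : X → Matrix (Fin m) (Fin n) ℂ}
    {g : X → Matrix (Fin m') (Fin n') ℂ} {S : Set X} (hf : MatSmoothOn d f S)
    (hg : MatSmoothOn d g S) : MatSmoothOn d (fun x => blockSum (f x) (g x)) S := by
  intro a b
  obtain ⟨a, rfl⟩ := finSumFinEquiv.surjective a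
  obtain ⟨b, rfl⟩ := finSumFinEquiv.surjective b
  rcases a with a | a <;> rcases b with b | b
  · simpa [TwistedK.blockSum] using hf a b
  · simpa [TwistedK.blockSum] using contMDiffOn_const
  · simpa [TwistedK.blockSum] using contMDiffOn_const
  · simpa [TwistedK.blockSum] using hg a b

/-- The direct sum of twisted vector bundles. -/
def TwistedBundle.sum (E F : TwistedBundle L) : TwistedBundle L where
  rank := E.rank + F.rank
  g j i x := blockSum (E.g j i x) (F.g j i x)
  unitary j i x hx := by
    have h1 := Matrix.mem_unitaryGroup_iff.1 (E.unitary j i x hx)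
    have h2 := Matrix.mem_unitaryGroup_iff.1 (F.unitary j i x hx)
    rw [Matrix.mem_unitaryGroup_iff]
    rw [Matrix.star_eq_conjTranspose] at h1 h2 ⊢
    rw [blockSum_conjTranspose, blockSum_mul, h1, h2, blockSum_one]
  smooth j i := (E.smooth j i).blockSum (F.smooth j i)
  g_self i x hx := by rw [E.g_self i x hx, F.g_self i x hx, blockSum_one]
  g_inv j i x hx := by rw [blockSum_mul, E.g_inv j i x hx, F.g_inv j i x hx, blockSum_one]
  g_mul k j i x hx := by
    rw [blockSum_mul, E.g_mul k j i x hx, F.g_mul k j i x hx, blockSum_smul]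

variable (L) in
/-- The twisted vector bundle of rank zero. -/
def TwistedBundle.zero : TwistedBundle L where
  rank := 0
  g _ _ _ := 1
  unitary _ _ _ _ := one_mem _
  smooth _ _ a := a.elim0
  g_self _ _ _ := rfl
  g_inv _ _ _ _ := by simp
  g_mul _ _ _ _ _ := Subsingleton.elim _ _

/-- The identity isomorphism. -/
def Iso.refl (E : TwistedBundle L) : Iso E E where
  f _ _ := 1
  unitary_left _ _ _ := by simp
  unitary_right _ _ _ := by simp
  smooth i := MatSmoothOn.const _ _
  comm _ _ _ _ := by simp

/-- The inverse isomorphism. -/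
def Iso.symm {E F : TwistedBundle L} (φ : Iso E F) : Iso F E where
  f i x := (φ.f i x)ᴴ
  unitary_left i x hx := by simpa using φ.unitary_right i x hx
  unitary_right i x hx := by simpa using φ.unitary_left i x hx
  smooth i := (φ.smooth i).conjTranspose
  comm j i x hx := by
    calc (φ.f j x)ᴴ * F.g j i x = (φ.f j x)ᴴ * (F.g j i x * (φ.f i x * (φ.f i x)ᴴ)) := by
          rw [φ.unitary_right i x hx.2, mul_one]
      _ = (φ.f j x)ᴴ * (φ.f j x * E.g j i x) * (φ.f i x)ᴴ := by
          rw [φ.comm j i x hx]; simp only [Matrix.mul_assoc]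
      _ = E.g j i x * (φ.f i x)ᴴ := by
          rw [← Matrix.mul_assoc, φ.unitary_left j x hx.1, one_mul]

/-- The composition of isomorphisms. -/
def Iso.trans {E F G : TwistedBundle L} (φ : Iso E F) (ψ : Iso F G) : Iso E G where
  f i x := ψ.f i x * φ.f i x
  unitary_left i x hx := by
    calc (ψ.f i x * φ.f i x)ᴴ * (ψ.f i x * φ.f i x)
        = (φ.f i x)ᴴ * ((ψ.f i x)ᴴ * ψ.f i x) * φ.f i x := by
          rw [Matrix.conjTranspose_mul]; simp only [Matrix.mul_assoc]
      _ = 1 := by rw [ψ.unitary_left i x hx, Matrix.mul_one, φ.unitary_left i x hx]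
  unitary_right i x hx := by
    calc (ψ.f i x * φ.f i x) * (ψ.f i x * φ.f i x)ᴴ
        = ψ.f i x * (φ.f i x * (φ.f i x)ᴴ) * (ψ.f i x)ᴴ := by
          rw [Matrix.conjTranspose_mul]; simp only [Matrix.mul_assoc]
      _ = 1 := by rw [φ.unitary_right i x hx, Matrix.mul_one, ψ.unitary_right i x hx]
  smooth i := (ψ.smooth i).mul (φ.smooth i)
  comm j i x hx := by
    rw [Matrix.mul_assoc, φ.comm j i x hx, ← Matrix.mul_assoc, ψ.comm j i x hx, Matrix.mul_assoc]

/-- The direct sum of isomorphisms. -/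
def Iso.sum {E E' F F' : TwistedBundle L} (φ : Iso E E') (ψ : Iso F F') :
    Iso (E.sum F) (E'.sum F') where
  f i x := blockSum (φ.f i x) (ψ.f i x)
  unitary_left i x hx := by
    refine (congrArg (· * _) (blockSum_conjTranspose _ _)).trans ((blockSum_mul _ _ _ _).trans ?_)
    rw [φ.unitary_left i x hx, ψ.unitary_left i x hx]
    exact blockSum_one
  unitary_right i x hx := by
    refine (congrArg (_ * ·) (blockSum_conjTranspose _ _)).trans ((blockSum_mul _ _ _ _).trans ?_)
    rw [φ.unitary_right i x hx, ψ.unitary_right i x hx]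
    exact blockSum_one
  smooth i := (φ.smooth i).blockSum (ψ.smooth i)
  comm j i x hx := by
    refine (blockSum_mul _ _ _ _).trans (Eq.trans ?_ (blockSum_mul _ _ _ _).symm)
    rw [φ.comm j i x hx, ψ.comm j i x hx]

/-- An isomorphism of bundles transported along identifications of the index sets. -/
def Iso.reindex {E F E' F' : TwistedBundle L} (φ : Iso E F) (e : Fin E'.rank ≃ Fin E.rank)
    (e' : Fin F'.rank ≃ Fin F.rank) (hE : ∀ j i x, E'.g j i x = (E.g j i x).submatrix e e)
    (hF : ∀ j i x, F'.g j i x = (F.g j i x).submatrix e' e') : Iso E' F' where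
  f i x := (φ.f i x).submatrix e' e
  unitary_left i x hx := by
    rw [Matrix.conjTranspose_submatrix, Matrix.submatrix_mul_equiv, φ.unitary_left i x hx,
      Matrix.submatrix_one_equiv]
  unitary_right i x hx := by
    rw [Matrix.conjTranspose_submatrix, Matrix.submatrix_mul_equiv, φ.unitary_right i x hx,
      Matrix.submatrix_one_equiv]
  smooth i a b := φ.smooth i _ _
  comm j i x hx := by
    rw [hE, hF, Matrix.submatrix_mul_equiv, Matrix.submatrix_mul_equiv, φ.comm j i x hx]

/-- The isomorphism of two bundles that differ by an identification of the index sets. -/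
def Iso.ofEquiv {E E' : TwistedBundle L} (e : Fin E'.rank ≃ Fin E.rank)
    (h : ∀ j i x, E'.g j i x = (E.g j i x).submatrix e e) : Iso E E' :=
  (Iso.refl E).reindex (Equiv.refl _) e (fun _ _ _ => rfl) h

/-! ### Twisted K-theory -/

/-- Being isomorphic, as an equivalence relation on twisted vector bundles. -/
instance bundleSetoid (L : Gerbe d C) : Setoid (TwistedBundle L) where
  r E F := Nonempty (Iso E F)
  iseqv := ⟨fun E => ⟨Iso.refl E⟩, fun ⟨φ⟩ => ⟨φ.symm⟩, fun ⟨φ⟩ ⟨ψ⟩ => ⟨φ.trans ψ⟩⟩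

/-- The monoid of isomorphism classes of `λ`-twisted vector bundles. -/
def Vect (L : Gerbe d C) := Quotient (bundleSetoid L)

/-- The isomorphism class of a twisted vector bundle. -/
def Vect.mk (E : TwistedBundle L) : Vect L := Quotient.mk _ E

instance : Zero (Vect L) := ⟨Vect.mk (TwistedBundle.zero L)⟩

instance : Add (Vect L) :=
  ⟨Quotient.map₂ TwistedBundle.sum fun _ _ ⟨φ⟩ _ _ ⟨ψ⟩ => ⟨φ.sum ψ⟩⟩

lemma Vect.add_comm' (a b : Vect L) : a + b = b + a := by
  induction a, b using Quotient.inductionOn₂ with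
  | _ E F =>
    exact Quotient.sound ⟨Iso.ofEquiv (commEquiv _ _).symm fun _ _ _ => blockSum_comm _ _⟩

lemma Vect.zero_add' (a : Vect L) : 0 + a = a := by
  induction a using Quotient.inductionOn with
  | _ E =>
    exact Quotient.sound ⟨Iso.ofEquiv (zeroEquiv _).symm fun _ _ _ => blockSum_zero_left _ _⟩

lemma Vect.add_assoc' (a b c : Vect L) : a + b + c = a + (b + c) := by
  induction a, b, c using Quotient.inductionOn₃ with
  | _ E F G =>
    exact Quotient.sound ⟨Iso.ofEquiv (assocEquiv _ _ _).symm fun _ _ _ => blockSum_assoc _ _ _⟩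

instance : AddCommMonoid (Vect L) where
  add_assoc := Vect.add_assoc'
  zero_add := Vect.zero_add'
  add_zero a := (Vect.add_comm' a 0).trans (Vect.zero_add' a)
  add_comm := Vect.add_comm'
  nsmul := nsmulRec

/-- The twisted K-group `K⁰(𝒰, λ)`: the Grothendieck group of the monoid of isomorphism classes
of `λ`-twisted vector bundles. -/
abbrev K0 (L : Gerbe d C) := Algebra.GrothendieckAddGroup (Vect L)

/-- The class `[E]` of a twisted vector bundle in twisted K-theory. -/
def K0.mk (E : TwistedBundle L) : K0 L := Algebra.GrothendieckAddGroup.of (Vect.mk E)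

end Twists

/-! ### Chern–Simons forms -/

section ChernSimons

/- The forms on `X × I` at a point `(x, t)` are the elements of `Ext (Eucl d × ℝ)`. -/

/-- Pull-back of forms along the projection `p : X × I → X`. -/
def cylPull (d : ℕ) : Ext (Eucl d) →ₐ[ℂ] Ext (Eucl d × ℝ) :=
  pullback (LinearMap.fst ℝ (Eucl d) ℝ)

/-- The form `dt` on `X × I`. -/
def dt (d : ℕ) : Ext (Eucl d × ℝ) :=
  oneForm (Complex.ofRealCLM.toLinearMap ∘ₗ LinearMap.snd ℝ (Eucl d) ℝ)

/-- The value of complex covectors of `X × I` on the vector field `∂/∂t`. -/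
def evalDt (d : ℕ) : Module.Dual ℂ ((Eucl d × ℝ) →ₗ[ℝ] ℂ) where
  toFun α := α (0, 1)
  map_add' _ _ := rfl
  map_smul' _ _ := rfl

/-- The component `α` in the decomposition `α ∧ dt + β` of a form on `X × I`, where `α` and `β` do
not contain `dt`: contract with `∂/∂t` from the right, and restrict to the slice `X × {t}`. -/
def dtPart {d : ℕ} (a : Ext (Eucl d × ℝ)) : Ext (Eucl d) :=
  pullback (LinearMap.inl ℝ (Eucl d) ℝ)
    (CliffordAlgebra.contractRight (Q := (0 : QuadraticForm ℂ ((Eucl d × ℝ) →ₗ[ℝ] ℂ))) a (evalDt d))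

/-- Integration along the fibre `I = [0, 1]` of `X × I → X`, at one point of `X`:
the form `α_t ∧ dt + β_t` is sent to `∫₀¹ α_t dt`. -/
def fibreIntegral {d : ℕ} (a : ℝ → Ext (Eucl d × ℝ)) : Ext (Eucl d) :=
  (coords d).symm fun S => ∫ t in (0 : ℝ)..1, coords d (dtPart (a t)) S

/-- The derivative at time `t` of a path of forms at a point. -/
def timeDeriv {d : ℕ} (a : ℝ → Ext (Eucl d)) (t : ℝ) : Ext (Eucl d) :=
  (coords d).symm fun S => deriv (fun s => coords d (a s) S) t

variable {d : ℕ} {X : Type*} [TopologicalSpace X] [ChartedSpace (Eucl d) X]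
  {n n' : Type*} [Fintype n] [DecidableEq n] [Fintype n'] [DecidableEq n']

/-- The curvature `dΓ̃ + Γ̃ ∧ Γ̃` at `(x, t)` of the matrix of 1-forms `Γ̃ (x, t) = p^* Γ_t` on
`X × I` that is defined by a path `t ↦ Γ_t`. The exterior derivative on `X × I` is
`dΓ̃ = p^* (dΓ_t) + dt ∧ p^* (∂Γ_t/∂t)`. -/
def pathCurv (γ : ℝ → X → Matrix n n (Ext (Eucl d))) (t : ℝ) (x : X) :
    Matrix n n (Ext (Eucl d × ℝ)) :=
  (extDMat (γ t) x).map (cylPull d) +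
    Matrix.of (fun a b => dt d * cylPull d (timeDeriv (fun s => γ s x a b) t)) +
    (γ t x).map (cylPull d) * (γ t x).map (cylPull d)

/-- The total twisted Chern character form `∑_m (1 / m!) tr ((R̃ - p^* B)^m)` of the path
`t ↦ Γ_t`, at the point `(x, t)` of `X × I`. The entries of `R̃ - p^* B` are of degree two, so
the terms with `m > d + 1` vanish because `X × I` is of dimension `d + 1`. -/
def pathCh (B : X → Ext (Eucl d)) (γ : ℝ → X → Matrix n n (Ext (Eucl d))) (t : ℝ) (x : X) :
    Ext (Eucl d × ℝ) :=
  ∑ m ∈ Finset.range (d + 2), ((m.factorial : ℂ)⁻¹) •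
    ((pathCurv γ t x - Matrix.diagonal fun _ => cylPull d (B x)) ^ m).trace

/-- The twisted Chern–Simons form of a path, in terms of the local data over one open set of the
cover: the integral along the fibre of the total twisted Chern character form on `X × I`. -/
def csForm (B : X → Ext (Eucl d)) (γ : ℝ → X → Matrix n n (Ext (Eucl d))) (x : X) :
    Ext (Eucl d) :=
  fibreIntegral fun t => pathCh B γ t x

/-- The straight path `t ↦ (1 - t) Γ₀ + t Γ₁`. -/
def straightPath (Γ₀ Γ₁ : X → Matrix n n (Ext (Eucl d))) (t : ℝ) (x : X) :
    Matrix n n (Ext (Eucl d)) :=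
  (1 - t : ℂ) • Γ₀ x + (t : ℂ) • Γ₁ x

lemma dtPart_cylPull (a : Ext (Eucl d)) : dtPart (cylPull d a) = 0 := by
  have key : ∀ a : Ext (Eucl d), CliffordAlgebra.contractRight
      (Q := (0 : QuadraticForm ℂ ((Eucl d × ℝ) →ₗ[ℝ] ℂ))) (cylPull d a) (evalDt d) = 0 := by
    intro a
    induction a using CliffordAlgebra.right_induction with
    | algebraMap r => 
      rw [AlgHom.commutes]
      exact CliffordAlgebra.contractRight_algebraMap
        (Q := (0 : QuadraticForm ℂ ((Eucl d × ℝ) →ₗ[ℝ] ℂ))) (evalDt d) r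
    | add x y hx hy => rw [map_add, map_add, LinearMap.add_apply, hx, hy, add_zero]
    | mul_ι m x hx =>
      rw [map_mul]
      have : cylPull d (CliffordAlgebra.ι 0 m) = CliffordAlgebra.ι
          (0 : QuadraticForm ℂ ((Eucl d × ℝ) →ₗ[ℝ] ℂ)) (m ∘ₗ LinearMap.fst ℝ (Eucl d) ℝ) :=
        ExteriorAlgebra.map_apply_ι _ _
      rw [this, CliffordAlgebra.contractRight_mul_ι, hx]
      simp [evalDt]
  simp [dtPart, key]

lemma dtPart_add (a b : Ext (Eucl d × ℝ)) : dtPart (a + b) = dtPart a + dtPart b := by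
  simp [dtPart]

lemma timeDeriv_const (a : Ext (Eucl d)) (t : ℝ) : timeDeriv (fun _ => a) t = 0 := by
  simp only [timeDeriv, deriv_const]
  exact map_zero _

lemma extDMat_submatrix {m m' : Type*} (e : n' → n) (e' : m' → m)
    (Γ : X → Matrix n m (Ext (Eucl d))) (x : X) :
    extDMat (fun y => (Γ y).submatrix e e') x = (extDMat Γ x).submatrix e e' := rfl

lemma pathCurv_submatrix (e : n' ≃ n) (γ : ℝ → X → Matrix n n (Ext (Eucl d))) (t : ℝ) (x : X) :
    pathCurv (fun t x => (γ t x).submatrix e e) t x = (pathCurv γ t x).submatrix e e := by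
  simp only [pathCurv, extDMat_submatrix]
  rw [Matrix.submatrix_add, Matrix.submatrix_add, Pi.add_apply, Pi.add_apply,
    ← Matrix.submatrix_mul_equiv _ _ e e e]
  rfl

lemma csForm_submatrix (e : n' ≃ n) (B : X → Ext (Eucl d))
    (γ : ℝ → X → Matrix n n (Ext (Eucl d))) (x : X) :
    csForm B (fun t x => (γ t x).submatrix e e) x = csForm B γ x := by
  have hpow : ∀ (M : Matrix n n (Ext (Eucl d × ℝ))) (k : ℕ),
      (M.submatrix e e) ^ k = (M ^ k).submatrix e e := by
    intro M k
    induction k with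
    | zero => simp
    | succ k ih => rw [pow_succ, ih, Matrix.submatrix_mul_equiv, pow_succ]
  have htr : ∀ M : Matrix n n (Ext (Eucl d × ℝ)), (M.submatrix e e).trace = M.trace := by
    intro M
    exact e.sum_comp fun i => M i i
  unfold csForm
  congr 1
  funext t
  simp only [pathCh, pathCurv_submatrix]
  refine Finset.sum_congr rfl fun m _ => ?_
  congr 1
  rw [← htr, ← hpow]
  congr 2
  ext a b
  simp [Matrix.diagonal_apply]

lemma extDMat_blockSum {m k m' k' : ℕ} (Γ : X → Matrix (Fin m) (Fin k) (Ext (Eucl d)))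
    (Δ : X → Matrix (Fin m') (Fin k') (Ext (Eucl d))) (x : X) :
    extDMat (fun y => blockSum (Γ y) (Δ y)) x = blockSum (extDMat Γ x) (extDMat Δ x) := by
  ext a b
  obtain ⟨a, rfl⟩ := finSumFinEquiv.surjective a
  obtain ⟨b, rfl⟩ := finSumFinEquiv.surjective b
  rcases a with a | a <;> rcases b with b | b <;> simp [blockSum, extDMat, extD_zero]

lemma straightPath_self (Γ : X → Matrix n n (Ext (Eucl d))) :
    straightPath Γ Γ = fun _ x => Γ x := by
  funext t x
  rw [straightPath, ← add_smul]
  simp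

lemma straightPath_submatrix (e : n' → n) (Γ₀ Γ₁ : X → Matrix n n (Ext (Eucl d))) :
    straightPath (fun x => (Γ₀ x).submatrix e e) (fun x => (Γ₁ x).submatrix e e) =
      fun t x => (straightPath Γ₀ Γ₁ t x).submatrix e e := rfl

lemma straightPath_blockSum {m k : ℕ} (Γ₀ Γ₁ : X → Matrix (Fin m) (Fin m) (Ext (Eucl d)))
    (Δ : X → Matrix (Fin k) (Fin k) (Ext (Eucl d))) :
    straightPath (fun x => blockSum (Γ₀ x) (Δ x)) (fun x => blockSum (Γ₁ x) (Δ x)) =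
      fun t x => blockSum (straightPath Γ₀ Γ₁ t x) (Δ x) := by
  funext t x
  ext a b
  obtain ⟨a, rfl⟩ := finSumFinEquiv.surjective a
  obtain ⟨b, rfl⟩ := finSumFinEquiv.surjective b
  rcases a with a | a <;> rcases b with b | b <;> 
    simp [blockSum, straightPath, sub_smul, -Complex.coe_smul]

/-- The curvature of a constant path does not contain `dt`. -/
lemma pathCurv_const (Δ : X → Matrix n n (Ext (Eucl d))) (t : ℝ) (x : X) :
    pathCurv (fun _ => Δ) t x = (extDMat Δ x + Δ x * Δ x).map (cylPull d) := by
  ext a b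
  simp [pathCurv, timeDeriv_const, Matrix.mul_apply]

lemma dtPart_pathCh_const (B : X → Ext (Eucl d)) (Δ : X → Matrix n n (Ext (Eucl d))) (t : ℝ)
    (x : X) : dtPart (pathCh B (fun _ => Δ) t x) = 0 := by
  have h : pathCh B (fun _ => Δ) t x = cylPull d (∑ m ∈ Finset.range (d + 2),
      ((m.factorial : ℂ)⁻¹) • ((extDMat Δ x + Δ x * Δ x - Matrix.diagonal fun _ => B x) ^ m).trace) := by
    rw [map_sum]
    refine Finset.sum_congr rfl fun m _ => ?_
    rw [map_smul]
    congr 1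
    rw [AddMonoidHom.map_trace, pathCurv_const]
    congr 1
    change _ = (cylPull d).mapMatrix _
    rw [map_pow, map_sub]
    congr 2
    ext a b
    simp only [Matrix.diagonal_apply, AlgHom.mapMatrix_apply, Matrix.map_apply]
    split_ifs <;> simp
  rw [h, dtPart_cylPull]

lemma csForm_const (B : X → Ext (Eucl d)) (Δ : X → Matrix n n (Ext (Eucl d))) (x : X) :
    csForm B (fun _ => Δ) x = 0 := by
  simp only [csForm, fibreIntegral, dtPart_pathCh_const]
  simp only [map_zero, Pi.zero_apply, intervalIntegral.integral_zero]
  exact map_zero _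

lemma pathCurv_blockSum {m k : ℕ} (γ : ℝ → X → Matrix (Fin m) (Fin m) (Ext (Eucl d)))
    (δ : ℝ → X → Matrix (Fin k) (Fin k) (Ext (Eucl d))) (t : ℝ) (x : X) :
    pathCurv (fun t x => blockSum (γ t x) (δ t x)) t x =
      blockSum (pathCurv γ t x) (pathCurv δ t x) := by
  simp only [pathCurv, extDMat_blockSum, blockSum_map _ (map_zero _), blockSum_mul]
  rw [← blockSum_add, ← blockSum_add]
  congr 2
  ext a b
  obtain ⟨a, rfl⟩ := finSumFinEquiv.surjective a
  obtain ⟨b, rfl⟩ := finSumFinEquiv.surjective b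
  rcases a with a | a <;> rcases b with b | b <;> simp [blockSum, timeDeriv_const]

lemma pathCh_blockSum {m k : ℕ} (B : X → Ext (Eucl d))
    (γ : ℝ → X → Matrix (Fin m) (Fin m) (Ext (Eucl d)))
    (δ : ℝ → X → Matrix (Fin k) (Fin k) (Ext (Eucl d))) (t : ℝ) (x : X) :
    pathCh B (fun t x => blockSum (γ t x) (δ t x)) t x = pathCh B γ t x + pathCh B δ t x := by
  have hpow : ∀ (P : Matrix (Fin m) (Fin m) (Ext (Eucl d × ℝ)))
      (Q : Matrix (Fin k) (Fin k) (Ext (Eucl d × ℝ))) (r : ℕ),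
      (blockSum P Q) ^ r = blockSum (P ^ r) (Q ^ r) := by
    intro P Q r
    induction r with
    | zero => simp [blockSum_one]
    | succ r ih => rw [pow_succ, ih, blockSum_mul, pow_succ, pow_succ]
  simp only [pathCh, ← Finset.sum_add_distrib, ← smul_add]
  refine Finset.sum_congr rfl fun r _ => ?_
  rw [pathCurv_blockSum, ← blockSum_diagonal, blockSum_sub, hpow, blockSum_trace]

lemma csForm_blockSum_const {m k : ℕ} (B : X → Ext (Eucl d))
    (γ : ℝ → X → Matrix (Fin m) (Fin m) (Ext (Eucl d)))
    (Δ : X → Matrix (Fin k) (Fin k) (Ext (Eucl d))) (x : X) :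
    csForm B (fun t x => blockSum (γ t x) (Δ x)) x = csForm B γ x := by
  have h : ∀ t, dtPart (pathCh B (fun t x => blockSum (γ t x) (Δ x)) t x) =
      dtPart (pathCh B γ t x) := by
    intro t
    rw [pathCh_blockSum B γ (fun _ => Δ), dtPart_add, dtPart_pathCh_const, add_zero]
  simp only [csForm, fibreIntegral, h]

end ChernSimons

/-! ### Connections and the twisted differential K-group -/

section Differential

variable {d : ℕ} {X : Type*} [TopologicalSpace X] [ChartedSpace (Eucl d) X] {ι : Type*}
  {C : OpenCover ι X} {T : GerbeConn d C}

/-- A connection on a twisted vector bundle `E`, compatible with the connection of the gerbe: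
smooth `𝔲(n)`-valued 1-forms `Γ_i` on `U_i` with
`Γ_i - g_ji⁻¹ Γ_j g_ji - g_ji⁻¹ dg_ji = -A_ji · 1`. Here `g_ji⁻¹ = g_jiᴴ`. -/
structure Connection (E : TwistedBundle T.toGerbe) where
  Γ : (i : ι) → X → Matrix (Fin E.rank) (Fin E.rank) (Ext (Eucl d))
  skew : ∀ i, ∀ x ∈ C.U i, IsSkewOneForm (Γ i x)
  smooth : ∀ i a b, IsSmoothOn (fun x => Γ i x a b) (C.U i)
  compat : ∀ j i, ∀ x ∈ C.U j ∩ C.U i,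
    Γ i x - toForm d (E.g j i x)ᴴ * Γ j x * toForm d (E.g j i x) -
      toForm d (E.g j i x)ᴴ * extDMat (fun y => toForm d (E.g j i y)) x =
    -Matrix.diagonal fun _ => T.A j i x

/-- The direct sum of connections. -/
def Connection.sum {E F : TwistedBundle T.toGerbe} (Γ : Connection E) (Δ : Connection F) :
    Connection (E.sum F) where
  Γ i x := blockSum (Γ.Γ i x) (Δ.Γ i x)
  skew i x hx := by
    obtain ⟨α, hα, h⟩ := Γ.skew i x hx
    obtain ⟨β, hβ, h'⟩ := Δ.skew i x hx
    refine ⟨blockSum α β, ?_, ?_⟩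
    · intro v a b
      obtain ⟨a, rfl⟩ := finSumFinEquiv.surjective a
      obtain ⟨b, rfl⟩ := finSumFinEquiv.surjective b
      rcases a with a | a <;> rcases b with b | b
      · simpa [blockSum] using hα v a b
      · simp [blockSum]
      · simp [blockSum]
      · simpa [blockSum] using hβ v a b
    · rw [h, h']
      exact (blockSum_map _ (map_zero _) _ _).symm
  smooth i a b := by
    obtain ⟨a, rfl⟩ := finSumFinEquiv.surjective a
    obtain ⟨b, rfl⟩ := finSumFinEquiv.surjective b
    rcases a with a | a <;> rcases b with b | b
    · simpa [blockSum] using Γ.smooth i a b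
    · simpa [blockSum] using IsSmoothOn.zero _
    · simpa [blockSum] using IsSmoothOn.zero _
    · simpa [blockSum] using Δ.smooth i a b
  compat j i x hx := by
    have hg : ∀ y, (toForm d ((E.sum F).g j i y) : Matrix _ _ (Ext (Eucl d))) =
        blockSum (toForm d (E.g j i y)) (toForm d (F.g j i y)) :=
      fun y => blockSum_map _ (map_zero _) _ _
    have hg' : (toForm d ((E.sum F).g j i x)ᴴ : Matrix _ _ (Ext (Eucl d))) =
        blockSum (toForm d (E.g j i x)ᴴ) (toForm d (F.g j i x)ᴴ) :=
      (congrArg (toForm d) (blockSum_conjTranspose _ _)).trans (blockSum_map _ (map_zero _) _ _)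
    have hd : extDMat (fun y => (toForm d ((E.sum F).g j i y) : Matrix _ _ (Ext (Eucl d)))) x =
        blockSum (extDMat (fun y => toForm d (E.g j i y)) x)
          (extDMat (fun y => toForm d (F.g j i y)) x) :=
      (congrArg (fun f => extDMat f x) (funext hg)).trans (extDMat_blockSum _ _ x)
    have key : blockSum (Γ.Γ i x) (Δ.Γ i x) -
        blockSum (toForm d (E.g j i x)ᴴ) (toForm d (F.g j i x)ᴴ) * blockSum (Γ.Γ j x) (Δ.Γ j x) *
          blockSum (toForm d (E.g j i x)) (toForm d (F.g j i x)) -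
        blockSum (toForm d (E.g j i x)ᴴ) (toForm d (F.g j i x)ᴴ) *
          blockSum (extDMat (fun y => toForm d (E.g j i y)) x)
            (extDMat (fun y => toForm d (F.g j i y)) x) =
        -Matrix.diagonal fun _ => T.A j i x := by
      rw [blockSum_mul, blockSum_mul, blockSum_mul, blockSum_sub, blockSum_sub, Γ.compat j i x hx,
        Δ.compat j i x hx, ← blockSum_diagonal, ← sub_eq_zero, sub_neg_eq_add, blockSum_add]
      simp [blockSum_zero]
    rw [hg', hg, hd]
    exact key

variable (T) in
/-- The zero connection on the twisted vector bundle of rank zero. -/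
def Connection.zero : Connection (TwistedBundle.zero T.toGerbe) where
  Γ _ _ := 0
  skew _ _ _ := ⟨0, fun _ a => a.elim0, by ext a; exact a.elim0⟩
  smooth _ a := a.elim0
  compat _ _ _ _ := by ext a; exact a.elim0

/-- The local forms `φ_i⁻¹ Γ_i φ_i + φ_i⁻¹ dφ_i` of the pull-back of a connection along
an isomorphism of twisted vector bundles. -/
def Iso.pullConn {E F : TwistedBundle T.toGerbe} (φ : Iso E F) (Γ : Connection F) (i : ι) (x : X) :
    Matrix (Fin E.rank) (Fin E.rank) (Ext (Eucl d)) :=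
  toForm d (φ.f i x)ᴴ * Γ.Γ i x * toForm d (φ.f i x) +
    toForm d (φ.f i x)ᴴ * extDMat (fun y => toForm d (φ.f i y)) x

/-- The additive group of smooth complex differential forms on `X` of even (`s = 0`) or odd
(`s = 1`) degree. -/
def Forms (d : ℕ) (X : Type*) [TopologicalSpace X] [ChartedSpace (Eucl d) X] (s : ZMod 2) :
    AddSubgroup (X → Ext (Eucl d)) where
  carrier := {w | (∀ x, w x ∈ parity (Eucl d) s) ∧ IsSmoothOn w Set.univ}
  zero_mem' := ⟨fun _ => zero_mem _, IsSmoothOn.zero _⟩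
  add_mem' ha hb := ⟨fun x => add_mem (ha.1 x) (hb.1 x), ha.2.add hb.2⟩
  neg_mem' ha := ⟨fun x => neg_mem (ha.1 x), ha.2.neg⟩

/-- The group `Ω^odd(X; ℂ)`. -/
abbrev OddForms (d : ℕ) (X : Type*) [TopologicalSpace X] [ChartedSpace (Eucl d) X] : Type _ :=
  Forms d X 1

variable (T) in
/-- The subgroup `Im(d + H)` of `Ω^odd(X; ℂ)`: all `dη + H ∧ η` with `η` an even form. -/
def exactForms : AddSubgroup (OddForms d X) where
  carrier := {w | ∃ u ∈ Forms d X 0, ∀ x, w.1 x = extD u x + T.H x * u x}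
  zero_mem' := ⟨0, zero_mem _, fun x => by
    change (0 : Ext (Eucl d)) = extD (fun _ => 0) x + T.H x * 0
    rw [extD_zero, mul_zero, add_zero]⟩
  add_mem' := by
    rintro a b ⟨u, hu, ha⟩ ⟨v, hv, hb⟩
    refine ⟨u + v, add_mem hu hv, fun x => ?_⟩
    have h := extD_add hu.2 hv.2 x
    change a.1 x + b.1 x = extD (fun x => u x + v x) x + T.H x * (u x + v x)
    rw [h, ha, hb, mul_add]
    abel
  neg_mem' := by
    rintro a ⟨u, hu, ha⟩
    refine ⟨-u, neg_mem hu, fun x => ?_⟩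
    change -a.1 x = extD (fun x => -u x) x + T.H x * (-u x)
    rw [extD_neg, ha, mul_neg]
    abel

variable (T) in
/-- `w` is the twisted Chern–Simons form `cs` of the straight path between two connections on
a twisted vector bundle (given by their local forms): it is the global form whose restriction to
each `U_i` is the fibre integral of the Chern character form of the path. -/
def IsCS {n : ℕ} (Γ₀ Γ₁ : ι → X → Matrix (Fin n) (Fin n) (Ext (Eucl d))) (w : OddForms d X) :
    Prop :=
  ∀ i, ∀ x ∈ C.U i, w.1 x = csForm (T.B i) (straightPath (Γ₀ i) (Γ₁ i)) x

variable (T) in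
/-- The odd twisted Chern character forms `Ch(E, φ, Γ) = cs(t ↦ (1 - t) Γ + t φ^*Γ)`, for
a twisted vector bundle `E` with automorphism `φ` and compatible connection `Γ`. -/
def oddChernForms : Set (OddForms d X) :=
  {w | ∃ (E : TwistedBundle T.toGerbe) (φ : Iso E E) (Γ : Connection E),
    IsCS T Γ.Γ (φ.pullConn Γ) w}

variable (T) in
/-- The group `Ω_{H,Ch} = Im(Ch) + Im(d + H)`. -/
def OmegaHCh : AddSubgroup (OddForms d X) :=
  AddSubgroup.closure (oddChernForms T) ⊔ exactForms T

variable (T) in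
/-- A generator `(E, Γ, w)`: a twisted vector bundle, a compatible connection, and an odd form
modulo `Im(d + H)`. -/
structure Generator where
  E : TwistedBundle T.toGerbe
  Γ : Connection E
  w : OddForms d X ⧸ exactForms T

/-- The sum `(E ⊕ F, Γ ⊕ Δ, w + u)` of generators. -/
def Generator.sum (a b : Generator T) : Generator T :=
  ⟨a.E.sum b.E, a.Γ.sum b.Γ, a.w + b.w⟩

/-- Equivalence of generators: there are a twisted vector bundle with connection `(F, Γ^F)` and an
isomorphism `φ : E ⊕ F → E' ⊕ F` with `CS(Γ ⊕ Γ^F, φ^*(Γ' ⊕ Γ^F)) = w - w'` modulo `Im(d + H)`.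
The Chern–Simons class `CS` is independent of the path of connections; it is computed here with
the straight path. -/
def Generator.Rel (a b : Generator T) : Prop :=
  ∃ (F : TwistedBundle T.toGerbe) (ΓF : Connection F) (φ : Iso (a.E.sum F) (b.E.sum F))
    (cs : OddForms d X), IsCS T (a.Γ.sum ΓF).Γ (φ.pullConn (b.Γ.sum ΓF)) cs ∧
      (QuotientAddGroup.mk cs : OddForms d X ⧸ exactForms T) = a.w - b.w

/-- Transport of the pull-back of a connection along identifications of the index sets. -/
lemma Iso.pullConn_reindex {E F E' F' : TwistedBundle T.toGerbe} (φ : Iso E F)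
    (e : Fin E'.rank ≃ Fin E.rank) (e' : Fin F'.rank ≃ Fin F.rank)
    (hE : ∀ j i x, E'.g j i x = (E.g j i x).submatrix e e)
    (hF : ∀ j i x, F'.g j i x = (F.g j i x).submatrix e' e')
    (Γ : Connection F) (Γ' : Connection F')
    (hΓ : ∀ i x, Γ'.Γ i x = (Γ.Γ i x).submatrix e' e') (i : ι) (x : X) :
    (φ.reindex e e' hE hF).pullConn Γ' i x = (φ.pullConn Γ i x).submatrix e e := by
  have h1 : (toForm d ((φ.reindex e e' hE hF).f i x)ᴴ : Matrix _ _ (Ext (Eucl d))) =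
      (toForm d (φ.f i x)ᴴ).submatrix e e' := rfl
  have h2 : (toForm d ((φ.reindex e e' hE hF).f i x) : Matrix _ _ (Ext (Eucl d))) =
      (toForm d (φ.f i x)).submatrix e' e := rfl
  have h3 : extDMat (fun y => (toForm d ((φ.reindex e e' hE hF).f i y) :
      Matrix _ _ (Ext (Eucl d)))) x =
      (extDMat (fun y => (toForm d (φ.f i y) : Matrix _ _ (Ext (Eucl d)))) x).submatrix e' e := rfl
  rw [Iso.pullConn, h1, h2, h3, hΓ, Matrix.submatrix_mul_equiv, Matrix.submatrix_mul_equiv,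
    Matrix.submatrix_mul_equiv]
  rfl

lemma Iso.pullConn_refl {E : TwistedBundle T.toGerbe} (Γ : Connection E) (i : ι) (x : X) :
    (Iso.refl E).pullConn Γ i x = Γ.Γ i x := by
  have h := extDMat_toForm_const (d := d) (1 : Matrix (Fin E.rank) (Fin E.rank) ℂ) x
  simp only [Iso.pullConn, Iso.refl, h]
  simp [toForm]

lemma Iso.pullConn_sum {E F E' F' : TwistedBundle T.toGerbe} (φ : Iso E E') (ψ : Iso F F')
    (Γ : Connection E') (Δ : Connection F') (i : ι) (x : X) :
    (φ.sum ψ).pullConn (Γ.sum Δ) i x = blockSum (φ.pullConn Γ i x) (ψ.pullConn Δ i x) := by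
  have h1 : (toForm d ((φ.sum ψ).f i x)ᴴ : Matrix _ _ (Ext (Eucl d))) =
      blockSum (toForm d (φ.f i x)ᴴ) (toForm d (ψ.f i x)ᴴ) :=
    (congrArg (toForm d) (blockSum_conjTranspose _ _)).trans (blockSum_map _ (map_zero _) _ _)
  have h2 : ∀ y, (toForm d ((φ.sum ψ).f i y) : Matrix _ _ (Ext (Eucl d))) =
      blockSum (toForm d (φ.f i y)) (toForm d (ψ.f i y)) :=
    fun y => blockSum_map _ (map_zero _) _ _
  have h3 : extDMat (fun y => (toForm d ((φ.sum ψ).f i y) : Matrix _ _ (Ext (Eucl d)))) x =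
      blockSum (extDMat (fun y => toForm d (φ.f i y)) x)
        (extDMat (fun y => toForm d (ψ.f i y)) x) :=
    (congrArg (fun f => extDMat f x) (funext h2)).trans (extDMat_blockSum _ _ x)
  have key : blockSum (toForm d (φ.f i x)ᴴ) (toForm d (ψ.f i x)ᴴ) * blockSum (Γ.Γ i x) (Δ.Γ i x) *
      blockSum (toForm d (φ.f i x)) (toForm d (ψ.f i x)) +
      blockSum (toForm d (φ.f i x)ᴴ) (toForm d (ψ.f i x)ᴴ) *
        blockSum (extDMat (fun y => toForm d (φ.f i y)) x)
          (extDMat (fun y => toForm d (ψ.f i y)) x) =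
      blockSum (φ.pullConn Γ i x) (ψ.pullConn Δ i x) := by
    rw [blockSum_mul, blockSum_mul, blockSum_mul, blockSum_add]
    rfl
  rw [← key, ← h1, ← h2, ← h3]
  rfl

/-- Isomorphic bundles with the same connection and the same form are equivalent. -/
lemma Generator.Rel.of_iso {a b : Generator T} (φ : Iso a.E b.E)
    (hΓ : ∀ i x, φ.pullConn b.Γ i x = a.Γ.Γ i x) (hw : a.w = b.w) : a.Rel b := by
  refine ⟨TwistedBundle.zero _, Connection.zero T, φ.sum (Iso.refl _), 0, ?_, ?_⟩
  · intro i x _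
    have h : (φ.sum (Iso.refl _)).pullConn (b.Γ.sum (Connection.zero T)) i =
        (a.Γ.sum (Connection.zero T)).Γ i := by
      funext x
      rw [Iso.pullConn_sum, hΓ, Iso.pullConn_refl]
      rfl
    rw [h, straightPath_self]
    exact (csForm_const _ _ _).symm
  · rw [hw, sub_self]; rfl

lemma Generator.Rel.of_equiv {a b : Generator T} (e : Fin b.E.rank ≃ Fin a.E.rank)
    (hg : ∀ j i x, b.E.g j i x = (a.E.g j i x).submatrix e e)
    (hΓ : ∀ i x, b.Γ.Γ i x = (a.Γ.Γ i x).submatrix e e) (hw : a.w = b.w) : a.Rel b :=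
  Generator.Rel.of_iso (Iso.ofEquiv e hg) (fun i x =>
    ((Iso.refl a.E).pullConn_reindex (Equiv.refl _) e (fun _ _ _ => rfl) hg a.Γ b.Γ hΓ i x).trans
      (Iso.pullConn_refl a.Γ i x)) hw

lemma TwistedBundle.sum_swap (E G F : TwistedBundle T.toGerbe) (j i : ι) (x : X) :
    ((E.sum G).sum F).g j i x = (((E.sum F).sum G).g j i x).submatrix
      (swapEquiv E.rank G.rank F.rank) (swapEquiv E.rank G.rank F.rank) :=
  blockSum_swap (E.g j i x) (G.g j i x) (F.g j i x)

lemma Connection.sum_swap {E G F : TwistedBundle T.toGerbe} (Γ : Connection E) (Δ : Connection G)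
    (Θ : Connection F) (i : ι) (x : X) :
    ((Γ.sum Δ).sum Θ).Γ i x = (blockSum ((Γ.sum Θ).Γ i x) (Δ.Γ i x)).submatrix
      (swapEquiv E.rank G.rank F.rank) (swapEquiv E.rank G.rank F.rank) :=
  blockSum_swap (Γ.Γ i x) (Δ.Γ i x) (Θ.Γ i x)

/-- The isomorphism `(E ⊕ G) ⊕ F → (E' ⊕ G) ⊕ F` induced by `E ⊕ F → E' ⊕ F`. -/
def Iso.swapSum {E E' F : TwistedBundle T.toGerbe} (φ : Iso (E.sum F) (E'.sum F))
    (G : TwistedBundle T.toGerbe) : Iso ((E.sum G).sum F) ((E'.sum G).sum F) :=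
  (φ.sum (Iso.refl G)).reindex (E' := (E.sum G).sum F) (F' := (E'.sum G).sum F)
    (swapEquiv E.rank G.rank F.rank) (swapEquiv E'.rank G.rank F.rank)
    (E.sum_swap G F) (E'.sum_swap G F)

lemma Iso.pullConn_swapSum {E E' F G : TwistedBundle T.toGerbe} (φ : Iso (E.sum F) (E'.sum F))
    (Γ : Connection E') (Δ : Connection G) (Θ : Connection F) (i : ι) (x : X) :
    (φ.swapSum G).pullConn ((Γ.sum Δ).sum Θ) i x =
      (blockSum (φ.pullConn (Γ.sum Θ) i x) (Δ.Γ i x)).submatrix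
        (swapEquiv E.rank G.rank F.rank) (swapEquiv E.rank G.rank F.rank) := by
  have h := (φ.sum (Iso.refl G)).pullConn_reindex (E' := (E.sum G).sum F) (F' := (E'.sum G).sum F)
    (swapEquiv E.rank G.rank F.rank) (swapEquiv E'.rank G.rank F.rank)
    (E.sum_swap G F) (E'.sum_swap G F) ((Γ.sum Θ).sum Δ) ((Γ.sum Δ).sum Θ)
    (Connection.sum_swap Γ Δ Θ) i x
  rw [Iso.pullConn_sum, Iso.pullConn_refl] at h
  exact h

lemma Generator.Rel.sum_right {a b : Generator T} (h : a.Rel b) (c : Generator T) :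
    (a.sum c).Rel (b.sum c) := by
  obtain ⟨F, ΓF, φ, cs, hcs, hw⟩ := h
  refine ⟨F, ΓF, φ.swapSum c.E, cs, ?_, ?_⟩
  · intro i x hx
    have h0 := funext (Connection.sum_swap a.Γ c.Γ ΓF i)
    have h1 := funext (φ.pullConn_swapSum b.Γ c.Γ ΓF i)
    have h2 := csForm_submatrix (swapEquiv a.E.rank c.E.rank F.rank) (T.B i)
      (straightPath (fun y => blockSum ((a.Γ.sum ΓF).Γ i y) (c.Γ.Γ i y))
        (fun y => blockSum (φ.pullConn (b.Γ.sum ΓF) i y) (c.Γ.Γ i y))) x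
    have h3 := congrArg (fun γ => csForm (T.B i) γ x) (straightPath_blockSum
      ((a.Γ.sum ΓF).Γ i) (φ.pullConn (b.Γ.sum ΓF) i) (c.Γ.Γ i))
    have h4 := csForm_blockSum_const (T.B i)
      (straightPath ((a.Γ.sum ΓF).Γ i) (φ.pullConn (b.Γ.sum ΓF) i)) (c.Γ.Γ i) x
    have h5 := congrArg₂ (fun P Q => csForm (T.B i) (straightPath P Q) x) h0 h1
    exact (hcs i x hx).trans (h5.trans (h2.trans (h3.trans h4))).symm
  · change _ = a.w + c.w - (b.w + c.w)
    rw [hw]; abel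

variable (T) in
/-- The set of equivalence classes of generators. -/
def GenMonoid := Quot (Generator.Rel (T := T))

/-- The equivalence class of a generator. -/
def GenMonoid.mk (a : Generator T) : GenMonoid T := Quot.mk _ a

variable (T) in
/-- The generator `(O, 0, w)` on the bundle of rank zero. -/
def Generator.ofForm (w : OddForms d X ⧸ exactForms T) : Generator T :=
  ⟨TwistedBundle.zero _, Connection.zero T, w⟩

lemma GenMonoid.mk_comm (a b : Generator T) : GenMonoid.mk (a.sum b) = GenMonoid.mk (b.sum a) :=
  Quot.sound (Generator.Rel.of_equiv (commEquiv _ _).symm (fun _ _ _ => blockSum_comm _ _)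
    (fun _ _ => blockSum_comm _ _) (add_comm _ _))

instance : Zero (GenMonoid T) := ⟨GenMonoid.mk (Generator.ofForm T 0)⟩

instance : Add (GenMonoid T) :=
  ⟨Quot.lift₂ (fun a b => GenMonoid.mk (a.sum b))
    (fun a b b' h => by
      rw [GenMonoid.mk_comm a b, GenMonoid.mk_comm a b']
      exact Quot.sound (h.sum_right a))
    (fun _ _ b h => Quot.sound (h.sum_right b))⟩

lemma GenMonoid.add_comm' (a b : GenMonoid T) : a + b = b + a := by
  induction a using Quot.ind
  induction b using Quot.ind
  exact GenMonoid.mk_comm _ _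

lemma GenMonoid.zero_add' (a : GenMonoid T) : 0 + a = a := by
  induction a using Quot.ind
  exact Quot.sound (Generator.Rel.of_equiv (zeroEquiv _).symm (fun _ _ _ => blockSum_zero_left _ _)
    (fun _ _ => blockSum_zero_left _ _) (zero_add _))

lemma GenMonoid.add_assoc' (a b c : GenMonoid T) : a + b + c = a + (b + c) := by
  induction a using Quot.ind
  induction b using Quot.ind
  induction c using Quot.ind
  exact Quot.sound (Generator.Rel.of_equiv (assocEquiv _ _ _).symm (fun _ _ _ => blockSum_assoc _ _ _)
    (fun _ _ => blockSum_assoc _ _ _) (add_assoc _ _ _))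

instance : AddCommMonoid (GenMonoid T) where
  add_assoc := GenMonoid.add_assoc'
  zero_add := GenMonoid.zero_add'
  add_zero a := (GenMonoid.add_comm' a 0).trans (GenMonoid.zero_add' a)
  add_comm := GenMonoid.add_comm'
  nsmul := nsmulRec

variable (T) in
/-- The twisted differential K-group `K̂⁰(𝒰, λ̂)`: the group completion of the monoid of
equivalence classes of generators. -/
abbrev KHat := Algebra.GrothendieckAddGroup (GenMonoid T)

/-- The class `[(E, Γ, w)]` of a generator in the twisted differential K-group. -/
def KHat.mk (a : Generator T) : KHat T := Algebra.GrothendieckAddGroup.of (GenMonoid.mk a)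

end Differential

end TwistedK

end

open scoped Manifold ContDiff Matrix

set_option linter.unusedSectionVars false

noncomputable section

/-! The theorem rests on two properties of the Chern–Simons class modulo Im(d + H). It is additive
on triangles, CS(Γ₀, Γ₁) + CS(Γ₁, Γ₂) = CS(Γ₀, Γ₂) (`IsCS.triangle`), and it does not change when
both connections are pulled back along an isomorphism (`IsCS.pull`). Together they make the relation
on generators an equivalence relation (`Generator.rel_equivalence`). Stabilisation by a further
bundle is built into that relation, so the monoid of classes is cancellative, and two generators
have the same class in the group completion exactly when they are equivalent (`KHat.mk_eq_iff`).

Exactness is then formal. An equivalence between (O, 0, θ) and (O, 0, 0) is an automorphism φ of a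
bundle with connection Γ such that cs(Γ, φ^*Γ) = θ modulo Im(d + H). Conversely, such an
automorphism identifies (E, Γ, θ) with (E, Γ, 0), and [(E, Γ, 0)] cancels. If [E] = [E'] in
K-theory, choose an isomorphism E ⊕ G ≅ E' ⊕ G and a connection on G; the form ω - ω' - CS is then a
preimage of the difference of the two generators. This step and the surjectivity of I need
compatible connections to exist (`exists_connection`), which follows by averaging local ones with a
partition of unity.

For the triangle identity, put K = dΓ + Γ ∧ Γ - B. Integration along the fibre turns cs into minus
the integral, along the segment, of the one-form θ(β) = ∑ tr(β K^m) / m! on the affine space of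
connections (`csForm_eq`). The twisted Bianchi identity ∇K = -H shows that the differential of θ on
this space is (d + H) of an explicit form `chEta` (`extD_chEta`), and Stokes on the triangle
concludes (`csForm_triangle`). All local forms glue because K is only conjugated when passing from
U_j to U_i: the shift of Γ by A_ji is compensated by B_j - B_i = dA_ji (`twCurv_gauge`). -/

namespace TwistedK

/-! ### Degrees, graded commutativity and pull-back in the exterior algebra. -/

section Algebra

variable {V W : Type} [AddCommGroup V] [Module ℝ V] [AddCommGroup W] [Module ℝ W]

/-- The forms of degree `n`. -/
abbrev deg (V : Type) [AddCommGroup V] [Module ℝ V] (n : ℕ) : Submodule ℂ (Ext V) :=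
  ⋀[ℂ]^n (V →ₗ[ℝ] ℂ)

/-- The grade involution, `(-1)^n` on forms of degree `n`. -/
abbrev sgn : Ext V →ₐ[ℂ] Ext V :=
  CliffordAlgebra.involute (Q := (0 : QuadraticForm ℂ (V →ₗ[ℝ] ℂ)))

lemma sgn_ι (v : V →ₗ[ℝ] ℂ) : sgn (oneForm v) = -oneForm v :=
  CliffordAlgebra.involute_ι v

lemma deg_le_parity (n : ℕ) : deg V n ≤ parity V n :=
  le_iSup (fun j : {m : ℕ // (m : ZMod 2) = n} =>
    LinearMap.range (CliffordAlgebra.ι (0 : QuadraticForm ℂ (V →ₗ[ℝ] ℂ))) ^ (j : ℕ)) ⟨n, rfl⟩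

lemma sgn_even {a : Ext V} {n : ℕ} (ha : a ∈ deg V (2 * n)) : sgn a = a :=
  CliffordAlgebra.involute_eq_of_mem_even (by
    have := deg_le_parity _ ha
    have h : ((2 * n : ℕ) : ZMod 2) = 0 := by
      rw [ZMod.natCast_eq_zero_iff]; exact dvd_mul_right 2 n
    rwa [h] at this)

lemma sgn_odd {a : Ext V} {n : ℕ} (ha : a ∈ deg V (2 * n + 1)) : sgn a = -a :=
  CliffordAlgebra.involute_eq_of_mem_odd (by
    have := deg_le_parity _ ha
    have h : ((2 * n + 1 : ℕ) : ZMod 2) = 1 := by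
      rw [Nat.cast_add, (ZMod.natCast_eq_zero_iff _ _).2 (dvd_mul_right 2 n)]; simp
    rwa [h] at this)

/-- Both sides are multiplicative in `a` because `sgn` is an algebra map, so the rule reduces to
anticommutation of covectors. It is the source of the signs in the Leibniz rule for d. -/
lemma ι_mul_eq (v : V →ₗ[ℝ] ℂ) (a : Ext V) : oneForm v * a = sgn a * oneForm v := by
  induction a using ExteriorAlgebra.induction with
  | algebraMap r => rw [AlgHom.commutes, Algebra.commutes]
  | ι w =>
    rw [sgn_ι, neg_mul, eq_neg_iff_add_eq_zero]
    exact ExteriorAlgebra.ι_add_mul_swap v w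
  | mul a b ha hb => rw [map_mul, ← mul_assoc, ha, mul_assoc, hb, mul_assoc]
  | add a b ha hb => rw [mul_add, map_add, add_mul, ha, hb]

lemma mul_deg {a b : Ext V} {m n : ℕ} (ha : a ∈ deg V m) (hb : b ∈ deg V n) :
    a * b ∈ deg V (m + n) :=
  SetLike.mul_mem_graded (A := fun i : ℕ => deg V i) ha hb

lemma oneForm_mem (v : V →ₗ[ℝ] ℂ) : oneForm v ∈ deg V 1 := by
  rw [deg, ExteriorAlgebra.exteriorPower, pow_one]; exact ⟨v, rfl⟩

lemma mem_deg_one_iff {a : Ext V} : a ∈ deg V 1 ↔ ∃ v, a = oneForm v := by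
  rw [deg, ExteriorAlgebra.exteriorPower, pow_one]
  exact ⟨fun ⟨v, h⟩ => ⟨v, h.symm⟩, fun ⟨v, h⟩ => ⟨v, h.symm⟩⟩

lemma algebraMap_mem_deg (r : ℂ) : algebraMap ℂ (Ext V) r ∈ deg V 0 := by
  rw [deg, ExteriorAlgebra.exteriorPower, pow_zero]; exact Submodule.algebraMap_mem r

/-- Forms of even degree are central. -/
lemma even_mul_comm {a : Ext V} {n : ℕ} (ha : a ∈ deg V (2 * n)) (b : Ext V) :
    a * b = b * a := by
  induction b using ExteriorAlgebra.induction with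
  | algebraMap r => rw [Algebra.commutes]
  | ι w =>
    have := ι_mul_eq w a
    rw [sgn_even ha] at this
    exact this.symm
  | mul b c hb hc => rw [← mul_assoc, hb, mul_assoc, hc, mul_assoc]
  | add b c hb hc => rw [mul_add, add_mul, hb, hc]

lemma odd_mul_eq {a : Ext V} {n : ℕ} (ha : a ∈ deg V (2 * n + 1)) (b : Ext V) :
    a * b = sgn b * a := by
  induction b using ExteriorAlgebra.induction with
  | algebraMap r => rw [AlgHom.commutes, Algebra.commutes]
  | ι w =>
    have := ι_mul_eq w a
    rw [sgn_odd ha, neg_mul] at this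
    rw [sgn_ι, neg_mul, this, neg_neg]
  | mul b c hb hc => rw [map_mul, ← mul_assoc, hb, mul_assoc, hc, mul_assoc]
  | add b c hb hc => rw [mul_add, map_add, add_mul, hb, hc]

lemma pullback_oneForm (f : V →ₗ[ℝ] W) (α : W →ₗ[ℝ] ℂ) :
    pullback f (oneForm α) = oneForm (α ∘ₗ f) :=
  ExteriorAlgebra.map_apply_ι _ _

lemma pullback_mem_deg (f : V →ₗ[ℝ] W) {a : Ext W} {n : ℕ} (ha : a ∈ deg W n) :
    pullback f a ∈ deg V n := by
  have h : (deg W n).map (pullback f).toLinearMap ≤ deg V n := by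
    rw [deg, deg, ExteriorAlgebra.exteriorPower, ExteriorAlgebra.exteriorPower, Submodule.map_pow]
    refine pow_le_pow_left' ?_ n
    rintro _ ⟨_, ⟨v, rfl⟩, rfl⟩
    exact ⟨v ∘ₗ f, (pullback_oneForm f v).symm⟩
  exact h ⟨a, ha, rfl⟩

lemma pullback_sgn (f : V →ₗ[ℝ] W) (a : Ext W) : pullback f (sgn a) = sgn (pullback f a) := by
  induction a using ExteriorAlgebra.induction with
  | algebraMap r => simp only [AlgHom.commutes]
  | ι w =>
    change pullback f (sgn (oneForm w)) = sgn (pullback f (oneForm w))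
    rw [sgn_ι, map_neg, pullback_oneForm, sgn_ι]
  | mul b c hb hc => simp only [map_mul, hb, hc]
  | add b c hb hc => simp only [map_add, hb, hc]

lemma pullback_comp {U : Type} [AddCommGroup U] [Module ℝ U] (f : V →ₗ[ℝ] W) (g : U →ₗ[ℝ] V)
    (a : Ext W) : pullback g (pullback f a) = pullback (f ∘ₗ g) a := by
  induction a using ExteriorAlgebra.induction with
  | algebraMap r => simp only [AlgHom.commutes]
  | ι w => simp only [pullback_oneForm]; rfl
  | mul b c hb hc => simp only [map_mul, hb, hc]
  | add b c hb hc => simp only [map_add, hb, hc]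

lemma pullback_id (a : Ext W) : pullback LinearMap.id a = a := by
  induction a using ExteriorAlgebra.induction with
  | algebraMap r => simp only [AlgHom.commutes]
  | ι w => simp only [pullback_oneForm]; rfl
  | mul b c hb hc => simp only [map_mul, hb, hc]
  | add b c hb hc => simp only [map_add, hb, hc]

lemma finrank_covectors (d : ℕ) : Module.finrank ℂ (Eucl d →ₗ[ℝ] ℂ) = d := by
  rw [Module.finrank_eq_card_basis (dx d), Fintype.card_fin]

instance (d : ℕ) : Module.Finite ℂ (Eucl d →ₗ[ℝ] ℂ) := Module.Finite.of_basis (dx d)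

instance (d : ℕ) : Module.Finite ℂ (Ext (Eucl d)) :=
  Module.Finite.of_basis (dx d).ExteriorAlgebra

/-- The dimension is a binomial coefficient. This is what makes the truncation of the exponential
series harmless in `extD_chEta`. -/
lemma deg_eq_bot {d n : ℕ} (h : d < n) : deg (Eucl d) n = ⊥ := by
  have h1 := exteriorPower.finrank_eq (R := ℂ) (M := Eucl d →ₗ[ℝ] ℂ) (n := n)
  rw [finrank_covectors, Nat.choose_eq_zero_of_lt h] at h1
  exact Submodule.finrank_eq_zero.1 h1

end Algebra

/-! ### A submultiplicative norm on the exterior algebra. -/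

section Norm

variable {d : ℕ}

/-- The left regular representation of the exterior algebra in coordinates. -/
def leftRep (d : ℕ) : Ext (Eucl d) →ₐ[ℂ] ((Finset (Fin d) → ℂ) →L[ℂ] (Finset (Fin d) → ℂ)) :=
  ((Module.End.toContinuousLinearMap (Finset (Fin d) → ℂ)).toAlgHom.comp
    ((coords d).conjAlgEquiv ℂ).toAlgHom).comp (Algebra.lmul ℂ (Ext (Eucl d)))

/-- The regular representation is faithful because an element is recovered from its action on 1. -/
lemma leftRep_injective : Function.Injective (leftRep d) := by
  intro a b h
  have h' : (coords d) (a * (coords d).symm (coords d 1)) =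
      (coords d) (b * (coords d).symm (coords d 1)) := congrArg (fun L => L (coords d 1)) h
  simpa using h'

/-- The operator norm of left multiplication is submultiplicative, so `fderiv`, its product rule and
Bochner integrals apply to form-valued functions directly instead of coordinate by coordinate. -/
instance : NormedRing (Ext (Eucl d)) := NormedRing.induced _ _ (leftRep d) leftRep_injective

instance : NormedAlgebra ℂ (Ext (Eucl d)) := NormedAlgebra.induced ℂ _ _ (leftRep d)

/-- The coordinates of forms, as a real continuous linear equivalence. -/
def coordsR (d : ℕ) : Ext (Eucl d) ≃L[ℝ] (Finset (Fin d) → ℂ) :=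
  ((coords d).restrictScalars ℝ).toContinuousLinearEquiv

lemma coordsR_apply (a : Ext (Eucl d)) : coordsR d a = coords d a := rfl

/-- A continuous projection onto a space of forms. -/
lemma exists_projection (M : Submodule ℂ (Ext (Eucl d))) :
    ∃ P : Ext (Eucl d) →L[ℂ] Ext (Eucl d), (∀ a ∈ M, P a = a) ∧ ∀ a, P a ∈ M := by
  obtain ⟨p, hp⟩ := LinearMap.exists_leftInverse_of_injective M.subtype M.ker_subtype
  exact ⟨(M.subtype ∘ₗ p).toContinuousLinearMap,
    fun a ha => congrArg Subtype.val (LinearMap.congr_fun hp ⟨a, ha⟩), fun a => (p a).2⟩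

end Norm

/-! ### The exterior derivative on Euclidean space. -/

section Flat

variable {d : ℕ} {f g : Eucl d → Ext (Eucl d)} {y : Eucl d}

/-- The `j`-th standard basis vector. -/
abbrev stdVec {d : ℕ} (j : Fin d) : Eucl d := EuclideanSpace.single j 1

/-- The coordinate map is a continuous linear equivalence, so it passes through the derivative and
the coordinates drop out of `flatD`. -/
lemma flatD_eq (f : Eucl d → Ext (Eucl d)) (y : Eucl d) :
    flatD f y = ∑ j, oneForm (dx d j) * fderiv ℝ f y (stdVec j) := by
  have h : fderiv ℝ (fun z => coords d (f z)) y =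
      (coordsR d : Ext (Eucl d) →L[ℝ] _).comp (fderiv ℝ f y) :=
    (coordsR d).comp_fderiv
  unfold flatD
  refine Finset.sum_congr rfl fun j _ => ?_
  rw [h]
  congr 1
  exact (coords d).symm_apply_apply _

lemma covector_eq_sum (β : Eucl d →ₗ[ℝ] ℂ) : β = ∑ k, β (stdVec k) • dx d k := by
  have h : ∀ v : Eucl d, v = ∑ k, v k • stdVec k := fun v => by
    simpa using ((EuclideanSpace.basisFun (Fin d) ℝ).sum_repr v).symm
  ext v
  conv_lhs => rw [h v]
  simp [dx_apply, mul_comm]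

lemma sum_dx_mul_oneForm (β : Eucl d →ₗ[ℝ] ℂ) :
    ∑ j, oneForm (dx d j) * algebraMap ℂ (Ext (Eucl d)) (β (stdVec j)) = oneForm β := by
  conv_rhs => rw [covector_eq_sum β]
  rw [oneForm, map_sum]
  refine Finset.sum_congr rfl fun j _ => ?_
  rw [map_smul, Algebra.smul_def, Algebra.commutes]

/-- Exchanging the two indices changes the sign of dx^j ∧ dx^k and fixes the coefficient, so the sum
equals its own negative. Applied to second derivatives, it gives both d² = 0 and the closedness of
pulled-back constant forms. -/
lemma sum_dx_dx_symm (c : Fin d → Fin d → Ext (Eucl d)) (hc : ∀ j k, c j k = c k j) :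
    ∑ j, ∑ k, oneForm (dx d j) * (oneForm (dx d k) * c j k) = 0 := by
  have h : ∑ j, ∑ k, oneForm (dx d j) * (oneForm (dx d k) * c j k) =
      -∑ j, ∑ k, oneForm (dx d j) * (oneForm (dx d k) * c j k) := by
    conv_lhs => rw [Finset.sum_comm]
    rw [← Finset.sum_neg_distrib]
    refine Finset.sum_congr rfl fun j _ => ?_
    rw [← Finset.sum_neg_distrib]
    refine Finset.sum_congr rfl fun k _ => ?_
    rw [hc k j, ← mul_assoc, ← mul_assoc, ← neg_mul]
    congr 1
    exact eq_neg_of_add_eq_zero_left (ExteriorAlgebra.ι_add_mul_swap _ _)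
  have h2 : (2 : ℂ) • ∑ j, ∑ k, oneForm (dx d j) * (oneForm (dx d k) * c j k) = 0 := by
    rw [two_smul]
    nth_rewrite 1 [h]
    exact neg_add_cancel _
  exact (smul_eq_zero.1 h2).resolve_left two_ne_zero

lemma flatD_congr (h : f =ᶠ[nhds y] g) : flatD f y = flatD g y := by
  simp only [flatD_eq, h.fderiv_eq]

lemma flatD_add (hf : DifferentiableAt ℝ f y) (hg : DifferentiableAt ℝ g y) :
    flatD (fun z => f z + g z) y = flatD f y + flatD g y := by
  simp only [flatD_eq, fderiv_fun_add hf hg, _root_.add_apply, mul_add,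
    Finset.sum_add_distrib]

lemma flatD_const (a : Ext (Eucl d)) : flatD (fun _ => a) y = 0 := by
  simp [flatD_eq]

/-- In the terms that differentiate the second factor, dx^j has to move past `f y`, which costs
`sgn` by `ι_mul_eq`. -/
lemma flatD_mul (hf : DifferentiableAt ℝ f y) (hg : DifferentiableAt ℝ g y) :
    flatD (fun z => f z * g z) y = flatD f y * g y + sgn (f y) * flatD g y := by
  simp only [flatD_eq, fderiv_fun_mul' hf hg, _root_.add_apply, mul_add,
    Finset.sum_add_distrib, Finset.sum_mul, Finset.mul_sum]
  rw [add_comm]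
  congr 1
  · exact Finset.sum_congr rfl fun j _ => (mul_assoc _ _ _).symm
  · refine Finset.sum_congr rfl fun j _ => ?_
    rw [← mul_assoc, ← ι_mul_eq, mul_assoc]
    rfl

lemma flatD_const_smul (c : ℂ) (hf : DifferentiableAt ℝ f y) :
    flatD (fun z => c • f z) y = c • flatD f y := by
  simp only [flatD_eq, fderiv_fun_const_smul hf, Finset.smul_sum]
  exact Finset.sum_congr rfl fun j _ => mul_smul_comm c (oneForm (dx d j)) _

lemma flatD_sum {κ : Type*} (s : Finset κ) {F : κ → Eucl d → Ext (Eucl d)}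
    (hF : ∀ k ∈ s, DifferentiableAt ℝ (F k) y) :
    flatD (fun z => ∑ k ∈ s, F k z) y = ∑ k ∈ s, flatD (F k) y := by
  simp only [flatD_eq, fderiv_fun_sum hF]
  rw [Finset.sum_comm]
  refine Finset.sum_congr rfl fun j _ => ?_
  rw [_root_.sum_apply, Finset.mul_sum]

/-- The algebra map as a continuous linear map. -/
abbrev scalarL (d : ℕ) : ℂ →L[ℝ] Ext (Eucl d) :=
  (algebraMapCLM ℂ (Ext (Eucl d))).restrictScalars ℝ

lemma flatD_algebraMap {h : Eucl d → ℂ} (hh : DifferentiableAt ℝ h y) :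
    flatD (fun z => algebraMap ℂ (Ext (Eucl d)) (h z)) y =
      oneForm (fderiv ℝ h y).toLinearMap := by
  have : fderiv ℝ (fun z => algebraMap ℂ (Ext (Eucl d)) (h z)) y =
      (scalarL d).comp (fderiv ℝ h y) :=
    ((scalarL d).hasFDerivAt.comp y hh.hasFDerivAt).fderiv
  rw [flatD_eq, this, ← sum_dx_mul_oneForm]
  rfl

lemma flatD_flatD (hf : ContDiffAt ℝ 2 f y) : flatD (flatD f) y = 0 := by
  have hd : DifferentiableAt ℝ (fderiv ℝ f) y :=
    (hf.fderiv_right (m := 1) (by norm_num)).differentiableAt (by norm_num)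
  have h : flatD f = fun z => ∑ k, oneForm (dx d k) * fderiv ℝ f z (stdVec k) :=
    funext (flatD_eq f)
  have hk : ∀ k, DifferentiableAt ℝ (fun z => fderiv ℝ f z (stdVec k)) y :=
    fun k => hd.clm_apply (differentiableAt_const _)
  rw [h, flatD_sum _ fun k _ => (differentiableAt_const _).fun_mul (hk k)]
  simp only [flatD_mul (differentiableAt_const _) (hk _), flatD_const, zero_mul, zero_add, sgn_ι,
    neg_mul, Finset.sum_neg_distrib, neg_eq_zero]
  have h2 : ∀ k, flatD (fun z => fderiv ℝ f z (stdVec k)) y =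
      ∑ j, oneForm (dx d j) * fderiv ℝ (fderiv ℝ f) y (stdVec j) (stdVec k) := fun k => by
    rw [flatD_eq]
    refine Finset.sum_congr rfl fun j _ => ?_
    rw [fderiv_clm_apply hd (differentiableAt_const _)]
    simp
  simp only [h2, Finset.mul_sum]
  refine sum_dx_dx_symm _ fun j k => ?_
  exact (hf.isSymmSndFDerivAt (by simp)).eq _ _

section Pullback

variable {τ : Eucl d → Eucl d}

/-- Composition with a covector, as a continuous linear map to one-forms. -/
def oneFormCompL (α : Eucl d →ₗ[ℝ] ℂ) : (Eucl d →L[ℝ] Eucl d) →L[ℝ] Ext (Eucl d) :=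
  LinearMap.toContinuousLinearMap
    { toFun := fun L => oneForm (α ∘ₗ L.toLinearMap)
      map_add' := fun L M => by
        rw [ContinuousLinearMap.toLinearMap_add, LinearMap.comp_add, oneForm, map_add]
      map_smul' := fun c L => by
        have : α ∘ₗ (c • L).toLinearMap = (c : ℂ) • (α ∘ₗ L.toLinearMap) := by
          ext v; simp
        rw [this, oneForm, map_smul]
        simp }

/-- For a constant covector α the pull-back is d(α ∘ τ), closed by symmetry of the second derivative
of τ; products follow from the Leibniz rule. Differentiability is proved in the same induction
because the Leibniz rule requires it. -/
lemma flatD_pullback_const (hτ : ContDiffAt ℝ 2 τ y) (a : Ext (Eucl d)) :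
    DifferentiableAt ℝ (fun z => pullback (fderiv ℝ τ z).toLinearMap a) y ∧
      flatD (fun z => pullback (fderiv ℝ τ z).toLinearMap a) y = 0 := by
  have hd : DifferentiableAt ℝ (fderiv ℝ τ) y :=
    (hτ.fderiv_right (m := 1) (by norm_num)).differentiableAt (by norm_num)
  induction a using ExteriorAlgebra.induction with
  | algebraMap r =>
    simp only [AlgHom.commutes]
    exact ⟨differentiableAt_const _, flatD_const _⟩
  | ι α =>
    have h : (fun z => pullback (fderiv ℝ τ z).toLinearMap (oneForm α)) =
        fun z => oneFormCompL α (fderiv ℝ τ z) := funext fun z => pullback_oneForm _ _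
    change DifferentiableAt ℝ (fun z => pullback (fderiv ℝ τ z).toLinearMap (oneForm α)) y ∧
      flatD (fun z => pullback (fderiv ℝ τ z).toLinearMap (oneForm α)) y = 0
    rw [h]
    refine ⟨(oneFormCompL α).differentiableAt.comp y hd, ?_⟩
    have h1 : fderiv ℝ (fun z => oneFormCompL α (fderiv ℝ τ z)) y =
        (oneFormCompL α).comp (fderiv ℝ (fderiv ℝ τ) y) :=
      ((oneFormCompL α).hasFDerivAt.comp y hd.hasFDerivAt).fderiv
    rw [flatD_eq, h1]
    have h2 : ∀ j, (oneFormCompL α).comp (fderiv ℝ (fderiv ℝ τ) y) (stdVec j) =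
        ∑ k, oneForm (dx d k) * algebraMap ℂ (Ext (Eucl d))
          (α (fderiv ℝ (fderiv ℝ τ) y (stdVec j) (stdVec k))) :=
      fun j => (sum_dx_mul_oneForm _).symm
    simp only [h2, Finset.mul_sum]
    refine sum_dx_dx_symm _ fun j k => ?_
    rw [(hτ.isSymmSndFDerivAt (by simp)).eq]
  | mul a b ha hb =>
    simp only [map_mul]
    exact ⟨ha.1.fun_mul hb.1, by rw [flatD_mul ha.1 hb.1, ha.2, hb.2, zero_mul, mul_zero, add_zero]⟩
  | add a b ha hb =>
    simp only [map_add]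
    exact ⟨ha.1.fun_add hb.1, by rw [flatD_add ha.1 hb.1, ha.2, hb.2, add_zero]⟩

/-- The exterior derivative commutes with pull-back along a smooth map. -/
lemma flatD_pullback (hτ : ContDiffAt ℝ 2 τ y) (hf : DifferentiableAt ℝ f (τ y)) :
    flatD (fun z => pullback (fderiv ℝ τ z).toLinearMap (f (τ z))) y =
      pullback (fderiv ℝ τ y).toLinearMap (flatD f (τ y)) := by
  have hτd : DifferentiableAt ℝ τ y := hτ.differentiableAt (by norm_num)
  set c : Finset (Fin d) → Eucl d → ℂ := fun S z => coordsR d (f z) S with hc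
  have hcd : ∀ S, DifferentiableAt ℝ (c S) (τ y) := fun S =>
    differentiableAt_pi.1 ((coordsR d).differentiableAt.comp _ hf) S
  have hcτ : ∀ S, DifferentiableAt ℝ (fun z => c S (τ z)) y := fun S => (hcd S).comp y hτd
  set b : Finset (Fin d) → Ext (Eucl d) := fun S => (coords d).symm (Pi.single S 1)
  -- Expanding in constant basis forms reduces the claim to the chain rule for the coefficient
  -- functions and to `flatD_pullback_const` for the basis forms.
  have hfe : ∀ z, f z = ∑ S, algebraMap ℂ (Ext (Eucl d)) (c S z) * b S := fun z => by
    apply (coords d).injective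
    rw [map_sum]
    simp only [← Algebra.smul_def, map_smul, b, LinearEquiv.apply_symm_apply]
    ext S
    simp [Pi.single_apply, hc, coordsR_apply]
  have hal : ∀ {u : Eucl d → ℂ} {z}, DifferentiableAt ℝ u z →
      DifferentiableAt ℝ (fun z => algebraMap ℂ (Ext (Eucl d)) (u z)) z := fun hu =>
    (scalarL d).differentiableAt.comp _ hu
  have hL : flatD f (τ y) = ∑ S, oneForm (fderiv ℝ (c S) (τ y)).toLinearMap * b S := by
    rw [funext hfe, flatD_sum _ fun S _ => (hal (hcd S)).fun_mul (differentiableAt_const _)]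
    refine Finset.sum_congr rfl fun S _ => ?_
    rw [flatD_mul (hal (hcd S)) (differentiableAt_const _), flatD_const, mul_zero, add_zero,
      flatD_algebraMap (hcd S)]
  have hR : (fun z => pullback (fderiv ℝ τ z).toLinearMap (f (τ z))) = fun z =>
      ∑ S, algebraMap ℂ (Ext (Eucl d)) (c S (τ z)) * pullback (fderiv ℝ τ z).toLinearMap (b S) := by
    funext z
    rw [hfe (τ z), map_sum]
    simp only [map_mul, AlgHom.commutes]
  rw [hL, hR, flatD_sum _ fun S _ => (hal (hcτ S)).fun_mul (flatD_pullback_const hτ _).1, map_sum]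
  refine Finset.sum_congr rfl fun S _ => ?_
  rw [flatD_mul (hal (hcτ S)) (flatD_pullback_const hτ _).1, (flatD_pullback_const hτ _).2,
    mul_zero, add_zero, flatD_algebraMap (hcτ S), map_mul, pullback_oneForm]
  congr 2
  have : fderiv ℝ (fun z => c S (τ z)) y = (fderiv ℝ (c S) (τ y)).comp (fderiv ℝ τ y) :=
    fderiv_comp y (hcd S) hτd
  rw [this]
  rfl

end Pullback

/-- The exterior derivative raises the degree by one. -/
lemma flatD_mem_deg {n : ℕ} (hd : DifferentiableAt ℝ f y) (h : ∀ᶠ z in nhds y, f z ∈ deg (Eucl d) n) :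
    flatD f y ∈ deg (Eucl d) (n + 1) := by
  obtain ⟨P, hP, hr⟩ := exists_projection (deg (Eucl d) n)
  -- Near y the function is fixed by a continuous projection onto the forms of degree n, hence so
  -- are its derivatives.
  have he : f =ᶠ[nhds y] fun z => P (f z) := h.mono fun z hz => (hP _ hz).symm
  have hfd : fderiv ℝ f y = (P.restrictScalars ℝ).comp (fderiv ℝ f y) := by
    conv_lhs => rw [he.fderiv_eq]
    exact ((P.restrictScalars ℝ).hasFDerivAt.comp y hd.hasFDerivAt).fderiv
  rw [flatD_eq, hfd]
  refine Submodule.sum_mem _ fun j _ => ?_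
  rw [add_comm]
  exact mul_deg (oneForm_mem _) (hr _)

end Flat

/-! ### Differential forms on the manifold, in charts. -/

section Charts

variable {d : ℕ} {X : Type*} [TopologicalSpace X] [ChartedSpace (Eucl d) X]
  {w u : X → Ext (Eucl d)} {S : Set X} {c x : X} {y : Eucl d}

/-- The part of the chart domain at `c` that corresponds to `S`. -/
abbrev chartDom (c : X) (S : Set X) : Set (Eucl d) :=
  (extChartAt (𝓡 d) c).target ∩ (extChartAt (𝓡 d) c).symm ⁻¹' S

lemma isOpen_chartDom (c : X) (hS : IsOpen S) : IsOpen (chartDom (d := d) c S) :=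
  (continuousOn_extChartAt_symm c).isOpen_inter_preimage (isOpen_extChartAt_target c) hS

lemma mem_chartDom_self (hx : x ∈ S) : extChartAt (𝓡 d) x x ∈ chartDom (d := d) x S :=
  ⟨mem_extChartAt_target x, by simpa using hx⟩

lemma isSmoothOn_iff : IsSmoothOn w S ↔ ∀ c, ContDiffOn ℝ ∞ (localRep c w) (chartDom c S) := by
  refine forall_congr' fun c => ⟨fun h => ?_, fun h => ?_⟩
  · have := (coordsR d).symm.contDiff.comp_contDiffOn h
    refine this.congr fun y _ => ?_
    exact ((coordsR d).symm_apply_apply _).symm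
  · exact (coordsR d).contDiff.comp_contDiffOn h

lemma IsSmoothOn.contDiffAt (hw : IsSmoothOn w S) (hS : IsOpen S) (hy : y ∈ chartDom c S) :
    ContDiffAt ℝ ∞ (localRep c w) y :=
  (isSmoothOn_iff.1 hw c).contDiffAt ((isOpen_chartDom c hS).mem_nhds hy)

lemma IsSmoothOn.differentiableAt_localRep (hw : IsSmoothOn w S) (hS : IsOpen S)
    (hy : y ∈ chartDom c S) : DifferentiableAt ℝ (localRep c w) y :=
  (hw.contDiffAt hS hy).differentiableAt (by simp)

lemma localRep_mul (c : X) (w u : X → Ext (Eucl d)) :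
    localRep c (fun x => w x * u x) = fun y => localRep c w y * localRep c u y := by
  funext y; simp [localRep]

lemma localRep_smul (c : X) (r : ℂ) (w : X → Ext (Eucl d)) :
    localRep c (fun x => r • w x) = fun y => r • localRep c w y := by
  funext y; simp [localRep]

lemma localRep_sum {κ : Type*} (s : Finset κ) (c : X) (W : κ → X → Ext (Eucl d)) :
    localRep c (fun x => ∑ k ∈ s, W k x) = fun y => ∑ k ∈ s, localRep c (W k) y := by
  funext y; simp [localRep]

lemma localRep_algebraMap (c : X) (f : X → ℂ) :
    localRep c (fun x => algebraMap ℂ (Ext (Eucl d)) (f x)) =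
      fun y => algebraMap ℂ (Ext (Eucl d)) (f ((extChartAt (𝓡 d) c).symm y)) := by
  funext y; simp [localRep]

lemma localRep_mem_deg {n : ℕ} (h : ∀ x ∈ S, w x ∈ deg (Eucl d) n) (hy : y ∈ chartDom c S) :
    localRep c w y ∈ deg (Eucl d) n :=
  pullback_mem_deg _ (h _ hy.2)

lemma localRep_congr (h : ∀ x ∈ S, w x = u x) (hy : y ∈ chartDom c S) :
    localRep c w y = localRep c u y := by
  simp only [localRep, h _ hy.2]

/-- The transition map from a chart to itself is the identity near the base point, so its derivative
there is the identity. This converts chart formulas at the base point into pointwise ones. -/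
lemma localRep_self (x : X) (w : X → Ext (Eucl d)) :
    localRep x w (extChartAt (𝓡 d) x x) = w x := by
  have h : (extChartAt (𝓡 d) x ∘ (extChartAt (𝓡 d) x).symm) =ᶠ[nhds (extChartAt (𝓡 d) x x)] id :=
    Filter.eventuallyEq_of_mem (extChartAt_target_mem_nhds x) fun z hz =>
      (extChartAt (𝓡 d) x).right_inv hz
  have h1 : (extChartAt (𝓡 d) x).symm (extChartAt (𝓡 d) x x) = x := extChartAt_to_inv x
  unfold localRep
  rw [h1, h.fderiv_eq, fderiv_id]
  exact pullback_id _

lemma IsSmoothOn.mono {S' : Set X} (hw : IsSmoothOn w S) (h : S' ⊆ S) : IsSmoothOn w S' :=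
  fun c => (hw c).mono fun _ hy => ⟨hy.1, h hy.2⟩

lemma IsSmoothOn.congr (hw : IsSmoothOn w S) (h : ∀ x ∈ S, u x = w x) : IsSmoothOn u S :=
  fun c => (hw c).congr fun _ hy => congrArg _ (localRep_congr h hy)

lemma IsSmoothOn.mul (hw : IsSmoothOn w S) (hu : IsSmoothOn u S) :
    IsSmoothOn (fun x => w x * u x) S :=
  isSmoothOn_iff.2 fun c => by
    rw [localRep_mul]
    exact (isSmoothOn_iff.1 hw c).mul (isSmoothOn_iff.1 hu c)

lemma IsSmoothOn.const_smul (r : ℂ) (hw : IsSmoothOn w S) : IsSmoothOn (fun x => r • w x) S :=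
  isSmoothOn_iff.2 fun c => by
    rw [localRep_smul]
    exact (isSmoothOn_iff.1 hw c).const_smul r

lemma IsSmoothOn.sub (hw : IsSmoothOn w S) (hu : IsSmoothOn u S) :
    IsSmoothOn (fun x => w x - u x) S := by
  simpa only [sub_eq_add_neg] using hw.add hu.neg

lemma IsSmoothOn.sum {κ : Type*} (s : Finset κ) {W : κ → X → Ext (Eucl d)}
    (hW : ∀ k ∈ s, IsSmoothOn (W k) S) : IsSmoothOn (fun x => ∑ k ∈ s, W k x) S :=
  isSmoothOn_iff.2 fun c => by
    rw [localRep_sum]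
    exact ContDiffOn.sum fun k hk => isSmoothOn_iff.1 (hW k hk) c

lemma IsSmoothOn.algebraMap_const (r : ℂ) (S : Set X) :
    IsSmoothOn (fun _ => algebraMap ℂ (Ext (Eucl d)) r) S :=
  isSmoothOn_iff.2 fun c => by
    rw [localRep_algebraMap]
    exact contDiffOn_const

lemma isSmoothOn_of_locally
    (h : ∀ x ∈ S, ∃ V : Set X, IsOpen V ∧ x ∈ V ∧ IsSmoothOn w V) : IsSmoothOn w S :=
  isSmoothOn_iff.2 fun c y hy => by
    obtain ⟨V, hV, hxV, hwV⟩ := h _ hy.2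
    exact (hwV.contDiffAt hV ⟨hy.1, hxV⟩).contDiffWithinAt

lemma extD_congr (hS : IsOpen S) (h : ∀ x ∈ S, w x = u x) (hx : x ∈ S) : extD w x = extD u x :=
  flatD_congr (Filter.eventuallyEq_of_mem ((isOpen_chartDom x hS).mem_nhds (mem_chartDom_self hx))
    fun _ hy => localRep_congr h hy)

lemma extD_mem_deg {n : ℕ} (hS : IsOpen S) (hw : IsSmoothOn w S)
    (h : ∀ x ∈ S, w x ∈ deg (Eucl d) n) (hx : x ∈ S) : extD w x ∈ deg (Eucl d) (n + 1) :=
  flatD_mem_deg (hw.differentiableAt_localRep hS (mem_chartDom_self hx))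
    (Filter.mem_of_superset ((isOpen_chartDom x hS).mem_nhds (mem_chartDom_self hx))
      fun _ hy => localRep_mem_deg h hy)

lemma extD_mul (hS : IsOpen S) (hw : IsSmoothOn w S) (hu : IsSmoothOn u S) (hx : x ∈ S) :
    extD (fun x => w x * u x) x = extD w x * u x + sgn (w x) * extD u x := by
  unfold extD
  rw [localRep_mul, flatD_mul (hw.differentiableAt_localRep hS (mem_chartDom_self hx))
    (hu.differentiableAt_localRep hS (mem_chartDom_self hx)), localRep_self, localRep_self]

lemma extD_add_of_mem (hS : IsOpen S) (hw : IsSmoothOn w S) (hu : IsSmoothOn u S) (hx : x ∈ S) :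
    extD (fun x => w x + u x) x = extD w x + extD u x := by
  unfold extD
  rw [funext (localRep_add x w u), flatD_add (hw.differentiableAt_localRep hS (mem_chartDom_self hx))
    (hu.differentiableAt_localRep hS (mem_chartDom_self hx))]

lemma extD_sub_of_mem (hS : IsOpen S) (hw : IsSmoothOn w S) (hu : IsSmoothOn u S) (hx : x ∈ S) :
    extD (fun x => w x - u x) x = extD w x - extD u x := by
  simp only [sub_eq_add_neg]
  rw [extD_add_of_mem hS hw hu.neg hx, extD_neg]

lemma extD_const_smul (hS : IsOpen S) (r : ℂ) (hw : IsSmoothOn w S) (hx : x ∈ S) :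
    extD (fun x => r • w x) x = r • extD w x := by
  unfold extD
  rw [localRep_smul, flatD_const_smul r (hw.differentiableAt_localRep hS (mem_chartDom_self hx))]

lemma extD_sum {κ : Type*} (s : Finset κ) {W : κ → X → Ext (Eucl d)} (hS : IsOpen S)
    (hW : ∀ k ∈ s, IsSmoothOn (W k) S) (hx : x ∈ S) :
    extD (fun x => ∑ k ∈ s, W k x) x = ∑ k ∈ s, extD (W k) x := by
  unfold extD
  rw [localRep_sum, flatD_sum s fun k hk =>
    (hW k hk).differentiableAt_localRep hS (mem_chartDom_self hx)]

variable [IsManifold (𝓡 d) ∞ X]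

lemma contDiffAt_transition {c z : X} (hy : y ∈ chartDom c (extChartAt (𝓡 d) z).source) :
    ContDiffAt ℝ ∞ (extChartAt (𝓡 d) z ∘ (extChartAt (𝓡 d) c).symm) y := by
  have h := contDiffWithinAt_ext_coord_change (I := 𝓡 d) (n := ∞) z c (y := y) hy
  rwa [ModelWithCorners.range_eq_univ, contDiffWithinAt_univ] at h

lemma two_le_infty : (2 : WithTop ℕ∞) ≤ ∞ := by
  exact ENat.LEInfty.out

/-- Chain rule for the transitions from the chart at c to the chart at z, and from there to the
preferred chart at the point p itself. -/
lemma localRep_transition {c z : X} (w : X → Ext (Eucl d))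
    (hy : y ∈ chartDom c (extChartAt (𝓡 d) z).source) :
    localRep c w y = pullback
      (fderiv ℝ (extChartAt (𝓡 d) z ∘ (extChartAt (𝓡 d) c).symm) y).toLinearMap
      (localRep z w ((extChartAt (𝓡 d) z ∘ (extChartAt (𝓡 d) c).symm) y)) := by
  set p := (extChartAt (𝓡 d) c).symm y with hp
  have hz : (extChartAt (𝓡 d) z).symm ((extChartAt (𝓡 d) z ∘ (extChartAt (𝓡 d) c).symm) y) = p :=
    (extChartAt (𝓡 d) z).left_inv hy.2
  have ht : (extChartAt (𝓡 d) z ∘ (extChartAt (𝓡 d) c).symm) y ∈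
      chartDom z (extChartAt (𝓡 d) p).source :=
    ⟨(extChartAt (𝓡 d) z).map_source hy.2, by
      rw [Set.mem_preimage, hz]; exact mem_extChartAt_source p⟩
  have he : (extChartAt (𝓡 d) p ∘ (extChartAt (𝓡 d) z).symm) ∘
      (extChartAt (𝓡 d) z ∘ (extChartAt (𝓡 d) c).symm) =ᶠ[nhds y]
      extChartAt (𝓡 d) p ∘ (extChartAt (𝓡 d) c).symm :=
    Filter.eventuallyEq_of_mem
      ((isOpen_chartDom c (isOpen_extChartAt_source z)).mem_nhds hy) fun v hv =>
        congrArg (extChartAt (𝓡 d) p) ((extChartAt (𝓡 d) z).left_inv hv.2)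
  unfold localRep
  rw [pullback_comp, hz, ← he.fderiv_eq, fderiv_comp y
    ((contDiffAt_transition ht).differentiableAt (by simp))
    ((contDiffAt_transition hy).differentiableAt (by simp))]
  rfl

/-- At each point `extD` is computed in that point's own chart. Naturality of d under the transition
maps (`flatD_pullback`) shows that any fixed chart gives the same form; smoothness of dw and d² = 0
depend on this. -/
lemma localRep_extD (hS : IsOpen S) (hw : IsSmoothOn w S) (hy : y ∈ chartDom c S) :
    localRep c (extD w) y = flatD (localRep c w) y := by
  set z := (extChartAt (𝓡 d) c).symm y with hz
  have hyz : y ∈ chartDom c (extChartAt (𝓡 d) z).source := ⟨hy.1, mem_extChartAt_source z⟩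
  have he : localRep c w =ᶠ[nhds y] fun v => pullback
      (fderiv ℝ (extChartAt (𝓡 d) z ∘ (extChartAt (𝓡 d) c).symm) v).toLinearMap
      (localRep z w ((extChartAt (𝓡 d) z ∘ (extChartAt (𝓡 d) c).symm) v)) :=
    Filter.eventuallyEq_of_mem
      ((isOpen_chartDom c (isOpen_extChartAt_source z)).mem_nhds hyz) fun v hv =>
        localRep_transition w hv
  rw [flatD_congr he, flatD_pullback ((contDiffAt_transition hyz).of_le two_le_infty)]
  · rfl
  · exact hw.differentiableAt_localRep hS (mem_chartDom_self hy.2)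

lemma IsSmoothOn.extD (hS : IsOpen S) (hw : IsSmoothOn w S) : IsSmoothOn (extD w) S :=
  isSmoothOn_iff.2 fun c => by
    have h : ContDiffOn ℝ ∞ (flatD (localRep c w)) (chartDom c S) := by
      rw [funext (flatD_eq (localRep c w))]
      refine ContDiffOn.sum fun j _ => contDiffOn_const.mul ?_
      exact ((isSmoothOn_iff.1 hw c).fderiv_of_isOpen (isOpen_chartDom c hS) (by simp)).clm_apply
        contDiffOn_const
    exact h.congr fun y hy => localRep_extD hS hw hy

lemma extD_extD (hS : IsOpen S) (hw : IsSmoothOn w S) (hx : x ∈ S) :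
    TwistedK.extD (TwistedK.extD w) x = 0 := by
  have he : localRep x (TwistedK.extD w) =ᶠ[nhds (extChartAt (𝓡 d) x x)] flatD (localRep x w) :=
    Filter.eventuallyEq_of_mem ((isOpen_chartDom x hS).mem_nhds (mem_chartDom_self hx))
      fun _ hy => localRep_extD hS hw hy
  rw [TwistedK.extD, flatD_congr he]
  exact flatD_flatD ((hw.contDiffAt hS (mem_chartDom_self hx)).of_le two_le_infty)

lemma IsSmoothOn.of_contMDiffOn {f : X → ℂ} (hf : ContMDiffOn (𝓡 d) 𝓘(ℝ, ℂ) ∞ f S) :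
    IsSmoothOn (fun x => algebraMap ℂ (Ext (Eucl d)) (f x)) S :=
  isSmoothOn_iff.2 fun c => by
    rw [localRep_algebraMap]
    refine (scalarL d).contDiff.comp_contDiffOn ?_
    rw [← contMDiffOn_iff_contDiffOn]
    exact hf.comp ((contMDiffOn_extChartAt_symm c).mono Set.inter_subset_left) fun y hy => hy.2

end Charts

/-! ### Matrices of forms: degrees, signs and traces. -/

section MatrixForms

variable {V : Type} [AddCommGroup V] [Module ℝ V] {l m n : Type*}

/-- All entries of the matrix `M` have degree `k`. -/
def MatDeg (k : ℕ) (M : Matrix m n (Ext V)) : Prop := ∀ a b, M a b ∈ deg V k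

/-- The entrywise grade involution. -/
def sgnM (M : Matrix m n (Ext V)) : Matrix m n (Ext V) := M.map sgn

lemma sgnM_mul [Fintype n] (M : Matrix m n (Ext V)) (N : Matrix n l (Ext V)) :
    sgnM (M * N) = sgnM M * sgnM N := by
  ext a b; simp [sgnM, Matrix.mul_apply]

lemma MatDeg.mul [Fintype n] {j k : ℕ} {M : Matrix m n (Ext V)} {N : Matrix n l (Ext V)}
    (hM : MatDeg j M) (hN : MatDeg k N) : MatDeg (j + k) (M * N) := fun a b => by
  rw [Matrix.mul_apply]
  exact Submodule.sum_mem _ fun c _ => mul_deg (hM a c) (hN c b)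

lemma MatDeg.add {k : ℕ} {M N : Matrix m n (Ext V)} (hM : MatDeg k M) (hN : MatDeg k N) :
    MatDeg k (M + N) := fun a b => add_mem (hM a b) (hN a b)

lemma MatDeg.sub {k : ℕ} {M N : Matrix m n (Ext V)} (hM : MatDeg k M) (hN : MatDeg k N) :
    MatDeg k (M - N) := fun a b => sub_mem (hM a b) (hN a b)

lemma MatDeg.neg {k : ℕ} {M : Matrix m n (Ext V)} (hM : MatDeg k M) :
    MatDeg k (-M) := fun a b => neg_mem (hM a b)

lemma MatDeg.smul {k : ℕ} {M : Matrix m n (Ext V)} (hM : MatDeg k M) (r : ℂ) :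
    MatDeg k (r • M) := fun a b => Submodule.smul_mem _ r (hM a b)

lemma MatDeg.diagonal [DecidableEq n] {k : ℕ} {b : Ext V} (hb : b ∈ deg V k) :
    MatDeg k (Matrix.diagonal fun _ : n => b) := fun i j => by
  rw [Matrix.diagonal_apply]
  split_ifs
  exacts [hb, zero_mem _]

lemma MatDeg.one [DecidableEq n] : MatDeg 0 (1 : Matrix n n (Ext V)) := by
  have := MatDeg.diagonal (n := n) (V := V) (algebraMap_mem_deg 1)
  rwa [map_one] at this

lemma MatDeg.pow [Fintype n] [DecidableEq n] {k : ℕ} {M : Matrix n n (Ext V)} (hM : MatDeg k M)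
    (j : ℕ) : MatDeg (k * j) (M ^ j) := by
  induction j with
  | zero => exact MatDeg.one
  | succ j ih => rw [pow_succ]; exact ih.mul hM

lemma MatDeg.trace [Fintype n] {k : ℕ} {M : Matrix n n (Ext V)} (hM : MatDeg k M) :
    M.trace ∈ deg V k :=
  Submodule.sum_mem _ fun a _ => hM a a

lemma MatDeg.toForm {d : ℕ} (M : Matrix m n ℂ) : MatDeg 0 (toForm d M) :=
  fun a b => algebraMap_mem_deg (M a b)

lemma MatDeg.sgnM_even {k : ℕ} {M : Matrix m n (Ext V)} (hM : MatDeg (2 * k) M) : sgnM M = M := by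
  ext a b; exact sgn_even (hM a b)

lemma MatDeg.sgnM_odd {k : ℕ} {M : Matrix m n (Ext V)} (hM : MatDeg (2 * k + 1) M) :
    sgnM M = -M := by
  ext a b; exact sgn_odd (hM a b)

/-- The trace is cyclic as soon as one factor has even entries. -/
lemma trace_mul_comm_even [Fintype m] [Fintype n] {k : ℕ} {M : Matrix m n (Ext V)}
    (hM : MatDeg (2 * k) M) (N : Matrix n m (Ext V)) : (M * N).trace = (N * M).trace := by
  simp only [Matrix.trace, Matrix.diag, Matrix.mul_apply]
  rw [Finset.sum_comm]
  exact Finset.sum_congr rfl fun a _ => Finset.sum_congr rfl fun b _ => even_mul_comm (hM b a) _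

lemma diagonal_mul_comm_even [Fintype n] [DecidableEq n] {k : ℕ} {b : Ext V} (hb : b ∈ deg V (2 * k))
    (N : Matrix n n (Ext V)) :
    (Matrix.diagonal fun _ : n => b) * N = N * (Matrix.diagonal fun _ : n => b) := by
  ext i j
  rw [Matrix.diagonal_mul, Matrix.mul_diagonal, even_mul_comm hb]

/-- This is used to move the scalar three-form dB to the left of a word in connection forms. -/
lemma diagonal_mul_comm_sgn [Fintype n] [DecidableEq n] {k : ℕ} {b : Ext V}
    (hb : b ∈ deg V (2 * k + 1)) (N : Matrix n n (Ext V)) :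
    (Matrix.diagonal fun _ : n => b) * N = sgnM N * (Matrix.diagonal fun _ : n => b) := by
  ext i j
  rw [Matrix.diagonal_mul, Matrix.mul_diagonal, odd_mul_eq hb]
  rfl

lemma trace_diagonal_mul [Fintype n] [DecidableEq n] (b : Ext V) (N : Matrix n n (Ext V)) :
    ((Matrix.diagonal fun _ : n => b) * N).trace = b * N.trace := by
  simp only [Matrix.trace, Matrix.diag, Matrix.diagonal_mul, Finset.mul_sum]

end MatrixForms

/-! ### Exterior calculus of matrices of forms, and the twisted Bianchi identity. -/

section MatrixCalculus

variable {d : ℕ} {X : Type*} [TopologicalSpace X] [ChartedSpace (Eucl d) X]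
  {l m n : Type*} {S : Set X} {x : X}

/-- A matrix of forms is smooth on `S`. -/
def FormMatSmooth (M : X → Matrix m n (Ext (Eucl d))) (S : Set X) : Prop :=
  ∀ a b, IsSmoothOn (fun x => M x a b) S

variable {M N : X → Matrix m n (Ext (Eucl d))}

lemma FormMatSmooth.add (hM : FormMatSmooth M S) (hN : FormMatSmooth N S) :
    FormMatSmooth (fun x => M x + N x) S := fun a b => (hM a b).add (hN a b)

lemma FormMatSmooth.sub (hM : FormMatSmooth M S) (hN : FormMatSmooth N S) :
    FormMatSmooth (fun x => M x - N x) S := fun a b => (hM a b).sub (hN a b)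

lemma FormMatSmooth.smul (r : ℂ) (hM : FormMatSmooth M S) :
    FormMatSmooth (fun x => r • M x) S := fun a b => (hM a b).const_smul r

lemma FormMatSmooth.mul [Fintype n] {N : X → Matrix n l (Ext (Eucl d))} (hM : FormMatSmooth M S)
    (hN : FormMatSmooth N S) : FormMatSmooth (fun x => M x * N x) S := fun a b => by
  simp only [Matrix.mul_apply]
  exact IsSmoothOn.sum _ fun c _ => (hM a c).mul (hN c b)

lemma FormMatSmooth.congr (hM : FormMatSmooth M S) (h : ∀ x ∈ S, N x = M x) : FormMatSmooth N S :=
  fun a b => (hM a b).congr fun x hx => by rw [h x hx]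

lemma FormMatSmooth.diagonal [DecidableEq n] {w : X → Ext (Eucl d)} (hw : IsSmoothOn w S) :
    FormMatSmooth (fun x => Matrix.diagonal fun _ : n => w x) S := fun a b => by
  simp only [Matrix.diagonal_apply]
  split_ifs
  exacts [hw, IsSmoothOn.zero S]

lemma FormMatSmooth.pow [Fintype n] [DecidableEq n] {M : X → Matrix n n (Ext (Eucl d))}
    (hM : FormMatSmooth M S) (k : ℕ) : FormMatSmooth (fun x => M x ^ k) S := by
  induction k with
  | zero =>
    simp only [pow_zero]
    have := FormMatSmooth.diagonal (n := n) (IsSmoothOn.algebraMap_const (d := d) 1 S)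
    simpa using this
  | succ k ih => simp only [pow_succ]; exact ih.mul hM

lemma FormMatSmooth.trace [Fintype n] {M : X → Matrix n n (Ext (Eucl d))}
    (hM : FormMatSmooth M S) : IsSmoothOn (fun x => (M x).trace) S :=
  IsSmoothOn.sum _ fun a _ => hM a a

lemma extDMat_add (hS : IsOpen S) (hM : FormMatSmooth M S) (hN : FormMatSmooth N S) (hx : x ∈ S) :
    extDMat (fun y => M y + N y) x = extDMat M x + extDMat N x := by
  ext a b; exact extD_add_of_mem hS (hM a b) (hN a b) hx

lemma extDMat_sub (hS : IsOpen S) (hM : FormMatSmooth M S) (hN : FormMatSmooth N S) (hx : x ∈ S) :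
    extDMat (fun y => M y - N y) x = extDMat M x - extDMat N x := by
  ext a b; exact extD_sub_of_mem hS (hM a b) (hN a b) hx

lemma extDMat_smul (hS : IsOpen S) (r : ℂ) (hM : FormMatSmooth M S) (hx : x ∈ S) :
    extDMat (fun y => r • M y) x = r • extDMat M x := by
  ext a b; exact extD_const_smul hS r (hM a b) hx

lemma extDMat_mul [Fintype n] {N : X → Matrix n l (Ext (Eucl d))} (hS : IsOpen S)
    (hM : FormMatSmooth M S) (hN : FormMatSmooth N S) (hx : x ∈ S) :
    extDMat (fun y => M y * N y) x = extDMat M x * N x + sgnM (M x) * extDMat N x := by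
  ext a b
  simp only [extDMat, Matrix.of_apply, Matrix.mul_apply, Matrix.add_apply]
  rw [extD_sum _ hS (fun c _ => (hM a c).mul (hN c b)) hx, ← Finset.sum_add_distrib]
  exact Finset.sum_congr rfl fun c _ => extD_mul hS (hM a c) (hN c b) hx

lemma extDMat_congr (hS : IsOpen S) (h : ∀ x ∈ S, M x = N x) (hx : x ∈ S) :
    extDMat M x = extDMat N x := by
  ext a b; exact extD_congr hS (fun y hy => by rw [h y hy]) hx

lemma extDMat_diagonal [DecidableEq n] (w : X → Ext (Eucl d)) (x : X) :
    extDMat (fun y => Matrix.diagonal fun _ : n => w y) x = Matrix.diagonal fun _ => extD w x := by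
  ext a b
  simp only [extDMat, Matrix.of_apply, Matrix.diagonal_apply]
  split_ifs
  exacts [rfl, extD_zero x]

lemma extD_trace [Fintype n] {M : X → Matrix n n (Ext (Eucl d))} (hS : IsOpen S)
    (hM : FormMatSmooth M S) (hx : x ∈ S) :
    extD (fun y => (M y).trace) x = (extDMat M x).trace :=
  extD_sum _ hS (fun a _ => hM a a) hx

lemma extDMat_matDeg {k : ℕ} (hS : IsOpen S) (hM : FormMatSmooth M S)
    (h : ∀ x ∈ S, MatDeg k (M x)) (hx : x ∈ S) : MatDeg (k + 1) (extDMat M x) :=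
  fun a b => extD_mem_deg hS (hM a b) (fun y hy => h y hy a b) hx

section Manifold

variable [IsManifold (𝓡 d) ∞ X]

lemma FormMatSmooth.extDMat (hS : IsOpen S) (hM : FormMatSmooth M S) :
    FormMatSmooth (extDMat M) S := fun a b => (hM a b).extD hS

lemma extDMat_extDMat (hS : IsOpen S) (hM : FormMatSmooth M S) (hx : x ∈ S) :
    TwistedK.extDMat (TwistedK.extDMat M) x = 0 := by
  ext a b; exact extD_extD hS (hM a b) hx

lemma MatSmoothOn.toForm {f : X → Matrix m n ℂ} (hf : MatSmoothOn d f S) :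
    FormMatSmooth (fun x => toForm d (f x)) S := fun a b => IsSmoothOn.of_contMDiffOn (hf a b)

end Manifold

/-! ### Twisted curvature and covariant derivative -/

variable [Fintype n] [DecidableEq n]

/-- The twisted curvature `dΓ + Γ ∧ Γ - B` of a connection form `Γ`. -/
def twCurv (B : X → Ext (Eucl d)) (Γ : X → Matrix n n (Ext (Eucl d))) (x : X) :
    Matrix n n (Ext (Eucl d)) :=
  extDMat Γ x + Γ x * Γ x - Matrix.diagonal fun _ => B x

/-- The covariant derivative `dM + Γ M - (-1)^{|M|} M Γ` of an endomorphism-valued form. -/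
def nabla (Γ M : X → Matrix n n (Ext (Eucl d))) (x : X) : Matrix n n (Ext (Eucl d)) :=
  extDMat M x + Γ x * M x - sgnM (M x) * Γ x

variable {B : X → Ext (Eucl d)} {Γ M N K : X → Matrix n n (Ext (Eucl d))}

lemma twCurv_matDeg (hS : IsOpen S) (hΓ : FormMatSmooth Γ S) (h1 : ∀ x ∈ S, MatDeg 1 (Γ x))
    (hB : ∀ x ∈ S, B x ∈ deg (Eucl d) 2) (hx : x ∈ S) : MatDeg 2 (twCurv B Γ x) :=
  ((extDMat_matDeg hS hΓ h1 hx).add ((h1 x hx).mul (h1 x hx))).sub (.diagonal (hB x hx))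

/-- ∇ is a graded derivation: the two terms with Γ between M and N, both carrying the sign of M,
cancel. -/
lemma nabla_mul (hS : IsOpen S) (hM : FormMatSmooth M S) (hN : FormMatSmooth N S) (hx : x ∈ S) :
    nabla Γ (fun y => M y * N y) x = nabla Γ M x * N x + sgnM (M x) * nabla Γ N x := by
  unfold nabla
  rw [extDMat_mul hS hM hN hx, sgnM_mul]
  noncomm_ring


/-- For even M the two terms with Γ have the same trace, so d may be replaced by ∇ under the trace
for any Γ. -/
lemma extD_trace_eq_nabla (hS : IsOpen S) (hM : FormMatSmooth M S) {k : ℕ}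
    (h : MatDeg (2 * k) (M x)) (hx : x ∈ S) :
    extD (fun y => (M y).trace) x = (nabla Γ M x).trace := by
  rw [extD_trace hS hM hx, nabla, h.sgnM_even, Matrix.trace_sub, Matrix.trace_add,
    trace_mul_comm_even h]
  abel

/-- The ordinary Bianchi identity cancels everything built from Γ. The even scalar form B commutes
with Γ, so only its derivative remains. -/
lemma bianchi [IsManifold (𝓡 d) ∞ X] (hS : IsOpen S) (hΓ : FormMatSmooth Γ S)
    (h1 : ∀ x ∈ S, MatDeg 1 (Γ x)) (hBs : IsSmoothOn B S)
    (hB : ∀ x ∈ S, B x ∈ deg (Eucl d) 2) (hx : x ∈ S) :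
    nabla Γ (twCurv B Γ) x = -Matrix.diagonal fun _ => extD B x := by
  have hd := hΓ.extDMat hS
  have hq := hΓ.mul hΓ
  have hb := FormMatSmooth.diagonal (n := n) hBs
  have h : extDMat (twCurv B Γ) x =
      extDMat Γ x * Γ x - Γ x * extDMat Γ x - Matrix.diagonal fun _ => extD B x := by
    have := extDMat_sub hS (hd.add hq) hb hx
    rw [extDMat_add hS hd hq hx, extDMat_extDMat hS hΓ hx, extDMat_mul hS hΓ hΓ hx,
      (show MatDeg (2 * 0 + 1) (Γ x) from h1 x hx).sgnM_odd, extDMat_diagonal] at this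
    refine Eq.trans this ?_
    noncomm_ring
  rw [nabla, h, (show MatDeg (2 * 1) _ from twCurv_matDeg hS hΓ h1 hB hx).sgnM_even, twCurv]
  have hc := diagonal_mul_comm_even (show B x ∈ deg (Eucl d) (2 * 1) from hB x hx) (Γ x)
  simp only [mul_sub, sub_mul, mul_add, add_mul, hc, mul_assoc]
  abel

lemma nabla_one : nabla Γ (fun _ => 1) x = 0 := by
  have h1 : extDMat (fun _ : X => (1 : Matrix n n (Ext (Eucl d)))) x = 0 := by
    have := extDMat_toForm_const (d := d) (1 : Matrix n n ℂ) x
    simpa [toForm] using this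
  rw [nabla, h1, (show MatDeg (2 * 0) (1 : Matrix n n (Ext (Eucl d))) from .one).sgnM_even]
  simp

/-- On powers of the even matrix K, ∇ acts as an ordinary derivation, and the scalar ∇K commutes
with these powers. At k = 0 the factor k annihilates the term with truncated exponent k - 1. -/
lemma nabla_pow (hS : IsOpen S) (hK : FormMatSmooth K S) (hK2 : ∀ x ∈ S, MatDeg 2 (K x))
    {h : Ext (Eucl d)} (hh : nabla Γ K x = -Matrix.diagonal fun _ => h) (hx : x ∈ S)
    (k : ℕ) :
    nabla Γ (fun y => K y ^ k) x = -((k : ℂ) • ((Matrix.diagonal fun _ => h) * K x ^ (k - 1))) := by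
  induction k with
  | zero => simp [nabla_one]
  | succ k ih =>
    have hp := (hK2 x hx).pow k
    have e : (fun y => K y ^ (k + 1)) = fun y => K y ^ k * K y := funext fun y => pow_succ _ _
    have hc : K x ^ k * (Matrix.diagonal fun _ => h) = (Matrix.diagonal fun _ => h) * K x ^ k := by
      ext i j
      rw [Matrix.diagonal_mul, Matrix.mul_diagonal, even_mul_comm (hp i j)]
    rw [e, nabla_mul hS (hK.pow k) hK hx, ih, hh, hp.sgnM_even, mul_neg, hc, Nat.add_sub_cancel]
    rcases k with _ | k
    · simp
    · rw [Nat.add_sub_cancel, neg_mul, smul_mul_assoc, mul_assoc, ← pow_succ]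
      push_cast
      module

end MatrixCalculus

/-! ### Integration along the fibre of X × I → X. -/

section FibreIntegral

variable {d : ℕ}

/-- Restriction of a form on `X × I` to a slice `X × {t}`. -/
def slice (d : ℕ) : Ext (Eucl d × ℝ) →ₐ[ℂ] Ext (Eucl d) :=
  pullback (LinearMap.inl ℝ (Eucl d) ℝ)

lemma slice_cylPull (a : Ext (Eucl d)) : slice d (cylPull d a) = a := by
  rw [slice, cylPull, pullback_comp, LinearMap.fst_comp_inl, pullback_id]

lemma slice_dt : slice d (dt d) = 0 := by
  rw [slice, dt, pullback_oneForm, LinearMap.comp_assoc, LinearMap.snd_comp_inl,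
    LinearMap.comp_zero, oneForm, map_zero]

/-- Contraction from the right is a graded derivation that meets b first; to reach a it passes b, so
the sign falls on b. -/
lemma dtPart_mul (a b : Ext (Eucl d × ℝ)) :
    dtPart (a * b) = slice d a * dtPart b + dtPart a * sgn (slice d b) := by
  have key : ∀ a b : Ext (Eucl d × ℝ),
      CliffordAlgebra.contractRight (Q := (0 : QuadraticForm ℂ ((Eucl d × ℝ) →ₗ[ℝ] ℂ)))
        (a * b) (evalDt d) = a * CliffordAlgebra.contractRight b (evalDt d) +
        CliffordAlgebra.contractRight (Q := (0 : QuadraticForm ℂ ((Eucl d × ℝ) →ₗ[ℝ] ℂ)))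
          a (evalDt d) * sgn b := by
    intro a b
    induction b using CliffordAlgebra.right_induction with
    | algebraMap r =>
      rw [CliffordAlgebra.contractRight_mul_algebraMap, CliffordAlgebra.contractRight_algebraMap,
        mul_zero, zero_add, AlgHom.commutes]
    | add x y hx hy =>
      simp only [mul_add, map_add, LinearMap.add_apply, hx, hy]
      abel
    | mul_ι m x hx =>
      rw [← mul_assoc, CliffordAlgebra.contractRight_mul_ι, hx, CliffordAlgebra.contractRight_mul_ι,
        map_mul, CliffordAlgebra.involute_ι, mul_sub, mul_smul_comm, add_mul, mul_neg, mul_neg,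
        mul_assoc, mul_assoc]
      abel
  unfold dtPart
  rw [key, map_add, map_mul, map_mul, pullback_sgn]
  rfl

lemma dtPart_dt : dtPart (dt d) = 1 := by
  have h := CliffordAlgebra.contractRight_ι (Q := (0 : QuadraticForm ℂ ((Eucl d × ℝ) →ₗ[ℝ] ℂ)))
    (evalDt d) (Complex.ofRealCLM.toLinearMap ∘ₗ LinearMap.snd ℝ (Eucl d) ℝ)
  have h2 : evalDt d (Complex.ofRealCLM.toLinearMap ∘ₗ LinearMap.snd ℝ (Eucl d) ℝ) = 1 := by
    simp [evalDt]
  rw [h2, map_one] at h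
  unfold dtPart dt
  exact (congrArg _ h).trans (map_one _)

lemma dtPart_smul (r : ℂ) (a : Ext (Eucl d × ℝ)) : dtPart (r • a) = r • dtPart a := by
  simp [dtPart]

lemma dtPart_sum {κ : Type*} (s : Finset κ) (a : κ → Ext (Eucl d × ℝ)) :
    dtPart (∑ k ∈ s, a k) = ∑ k ∈ s, dtPart (a k) := by
  simp [dtPart]

lemma dtPart_sub (a b : Ext (Eucl d × ℝ)) : dtPart (a - b) = dtPart a - dtPart b := by
  simp [dtPart]

variable {n : Type*} [Fintype n] [DecidableEq n]

/-- The differential `-tr(β exp K)` of the Chern character in direction `β`, up to sign. -/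
def chTheta (K β : Matrix n n (Ext (Eucl d))) : Ext (Eucl d) :=
  ∑ m ∈ Finset.range (d + 1), ((m.factorial : ℂ)⁻¹) • (β * K ^ m).trace

lemma slice_pow_map (M : Matrix n n (Ext (Eucl d × ℝ))) (k : ℕ) :
    (M ^ k).map (slice d) = (M.map (slice d)) ^ k :=
  map_pow (slice d).mapMatrix M k

/-- The derivation rule gives m words, which differ only in the position of N. All have the same
trace because powers of the even matrix K can be moved around cyclically. The trailing factor K^j is
what lets the induction absorb the last K. -/
lemma trace_dtPart_pow {M : Matrix n n (Ext (Eucl d × ℝ))} {K N : Matrix n n (Ext (Eucl d))}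
    (hK : M.map (slice d) = K) (hN : M.map dtPart = N) (hK2 : MatDeg 2 K) (m j : ℕ) :
    ((M ^ m).map dtPart * K ^ j).trace = (m : ℂ) • (N * K ^ (m - 1 + j)).trace := by
  induction m generalizing j with
  | zero =>
    have : ((1 : Matrix n n (Ext (Eucl d × ℝ))).map dtPart) = 0 := by
      ext a b
      have h1 : dtPart (1 : Ext (Eucl d × ℝ)) = 0 := by
        simpa using dtPart_cylPull (1 : Ext (Eucl d))
      rw [Matrix.map_apply, Matrix.one_apply]
      split_ifs
      · exact h1
      · simp [dtPart]
    simp [this]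
  | succ m ih =>
    have h : (M ^ (m + 1)).map dtPart = K ^ m * N + (M ^ m).map dtPart * K := by
      ext a b
      rw [pow_succ, Matrix.map_apply, Matrix.mul_apply, dtPart_sum, Matrix.add_apply,
        Matrix.mul_apply, Matrix.mul_apply, ← Finset.sum_add_distrib, ← hK, ← slice_pow_map, ← hN]
      refine Finset.sum_congr rfl fun c _ => ?_
      rw [dtPart_mul]
      have : sgn (slice d (M c b)) = slice d (M c b) :=
        sgn_even (n := 1) (by subst hK; exact hK2 c b)
      rw [this]
      rfl
    rw [h, add_mul, Matrix.trace_add, mul_assoc, mul_assoc, ← pow_succ', ih,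
      trace_mul_comm_even (hK2.pow m), mul_assoc, ← pow_add, Nat.add_sub_cancel, add_comm j m]
    rcases m with _ | m
    · simp
    · rw [Nat.add_sub_cancel, show m + (j + 1) = m + 1 + j by ring]
      push_cast
      module

section Path

variable {X : Type*} [TopologicalSpace X] [ChartedSpace (Eucl d) X]

/-- On the cylinder the twisted curvature is K + dt ∧ β, with β the velocity of the path. Its
restriction to a slice is K and its dt-component is -β, the sign coming from moving dt to the right
of a one-form. -/
lemma dtPart_pathCh {B : X → Ext (Eucl d)} {γ : ℝ → X → Matrix n n (Ext (Eucl d))} {t : ℝ} {x : X}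
    {β : Matrix n n (Ext (Eucl d))} (hβ : ∀ a b, timeDeriv (fun s => γ s x a b) t = β a b)
    (hβ1 : MatDeg 1 β) (hK : MatDeg 2 (twCurv B (γ t) x)) :
    dtPart (pathCh B γ t x) = -chTheta (twCurv B (γ t) x) β := by
  set M := pathCurv γ t x - Matrix.diagonal fun _ => cylPull d (B x) with hM
  have h1 : M.map (slice d) = twCurv B (γ t) x := by
    ext a b
    have hd : slice d ((Matrix.diagonal fun _ => cylPull d (B x) : Matrix n n _) a b) =
        (Matrix.diagonal fun _ => B x : Matrix n n _) a b := by
      rw [Matrix.diagonal_apply, Matrix.diagonal_apply]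
      split_ifs
      exacts [slice_cylPull _, map_zero _]
    simp [hM, pathCurv, twCurv, Matrix.mul_apply, slice_cylPull, slice_dt, hd]
  have h2 : M.map dtPart = -β := by
    ext a b
    have hd : dtPart ((Matrix.diagonal fun _ => cylPull d (B x) : Matrix n n _) a b) = 0 := by
      rw [Matrix.diagonal_apply]
      split_ifs
      exacts [dtPart_cylPull _, by simp [dtPart]]
    rw [Matrix.map_apply, hM, Matrix.sub_apply, dtPart_sub, hd, pathCurv, Matrix.add_apply,
      Matrix.add_apply, dtPart_add, dtPart_add, Matrix.map_apply, dtPart_cylPull, Matrix.of_apply,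
      dtPart_mul, slice_dt, zero_mul, dtPart_dt, one_mul, slice_cylPull, hβ,
      sgn_odd (n := 0) (hβ1 a b), Matrix.mul_apply, dtPart_sum, Finset.sum_eq_zero]
    · simp
    · intro c _
      rw [Matrix.map_apply, Matrix.map_apply, ← map_mul, dtPart_cylPull]
  have h3 : ∀ m : ℕ, dtPart (M ^ m).trace = (m : ℂ) • (-β * (twCurv B (γ t) x) ^ (m - 1)).trace := by
    intro m
    have := trace_dtPart_pow h1 h2 hK m 0
    rw [pow_zero, mul_one, add_zero] at this
    rw [← this, Matrix.trace, dtPart_sum]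
    rfl
  unfold pathCh chTheta
  -- The summand m = 0 has no dt-component. Removing it shifts the index by one, and m / m! = 1 / (m
  -- - 1)! turns the rest into `chTheta`.
  rw [dtPart_sum, Finset.sum_range_succ', ← Finset.sum_neg_distrib, dtPart_smul, h3]
  simp only [Nat.cast_zero, zero_smul, smul_zero, add_zero]
  refine Finset.sum_congr rfl fun m _ => ?_
  rw [dtPart_smul, h3, smul_smul, Nat.add_sub_cancel, neg_mul, Matrix.trace_neg, smul_neg]
  congr 2
  rw [Nat.factorial_succ]
  have : (m.factorial : ℂ) ≠ 0 := by exact_mod_cast m.factorial_ne_zero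
  have h' : ((m : ℂ) + 1) ≠ 0 := by exact_mod_cast m.succ_ne_zero
  push_cast
  field_simp

/-- The coordinatewise integral is the Bochner integral for the norm above, so linear maps and
subspaces pass through it. -/
lemma fibreIntegral_eq {a : ℝ → Ext (Eucl d × ℝ)} (h : Continuous fun t => dtPart (a t)) :
    fibreIntegral a = ∫ t in (0 : ℝ)..1, dtPart (a t) := by
  unfold fibreIntegral
  rw [LinearEquiv.symm_apply_eq]
  ext S
  have := ((ContinuousLinearMap.proj (R := ℝ) (φ := fun _ : Finset (Fin d) => ℂ) S).comp
    (coordsR d).toContinuousLinearMap).intervalIntegral_comp_comm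
      (h.intervalIntegrable (μ := MeasureTheory.volume) 0 1)
  exact this

lemma timeDeriv_straightPath (Γ₀ Γ₁ : X → Matrix n n (Ext (Eucl d))) (t : ℝ) (x : X) (a b : n) :
    timeDeriv (fun s => straightPath Γ₀ Γ₁ s x a b) t = (Γ₁ x - Γ₀ x) a b := by
  unfold timeDeriv
  rw [LinearEquiv.symm_apply_eq]
  ext S
  have h : (fun s : ℝ => coords d (straightPath Γ₀ Γ₁ s x a b) S) = fun s : ℝ =>
      (1 - s : ℂ) * coords d (Γ₀ x a b) S + (s : ℂ) * coords d (Γ₁ x a b) S := by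
    funext s
    simp [straightPath, -Complex.coe_smul]
  have h1 : HasDerivAt (fun s : ℝ => (s : ℂ)) 1 t := Complex.ofRealCLM.hasDerivAt
  rw [h]
  refine (((h1.const_sub 1).mul_const _).add (h1.mul_const _)).deriv.trans ?_
  simp
  ring

end Path

end FibreIntegral

/-! ### Families of forms depending on parameters. -/

section Families

variable {d : ℕ} {X : Type*} [TopologicalSpace X] [ChartedSpace (Eucl d) X]
  {P : Type*} [TopologicalSpace P] {S : Set X} {x : X}

/-- A family of forms that is a finite sum of products of continuous functions of the parameter
and smooth forms on `S`. -/
def SmoothFam (S : Set X) (f : P → X → Ext (Eucl d)) : Prop :=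
  ∃ (κ : Type) (_ : Fintype κ) (φ : κ → P → ℂ) (c : κ → X → Ext (Eucl d)),
    (∀ k, Continuous (φ k)) ∧ (∀ k, IsSmoothOn (c k) S) ∧
      ∀ p, ∀ x ∈ S, f p x = ∑ k, φ k p • c k x

variable {f g : P → X → Ext (Eucl d)}

lemma SmoothFam.const {w : X → Ext (Eucl d)} (hw : IsSmoothOn w S) :
    SmoothFam S (fun _ : P => w) :=
  ⟨Unit, inferInstance, fun _ _ => 1, fun _ => w, fun _ => continuous_const, fun _ => hw,
    fun p x _ => by simp⟩

lemma SmoothFam.smul {φ : P → ℂ} (hφ : Continuous φ) (hf : SmoothFam S f) :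
    SmoothFam S (fun p x => φ p • f p x) := by
  obtain ⟨κ, _, ψ, c, hψ, hc, h⟩ := hf
  refine ⟨κ, inferInstance, fun k p => φ p * ψ k p, c, fun k => hφ.mul (hψ k), hc,
    fun p x hx => ?_⟩
  simp only [h p x hx, Finset.smul_sum, smul_smul]

lemma SmoothFam.add (hf : SmoothFam S f) (hg : SmoothFam S g) :
    SmoothFam S (fun p x => f p x + g p x) := by
  obtain ⟨κ, _, ψ, c, hψ, hc, h⟩ := hf
  obtain ⟨κ', _, ψ', c', hψ', hc', h'⟩ := hg
  refine ⟨κ ⊕ κ', inferInstance, Sum.elim ψ ψ', Sum.elim c c', ?_, ?_, fun p x hx => ?_⟩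
  · rintro (k | k)
    exacts [hψ k, hψ' k]
  · rintro (k | k)
    exacts [hc k, hc' k]
  · simp [Fintype.sum_sum_type, h p x hx, h' p x hx]

lemma SmoothFam.mul (hf : SmoothFam S f) (hg : SmoothFam S g) :
    SmoothFam S (fun p x => f p x * g p x) := by
  obtain ⟨κ, _, ψ, c, hψ, hc, h⟩ := hf
  obtain ⟨κ', _, ψ', c', hψ', hc', h'⟩ := hg
  refine ⟨κ × κ', inferInstance, fun k p => ψ k.1 p * ψ' k.2 p, fun k x => c k.1 x * c' k.2 x,
    fun k => (hψ _).mul (hψ' _), fun k => (hc _).mul (hc' _), fun p x hx => ?_⟩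
  change f p x * g p x = _
  rw [h p x hx, h' p x hx, Finset.sum_mul_sum, Fintype.sum_prod_type]
  refine Finset.sum_congr rfl fun a _ => Finset.sum_congr rfl fun b _ => ?_
  rw [smul_mul_smul_comm]

lemma SmoothFam.sum {κ : Type*} (s : Finset κ) {F : κ → P → X → Ext (Eucl d)}
    (hF : ∀ k ∈ s, SmoothFam S (F k)) : SmoothFam S (fun p x => ∑ k ∈ s, F k p x) := by
  classical
  induction s using Finset.induction_on with
  | empty => simpa using SmoothFam.const (IsSmoothOn.zero S)
  | insert a s ha ih =>
    simp only [Finset.sum_insert ha]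
    exact (hF a (by simp)).add (ih fun k hk => hF k (by simp [hk]))

lemma SmoothFam.isSmoothOn (hf : SmoothFam S f) (p : P) : IsSmoothOn (f p) S := by
  obtain ⟨κ, _, ψ, c, hψ, hc, h⟩ := hf
  exact (IsSmoothOn.sum Finset.univ fun k _ => (hc k).const_smul (ψ k p)).congr (h p)

lemma SmoothFam.continuous (hf : SmoothFam S f) (hx : x ∈ S) : Continuous fun p => f p x := by
  obtain ⟨κ, _, ψ, c, hψ, hc, h⟩ := hf
  simp only [fun p => h p x hx]
  exact continuous_finsetSum _ fun k _ => (hψ k).smul continuous_const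

lemma SmoothFam.comp {Q : Type*} [TopologicalSpace Q] {q : Q → P} (hq : Continuous q)
    (hf : SmoothFam S f) : SmoothFam S (fun p => f (q p)) := by
  obtain ⟨κ, _, ψ, c, hψ, hc, h⟩ := hf
  exact ⟨κ, inferInstance, fun k p => ψ k (q p), c, fun k => (hψ k).comp hq, hc,
    fun p x hx => h _ x hx⟩

/-- The parameter enters only through scalar factors that are constant on X, so d acts on finitely
many fixed forms. -/
lemma SmoothFam.extD [IsManifold (𝓡 d) ∞ X] (hS : IsOpen S) (hf : SmoothFam S f) :
    SmoothFam S (fun p => extD (f p)) := by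
  obtain ⟨κ, _, ψ, c, hψ, hc, h⟩ := hf
  refine ⟨κ, inferInstance, ψ, fun k => TwistedK.extD (c k), hψ, fun k => (hc k).extD hS,
    fun p x hx => ?_⟩
  change TwistedK.extD (f p) x = _
  rw [extD_congr hS (h p) hx, extD_sum _ hS (fun k _ => (hc k).const_smul _) hx]
  exact Finset.sum_congr rfl fun k _ => extD_const_smul hS _ (hc k) hx

section Integral

variable {F : P → ℝ → X → Ext (Eucl d)}

lemma integral_sum_smul {κ : Type*} [Fintype κ] {ψ : κ → ℝ → ℂ} (hψ : ∀ k, Continuous (ψ k))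
    (c : κ → Ext (Eucl d)) :
    ∫ t in (0 : ℝ)..1, ∑ k, ψ k t • c k = ∑ k, (∫ t in (0 : ℝ)..1, ψ k t) • c k := by
  rw [intervalIntegral.integral_finsetSum (f := fun k t => ψ k t • c k) fun k _ =>
    (((hψ k).smul continuous_const).intervalIntegrable 0 1)]
  exact Finset.sum_congr rfl fun k _ => intervalIntegral.integral_smul_const _ _

lemma SmoothFam.integral (hF : SmoothFam S fun q : P × ℝ => F q.1 q.2) :
    SmoothFam S (fun p x => ∫ t in (0 : ℝ)..1, F p t x) := by
  obtain ⟨κ, _, ψ, c, hψ, hc, h⟩ := hF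
  refine ⟨κ, inferInstance, fun k p => ∫ t in (0 : ℝ)..1, ψ k (p, t), c, fun k => ?_, hc,
    fun p x hx => ?_⟩
  · exact intervalIntegral.continuous_parametric_intervalIntegral_of_continuous'
      (f := fun p t => ψ k (p, t)) (hψ k) 0 1
  · simp only [fun t => h (p, t) x hx]
    have hc : ∀ k, Continuous fun t => ψ k (p, t) := fun k => (hψ k).comp (by fun_prop)
    exact integral_sum_smul hc _

/-- By the finite-sum shape of the family this is linearity of d; no differentiation under the
integral sign takes place. -/
lemma SmoothFam.extD_integral (hS : IsOpen S)
    (hF : SmoothFam S fun q : P × ℝ => F q.1 q.2) (p : P) (hx : x ∈ S) :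
    TwistedK.extD (fun x => ∫ t in (0 : ℝ)..1, F p t x) x =
      ∫ t in (0 : ℝ)..1, TwistedK.extD (F p t) x := by
  obtain ⟨κ, _, ψ, c, hψ, hc, h⟩ := hF
  have hcont : ∀ k, Continuous fun t => ψ k (p, t) := fun k => (hψ k).comp (by fun_prop)
  have h1 : ∀ y ∈ S, ∫ t in (0 : ℝ)..1, F p t y =
      ∑ k, (∫ t in (0 : ℝ)..1, ψ k (p, t)) • c k y := fun y hy => by
    simp only [fun t => h (p, t) y hy]
    exact integral_sum_smul hcont _
  have h2 : ∀ t, TwistedK.extD (F p t) x = ∑ k, ψ k (p, t) • TwistedK.extD (c k) x := fun t => by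
    rw [extD_congr hS (h (p, t)) hx, extD_sum _ hS (fun k _ => (hc k).const_smul _) hx]
    exact Finset.sum_congr rfl fun k _ => extD_const_smul hS _ (hc k) hx
  simp only [h2]
  rw [extD_congr hS h1 hx, extD_sum _ hS (fun k _ => (hc k).const_smul _) hx,
    integral_sum_smul hcont]
  exact Finset.sum_congr rfl fun k _ => extD_const_smul hS _ (hc k) hx

/-- The integral of forms that lie in a linear subspace lies in that subspace. -/
lemma integral_mem {N : Submodule ℂ (Ext (Eucl d))} {a : ℝ → Ext (Eucl d)} (ha : Continuous a)
    (h : ∀ t, a t ∈ N) : ∫ t in (0 : ℝ)..1, a t ∈ N := by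
  -- A continuous projection onto the subspace commutes with the integral and fixes the integrand.
  obtain ⟨p, hp, hp'⟩ := exists_projection N
  have := p.intervalIntegral_comp_comm
    (ha.intervalIntegrable (μ := MeasureTheory.volume) 0 1)
  simp only [fun t => hp _ (h t)] at this
  rw [this]
  exact hp' _

end Integral

section MatrixFamilies

variable {l m n : Type*}

/-- A family of matrices of forms with entries as in `SmoothFam`. -/
def FormMatFam (S : Set X) (M : P → X → Matrix m n (Ext (Eucl d))) : Prop :=
  ∀ a b, SmoothFam S (fun p x => M p x a b)

variable {M N : P → X → Matrix m n (Ext (Eucl d))}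

lemma FormMatFam.const {M : X → Matrix m n (Ext (Eucl d))} (hM : FormMatSmooth M S) :
    FormMatFam S (fun _ : P => M) := fun a b => .const (hM a b)

lemma FormMatFam.smul {φ : P → ℂ} (hφ : Continuous φ) (hM : FormMatFam S M) :
    FormMatFam S (fun p x => φ p • M p x) := fun a b => (hM a b).smul hφ

lemma FormMatFam.add (hM : FormMatFam S M) (hN : FormMatFam S N) :
    FormMatFam S (fun p x => M p x + N p x) := fun a b => (hM a b).add (hN a b)

lemma FormMatFam.sub (hM : FormMatFam S M) (hN : FormMatFam S N) :
    FormMatFam S (fun p x => M p x - N p x) := by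
  have h := hM.add (hN.smul (φ := fun _ => -1) continuous_const)
  simpa only [neg_smul, one_smul, ← sub_eq_add_neg] using h

lemma FormMatFam.mul [Fintype n] {N : P → X → Matrix n l (Ext (Eucl d))} (hM : FormMatFam S M)
    (hN : FormMatFam S N) : FormMatFam S (fun p x => M p x * N p x) := fun a b => by
  simp only [Matrix.mul_apply]
  exact SmoothFam.sum _ fun c _ => (hM a c).mul (hN c b)

lemma FormMatFam.pow [Fintype n] [DecidableEq n] {M : P → X → Matrix n n (Ext (Eucl d))}
    (hM : FormMatFam S M) (k : ℕ) : FormMatFam S (fun p x => M p x ^ k) := by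
  induction k with
  | zero =>
    simp only [pow_zero]
    have := FormMatSmooth.diagonal (n := n) (IsSmoothOn.algebraMap_const (d := d) 1 S)
    exact .const (by simpa using this)
  | succ k ih => simp only [pow_succ]; exact ih.mul hM

lemma FormMatFam.trace [Fintype n] {M : P → X → Matrix n n (Ext (Eucl d))}
    (hM : FormMatFam S M) : SmoothFam S (fun p x => (M p x).trace) :=
  SmoothFam.sum _ fun a _ => hM a a

lemma FormMatFam.formMatSmooth (hM : FormMatFam S M) (p : P) : FormMatSmooth (M p) S :=
  fun a b => (hM a b).isSmoothOn p

lemma FormMatFam.extDMat [IsManifold (𝓡 d) ∞ X] (hS : IsOpen S) (hM : FormMatFam S M) :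
    FormMatFam S (fun p => extDMat (M p)) := fun a b => (hM a b).extD hS

variable [Fintype n] [DecidableEq n]

lemma FormMatFam.twCurv [IsManifold (𝓡 d) ∞ X] {B : X → Ext (Eucl d)}
    {Γ : P → X → Matrix n n (Ext (Eucl d))} (hS : IsOpen S) (hΓ : FormMatFam S Γ)
    (hB : IsSmoothOn B S) : FormMatFam S (fun p => twCurv B (Γ p)) :=
  ((hΓ.extDMat hS).add (hΓ.mul hΓ)).sub (.const (.diagonal hB))

lemma FormMatFam.chTheta {K β : P → X → Matrix n n (Ext (Eucl d))} (hK : FormMatFam S K)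
    (hβ : FormMatFam S β) : SmoothFam S (fun p x => chTheta (K p x) (β p x)) :=
  SmoothFam.sum _ fun m _ => (hβ.mul (hK.pow m)).trace.smul continuous_const

lemma chTheta_mem_parity {K β : Matrix n n (Ext (Eucl d))} (hK : MatDeg 2 K) (hβ : MatDeg 1 β) :
    chTheta K β ∈ parity (Eucl d) 1 := by
  refine Submodule.sum_mem _ fun m _ => Submodule.smul_mem _ _ ?_
  have h := deg_le_parity _ (hβ.mul (hK.pow m)).trace
  have e : ((1 + 2 * m : ℕ) : ZMod 2) = 1 := by
    rw [Nat.cast_add, (ZMod.natCast_eq_zero_iff _ _).2 (dvd_mul_right 2 m)]; simp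
  rwa [e] at h

end MatrixFamilies

section StraightPath

variable {n : Type*} [Fintype n] [DecidableEq n] {B : X → Ext (Eucl d)}
  {Γ₀ Γ₁ : X → Matrix n n (Ext (Eucl d))}

lemma FormMatFam.straightPath (h₀ : FormMatSmooth Γ₀ S) (h₁ : FormMatSmooth Γ₁ S) :
    FormMatFam S (straightPath Γ₀ Γ₁) :=
  ((FormMatFam.const h₀).smul (φ := fun t : ℝ => (1 - t : ℂ)) (by fun_prop)).add
    ((FormMatFam.const h₁).smul (φ := fun t : ℝ => (t : ℂ)) (by fun_prop))

lemma straightPath_matDeg (h₀ : MatDeg 1 (Γ₀ x)) (h₁ : MatDeg 1 (Γ₁ x)) (t : ℝ) :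
    MatDeg 1 (straightPath Γ₀ Γ₁ t x) :=
  (h₀.smul _).add (h₁.smul _)

variable [IsManifold (𝓡 d) ∞ X]

/-- The straight path has constant velocity Γ₁ - Γ₀. Thus cs is minus the integral, along the
segment, of the one-form `chTheta` on the affine space of connections; all later work uses this
description. -/
lemma csForm_eq (hS : IsOpen S) (h₀ : FormMatSmooth Γ₀ S) (h₁ : FormMatSmooth Γ₁ S)
    (hd₀ : ∀ x ∈ S, MatDeg 1 (Γ₀ x)) (hd₁ : ∀ x ∈ S, MatDeg 1 (Γ₁ x)) (hBs : IsSmoothOn B S)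
    (hB : ∀ x ∈ S, B x ∈ deg (Eucl d) 2) (hx : x ∈ S) :
    csForm B (straightPath Γ₀ Γ₁) x =
      -∫ t in (0 : ℝ)..1, chTheta (twCurv B (straightPath Γ₀ Γ₁ t) x) (Γ₁ x - Γ₀ x) := by
  have hfam := FormMatFam.straightPath h₀ h₁
  have h : ∀ t, dtPart (pathCh B (straightPath Γ₀ Γ₁) t x) =
      -chTheta (twCurv B (straightPath Γ₀ Γ₁ t) x) (Γ₁ x - Γ₀ x) := fun t =>
    dtPart_pathCh (timeDeriv_straightPath Γ₀ Γ₁ t x) ((hd₁ x hx).sub (hd₀ x hx))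
      (twCurv_matDeg hS (hfam.formMatSmooth t)
        (fun y hy => straightPath_matDeg (hd₀ y hy) (hd₁ y hy) t) hB hx)
  have hc : Continuous fun t =>
      chTheta (twCurv B (straightPath Γ₀ Γ₁ t) x) (Γ₁ x - Γ₀ x) :=
    ((hfam.twCurv hS hBs).chTheta (.const (h₁.sub h₀))).continuous hx
  rw [csForm, fibreIntegral_eq (by simp only [h]; exact continuous_neg.comp hc)]
  simp only [h, intervalIntegral.integral_neg]

lemma csForm_isSmoothOn (hS : IsOpen S) (h₀ : FormMatSmooth Γ₀ S) (h₁ : FormMatSmooth Γ₁ S)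
    (hd₀ : ∀ x ∈ S, MatDeg 1 (Γ₀ x)) (hd₁ : ∀ x ∈ S, MatDeg 1 (Γ₁ x)) (hBs : IsSmoothOn B S)
    (hB : ∀ x ∈ S, B x ∈ deg (Eucl d) 2) : IsSmoothOn (csForm B (straightPath Γ₀ Γ₁)) S := by
  have hfam := ((FormMatFam.straightPath h₀ h₁).twCurv hS hBs).chTheta (.const (h₁.sub h₀))
  have := (SmoothFam.integral (F := fun (_ : Unit) t x =>
    chTheta (twCurv B (straightPath Γ₀ Γ₁ t) x) (Γ₁ x - Γ₀ x)) (hfam.comp continuous_snd)).isSmoothOn ()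
  exact this.neg.congr fun x hx => csForm_eq hS h₀ h₁ hd₀ hd₁ hBs hB hx

lemma csForm_mem_parity (hS : IsOpen S) (h₀ : FormMatSmooth Γ₀ S) (h₁ : FormMatSmooth Γ₁ S)
    (hd₀ : ∀ x ∈ S, MatDeg 1 (Γ₀ x)) (hd₁ : ∀ x ∈ S, MatDeg 1 (Γ₁ x)) (hBs : IsSmoothOn B S)
    (hB : ∀ x ∈ S, B x ∈ deg (Eucl d) 2) (hx : x ∈ S) :
    csForm B (straightPath Γ₀ Γ₁) x ∈ parity (Eucl d) 1 := by
  have hfam := FormMatFam.straightPath h₀ h₁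
  rw [csForm_eq hS h₀ h₁ hd₀ hd₁ hBs hB hx]
  refine neg_mem (integral_mem
    (((hfam.twCurv hS hBs).chTheta (.const (h₁.sub h₀))).continuous hx) fun t => ?_)
  exact chTheta_mem_parity (twCurv_matDeg hS (hfam.formMatSmooth t)
    (fun y hy => straightPath_matDeg (hd₀ y hy) (hd₁ y hy) t) hB hx) ((hd₁ x hx).sub (hd₀ x hx))

end StraightPath

end Families

/-! ### Gauge transformations. -/

section Gauge

variable {d : ℕ} {l m n : Type*} [Fintype l] [Fintype m] [Fintype n]
  [DecidableEq l] [DecidableEq m] [DecidableEq n]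

lemma toForm_mul (M : Matrix l m ℂ) (N : Matrix m n ℂ) :
    toForm d (M * N) = toForm d M * toForm d N := Matrix.map_mul

lemma toForm_one : toForm d (1 : Matrix n n ℂ) = 1 := by simp [toForm]

section Algebra

variable {a : Matrix n m (Ext (Eucl d))} {b : Matrix m n (Ext (Eucl d))}

lemma conj_mul_conj (hba : b * a = 1) (M N : Matrix m m (Ext (Eucl d))) :
    a * M * b * (a * N * b) = a * (M * N) * b := by
  simp only [Matrix.mul_assoc]
  rw [← Matrix.mul_assoc b a, hba, Matrix.one_mul]

lemma conj_pow (hab : a * b = 1) (hba : b * a = 1) (M : Matrix m m (Ext (Eucl d))) (k : ℕ) :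
    (a * M * b) ^ k = a * M ^ k * b := by
  induction k with
  | zero => rw [pow_zero, pow_zero, Matrix.mul_one, hab]
  | succ k ih => rw [pow_succ, ih, conj_mul_conj hba, pow_succ]

/-- The conjugating matrix has degree zero, so the trace is cyclic for it whatever the degree of M.
-/
lemma trace_conj (hba : b * a = 1) (ha : MatDeg 0 a) (M : Matrix m m (Ext (Eucl d))) :
    (a * M * b).trace = M.trace := by
  rw [Matrix.mul_assoc, trace_mul_comm_even (k := 0) ha, Matrix.mul_assoc, hba, Matrix.mul_one]

lemma chTheta_conj (hab : a * b = 1) (hba : b * a = 1) (ha : MatDeg 0 a)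
    (K β : Matrix m m (Ext (Eucl d))) : chTheta (a * K * b) (a * β * b) = chTheta K β := by
  unfold chTheta
  refine Finset.sum_congr rfl fun k _ => ?_
  rw [conj_pow hab hba, conj_mul_conj hba, trace_conj hba ha]

lemma conj_diagonal {k : ℕ} (hab : a * b = 1) {w : Ext (Eucl d)} (hw : w ∈ deg (Eucl d) (2 * k)) :
    a * (Matrix.diagonal fun _ : m => w) * b = Matrix.diagonal fun _ : n => w := by
  have h : a * (Matrix.diagonal fun _ : m => w) = (Matrix.diagonal fun _ : n => w) * a := by
    ext i j
    rw [Matrix.mul_diagonal, Matrix.diagonal_mul, even_mul_comm hw]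
  rw [h, Matrix.mul_assoc, hab, Matrix.mul_one]

/-- Conjugation by a matrix of degree zero, applied to a central form of any degree. -/
lemma conj_diagonal_of_deg_zero (hab : a * b = 1) (ha : MatDeg 0 a) (w : Ext (Eucl d)) :
    a * (Matrix.diagonal fun _ : m => w) * b = Matrix.diagonal fun _ : n => w := by
  have h : a * (Matrix.diagonal fun _ : m => w) = (Matrix.diagonal fun _ : n => w) * a := by
    ext i j
    rw [Matrix.mul_diagonal, Matrix.diagonal_mul]
    exact even_mul_comm (n := 0) (ha i j) w
  rw [h, Matrix.mul_assoc, hab, Matrix.mul_one]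

end Algebra

variable {X : Type*} [TopologicalSpace X] [ChartedSpace (Eucl d) X] {S : Set X} {x : X}

/-- The gauge transform `h⁻¹ Γ h + h⁻¹ dh` of a connection form. -/
def gauge (h : X → Matrix m n ℂ) (Γ : X → Matrix m m (Ext (Eucl d))) (x : X) :
    Matrix n n (Ext (Eucl d)) :=
  toForm d (h x)ᴴ * Γ x * toForm d (h x) + toForm d (h x)ᴴ * extDMat (fun y => toForm d (h y)) x

variable {h : X → Matrix m n ℂ} {Γ Γ₀ Γ₁ : X → Matrix m m (Ext (Eucl d))}

lemma gauge_congr (hS : IsOpen S) {h' : X → Matrix m n ℂ} {Γ' : X → Matrix m m (Ext (Eucl d))}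
    (hh : ∀ x ∈ S, h x = h' x) (hΓ : Γ x = Γ' x) (hx : x ∈ S) : gauge h Γ x = gauge h' Γ' x := by
  unfold gauge
  rw [hh x hx, hΓ, extDMat_congr hS (fun y hy => by rw [hh y hy]) hx]

lemma gauge_sub_diagonal (h1 : (h x)ᴴ * h x = 1) (A : X → Ext (Eucl d)) :
    gauge h (fun y => Γ y - Matrix.diagonal fun _ => A y) x =
      gauge h Γ x - Matrix.diagonal fun _ => A x := by
  have hab : toForm d (h x)ᴴ * toForm d (h x) = 1 := by rw [← toForm_mul, h1, toForm_one]
  unfold gauge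
  rw [Matrix.mul_sub, Matrix.sub_mul, conj_diagonal_of_deg_zero hab (.toForm _)]
  abel

variable [IsManifold (𝓡 d) ∞ X]

/-- In d(hf) = dh · f + h · df, the first term yields the conjugated inhomogeneous part of the
transform by h. In the second, hᴴ h = 1 leaves the inhomogeneous part of the transform by f. -/
lemma gauge_gauge {f : X → Matrix n l ℂ} (hS : IsOpen S) (hh : MatSmoothOn d h S)
    (hf : MatSmoothOn d f S) (h1 : (h x)ᴴ * h x = 1) (hx : x ∈ S) :
    gauge f (gauge h Γ) x = gauge (fun y => h y * f y) Γ x := by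
  have hd : extDMat (fun y => toForm d (h y * f y)) x =
      extDMat (fun y => toForm d (h y)) x * toForm d (f x) +
        toForm d (h x) * extDMat (fun y => toForm d (f y)) x := by
    simp only [toForm_mul]
    rw [extDMat_mul hS hh.toForm hf.toForm hx,
      (show MatDeg (2 * 0) (toForm d (h x)) from .toForm _).sgnM_even]
  have hab : toForm d (h x)ᴴ * toForm d (h x) = 1 := by rw [← toForm_mul, h1, toForm_one]
  unfold gauge
  rw [hd, Matrix.conjTranspose_mul, toForm_mul, toForm_mul]
  simp only [Matrix.mul_add, Matrix.add_mul, Matrix.mul_assoc]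
  rw [← Matrix.mul_assoc (toForm d (h x)ᴴ) (toForm d (h x)) (extDMat _ x), hab, Matrix.one_mul]
  abel

lemma gauge_formMatSmooth (hS : IsOpen S) (hh : MatSmoothOn d h S) (hΓ : FormMatSmooth Γ S) :
    FormMatSmooth (gauge h Γ) S :=
  ((hh.conjTranspose.toForm.mul hΓ).mul hh.toForm).add
    (hh.conjTranspose.toForm.mul (hh.toForm.extDMat hS))

lemma gauge_matDeg (hS : IsOpen S) (hh : MatSmoothOn d h S) (hΓ : MatDeg 1 (Γ x)) (hx : x ∈ S) :
    MatDeg 1 (gauge h Γ x) := by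
  have h1 : MatDeg (0 + 1 + 0) (toForm d (h x)ᴴ * Γ x * toForm d (h x)) :=
    ((MatDeg.toForm _).mul hΓ).mul (.toForm _)
  have h2 : MatDeg (0 + (0 + 1))
      (toForm d (h x)ᴴ * extDMat (fun y => toForm d (h y)) x) :=
    (MatDeg.toForm _).mul (extDMat_matDeg hS hh.toForm (fun _ _ => .toForm _) hx)
  exact h1.add h2

/-- The twisted curvature transforms by conjugation under a gauge transformation combined with
a shift by a scalar one-form. -/
lemma twCurv_gauge {B B' A : X → Ext (Eucl d)} {Γ' : X → Matrix n n (Ext (Eucl d))}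
    (hS : IsOpen S) (hh : MatSmoothOn d h S) (hl : ∀ x ∈ S, (h x)ᴴ * h x = 1)
    (hr : ∀ x ∈ S, h x * (h x)ᴴ = 1) (hΓ : FormMatSmooth Γ S) (hΓ1 : ∀ x ∈ S, MatDeg 1 (Γ x))
    (hAs : IsSmoothOn A S) (hA : ∀ x ∈ S, A x ∈ deg (Eucl d) 1)
    (hB : ∀ x ∈ S, B x ∈ deg (Eucl d) 2) (hBB : ∀ x ∈ S, B x - B' x = extD A x)
    (hΓ' : ∀ x ∈ S, Γ' x = gauge h Γ x - Matrix.diagonal fun _ => A x) (hx : x ∈ S) :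
    twCurv B' Γ' x = toForm d (h x)ᴴ * twCurv B Γ x * toForm d (h x) := by
  have hbs : FormMatSmooth (fun y => toForm d (h y)) S := hh.toForm
  have has : FormMatSmooth (fun y => toForm d (h y)ᴴ) S := hh.conjTranspose.toForm
  have hdb := hbs.extDMat hS
  set a := toForm d (h x)ᴴ with ha
  set b := toForm d (h x) with hb
  set da := extDMat (fun y => toForm d (h y)ᴴ) x with hda
  set db := extDMat (fun y => toForm d (h y)) x with hdb'
  have ha0 : MatDeg (2 * 0) a := .toForm _
  have hb0 : MatDeg (2 * 0) b := .toForm _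
  have hab : a * b = 1 := by rw [ha, hb, ← toForm_mul, hl x hx, toForm_one]
  have hba : b * a = 1 := by rw [ha, hb, ← toForm_mul, hr x hx, toForm_one]
  -- This is the derivative of hᴴ h = 1; it expresses dh in terms of d(hᴴ) and removes all terms in
  -- dh from the curvature.
  have hdab : da * b + a * db = 0 := by
    have h1 := extDMat_mul hS has hbs hx
    rw [ha0.sgnM_even] at h1
    rw [← h1, extDMat_congr hS (N := fun _ => toForm d (1 : Matrix n n ℂ))
      (fun y hy => by rw [← toForm_mul, hl y hy]) hx, extDMat_toForm_const]
  have hadba : a * db * a = -da := by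
    have := congrArg (· * a) hdab
    simp only [Matrix.add_mul, Matrix.mul_assoc, hba, Matrix.mul_one, Matrix.zero_mul] at this
    rw [Matrix.mul_assoc]
    exact eq_neg_of_add_eq_zero_right this
  have hΓodd : sgnM (Γ x) = -Γ x := (show MatDeg (2 * 0 + 1) (Γ x) from hΓ1 x hx).sgnM_odd
  have hdΓ : extDMat Γ' x = da * Γ x * b + a * extDMat Γ x * b - a * Γ x * db + da * db -
      Matrix.diagonal fun _ => extD A x := by
    rw [extDMat_congr hS hΓ' hx, extDMat_sub hS (gauge_formMatSmooth hS hh hΓ) (.diagonal hAs) hx,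
      extDMat_diagonal]
    have h1 := extDMat_add hS ((has.mul hΓ).mul hbs) (has.mul hdb) hx
    rw [extDMat_mul hS (has.mul hΓ) hbs hx, extDMat_mul hS has hΓ hx, extDMat_mul hS has hdb hx,
      extDMat_extDMat hS hbs hx, sgnM_mul, ha0.sgnM_even, hΓodd] at h1
    refine (congrArg (· - _) h1).trans ?_
    simp only [Matrix.add_mul, Matrix.mul_neg, Matrix.neg_mul, Matrix.mul_zero, add_zero, ← hda,
      ← hdb', ← hb]
    abel
  set G := gauge h Γ x with hG
  have hGe : G = a * Γ x * b + a * db := rfl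
  have hG1 : MatDeg (2 * 0 + 1) G := gauge_matDeg hS hh (hΓ1 x hx) hx
  -- The scalar shift A does not affect the quadratic part: A ∧ A = 0, and A anticommutes with the
  -- one-form matrix G.
  have hAA : (Matrix.diagonal fun _ : n => A x) * (Matrix.diagonal fun _ => A x) = 0 := by
    obtain ⟨v, hv⟩ := mem_deg_one_iff.1 (hA x hx)
    rw [Matrix.diagonal_mul_diagonal, hv]
    simp only [ExteriorAlgebra.ι_sq_zero]
    exact Matrix.diagonal_zero
  have hAG : (Matrix.diagonal fun _ : n => A x) * G = -(G * Matrix.diagonal fun _ => A x) := by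
    rw [diagonal_mul_comm_sgn (k := 0) (hA x hx), hG1.sgnM_odd, Matrix.neg_mul]
  have hsq : Γ' x * Γ' x = G * G := by
    rw [hΓ' x hx, Matrix.sub_mul, Matrix.mul_sub, Matrix.mul_sub, hAG, hAA]
    abel
  have hGG : G * G = a * (Γ x * Γ x) * b + a * Γ x * db - da * Γ x * b - da * db := by
    have e1 : a * db * (a * Γ x * b) = -(da * Γ x * b) := by
      rw [← Matrix.mul_assoc, ← Matrix.mul_assoc, hadba]
      simp only [Matrix.neg_mul]
    have e2 : a * db * (a * db) = -(da * db) := by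
      rw [← Matrix.mul_assoc, hadba, Matrix.neg_mul]
    have e3 : a * Γ x * b * (a * db) = a * Γ x * db := by
      rw [← Matrix.mul_assoc, Matrix.mul_assoc (a * Γ x) b a, hba, Matrix.mul_one]
    rw [hGe, Matrix.add_mul, Matrix.mul_add, Matrix.mul_add, conj_mul_conj hba, e1, e2, e3]
    abel
  -- The term -dA left over from dΓ' is cancelled by the change of B. This is the role of B_j - B_i
  -- = dA_ji.
  have hBB' : (Matrix.diagonal fun _ : n => B' x) =
      (Matrix.diagonal fun _ => B x) - Matrix.diagonal fun _ => extD A x := by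
    rw [Matrix.diagonal_sub]
    congr 1
    funext _
    rw [← hBB x hx]; abel
  rw [twCurv, hdΓ, hsq, hGG, hBB', twCurv, Matrix.mul_sub, Matrix.sub_mul,
    conj_diagonal (k := 1) hab (hB x hx), Matrix.mul_add, Matrix.add_mul]
  abel

/-- Gauge transformation and the shift by A are affine in the connection: the inhomogeneous terms
carry total weight (1 - t) + t = 1. Straight paths therefore go to straight paths. -/
lemma gauge_straightPath (A : X → Ext (Eucl d)) (t : ℝ) :
    gauge h (straightPath Γ₀ Γ₁ t) x - Matrix.diagonal (fun _ => A x) =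
      straightPath (fun y => gauge h Γ₀ y - Matrix.diagonal fun _ => A y)
        (fun y => gauge h Γ₁ y - Matrix.diagonal fun _ => A y) t x := by
  simp only [gauge, straightPath, Matrix.mul_add, Matrix.add_mul, Matrix.mul_smul, Matrix.smul_mul]
  module

/-- Gauge invariance of the Chern–Simons form. -/
lemma csForm_gauge {B B' A : X → Ext (Eucl d)} {Γ₀' Γ₁' : X → Matrix n n (Ext (Eucl d))}
    (hS : IsOpen S) (hh : MatSmoothOn d h S) (hl : ∀ x ∈ S, (h x)ᴴ * h x = 1)
    (hr : ∀ x ∈ S, h x * (h x)ᴴ = 1) (h₀ : FormMatSmooth Γ₀ S) (h₁ : FormMatSmooth Γ₁ S)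
    (hd₀ : ∀ x ∈ S, MatDeg 1 (Γ₀ x)) (hd₁ : ∀ x ∈ S, MatDeg 1 (Γ₁ x))
    (hAs : IsSmoothOn A S) (hA : ∀ x ∈ S, A x ∈ deg (Eucl d) 1)
    (hBs : IsSmoothOn B S) (hB : ∀ x ∈ S, B x ∈ deg (Eucl d) 2)
    (hBs' : IsSmoothOn B' S) (hB' : ∀ x ∈ S, B' x ∈ deg (Eucl d) 2)
    (hBB : ∀ x ∈ S, B x - B' x = extD A x)
    (h₀' : ∀ x ∈ S, Γ₀' x = gauge h Γ₀ x - Matrix.diagonal fun _ => A x)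
    (h₁' : ∀ x ∈ S, Γ₁' x = gauge h Γ₁ x - Matrix.diagonal fun _ => A x) (hx : x ∈ S) :
    csForm B' (straightPath Γ₀' Γ₁') x = csForm B (straightPath Γ₀ Γ₁) x := by
  have hs₀ : FormMatSmooth Γ₀' S :=
    ((gauge_formMatSmooth hS hh h₀).sub (.diagonal hAs)).congr h₀'
  have hs₁ : FormMatSmooth Γ₁' S :=
    ((gauge_formMatSmooth hS hh h₁).sub (.diagonal hAs)).congr h₁'
  have hdeg₀ : ∀ x ∈ S, MatDeg 1 (Γ₀' x) := fun x hx => by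
    rw [h₀' x hx]; exact (gauge_matDeg hS hh (hd₀ x hx) hx).sub (.diagonal (hA x hx))
  have hdeg₁ : ∀ x ∈ S, MatDeg 1 (Γ₁' x) := fun x hx => by
    rw [h₁' x hx]; exact (gauge_matDeg hS hh (hd₁ x hx) hx).sub (.diagonal (hA x hx))
  have hab : toForm d (h x)ᴴ * toForm d (h x) = 1 := by rw [← toForm_mul, hl x hx, toForm_one]
  have hba : toForm d (h x) * toForm d (h x)ᴴ = 1 := by rw [← toForm_mul, hr x hx, toForm_one]
  rw [csForm_eq hS hs₀ hs₁ hdeg₀ hdeg₁ hBs' hB' hx, csForm_eq hS h₀ h₁ hd₀ hd₁ hBs hB hx]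
  congr 2
  funext t
  -- The inhomogeneous terms cancel in a difference of connections, so the velocity is conjugated
  -- just like the curvature, and the trace does not see the conjugation.
  have hβ : Γ₁' x - Γ₀' x = toForm d (h x)ᴴ * (Γ₁ x - Γ₀ x) * toForm d (h x) := by
    rw [h₀' x hx, h₁' x hx, gauge, gauge, Matrix.mul_sub, Matrix.sub_mul]
    abel
  rw [hβ, twCurv_gauge hS hh hl hr ((FormMatFam.straightPath h₀ h₁).formMatSmooth t)
    (fun y hy => straightPath_matDeg (hd₀ y hy) (hd₁ y hy) t) hAs hA hB hBB (fun y hy => ?_) hx,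
    chTheta_conj hab hba (.toForm _)]
  rw [gauge_straightPath, straightPath, straightPath, h₀' y hy, h₁' y hy]

end Gauge

/-! ### The second-order transgression form. -/

section Eta

variable {d : ℕ} {m n : Type*} [Fintype m] [Fintype n] [DecidableEq m] [DecidableEq n]

/-- The transgression form of second order, in the directions `β` and `γ`. -/
def chEta (K β γ : Matrix n n (Ext (Eucl d))) : Ext (Eucl d) :=
  ∑ k ∈ Finset.range d, (((k + 1).factorial : ℂ)⁻¹) •
    ∑ p ∈ Finset.HasAntidiagonal.antidiagonal k, (β * K ^ p.1 * γ * K ^ p.2).trace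

/-- The derivative of `chTheta K β` with respect to `K`, in direction `L`. -/
def chThetaDeriv (K L β : Matrix n n (Ext (Eucl d))) : Ext (Eucl d) :=
  ∑ k ∈ Finset.range d, (((k + 1).factorial : ℂ)⁻¹) •
    ∑ p ∈ Finset.HasAntidiagonal.antidiagonal k, (β * (K ^ p.1 * L * K ^ p.2)).trace

lemma chEta_conj {a : Matrix n m (Ext (Eucl d))} {b : Matrix m n (Ext (Eucl d))}
    (hab : a * b = 1) (hba : b * a = 1) (ha : MatDeg 0 a) (K β γ : Matrix m m (Ext (Eucl d))) :
    chEta (a * K * b) (a * β * b) (a * γ * b) = chEta K β γ := by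
  unfold chEta
  refine Finset.sum_congr rfl fun k _ => congrArg _ (Finset.sum_congr rfl fun p _ => ?_)
  rw [conj_pow hab hba, conj_pow hab hba, conj_mul_conj hba, conj_mul_conj hba, conj_mul_conj hba,
    trace_conj hba ha]

lemma chEta_mem_parity {K β γ : Matrix n n (Ext (Eucl d))} (hK : MatDeg 2 K) (hβ : MatDeg 1 β)
    (hγ : MatDeg 1 γ) : chEta K β γ ∈ parity (Eucl d) 0 := by
  refine Submodule.sum_mem _ fun m _ => Submodule.smul_mem _ _ (Submodule.sum_mem _ fun p _ => ?_)
  have h := deg_le_parity _ (((hβ.mul (hK.pow p.1)).mul hγ).mul (hK.pow p.2)).trace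
  have e : ((1 + 2 * p.1 + 1 + 2 * p.2 : ℕ) : ZMod 2) = 0 := by
    rw [ZMod.natCast_eq_zero_iff]
    exact ⟨p.1 + p.2 + 1, by ring⟩
  rwa [e] at h

/-- The word (p, q) with p + q = k arises from (p + 1, q) with weight p + 1 and from (p, q + 1) with
weight q + 1, in total k + 2. Words with a truncated exponent have coefficient zero. -/
lemma sum_antidiagonal_lower {E : Type*} [AddCommGroup E] [Module ℂ E] (F : ℕ → ℕ → E) (k : ℕ) :
    ∑ p ∈ Finset.HasAntidiagonal.antidiagonal (k + 1),
      ((p.1 : ℂ) • F (p.1 - 1) p.2 + (p.2 : ℂ) • F p.1 (p.2 - 1)) =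
    ((k : ℂ) + 2) • ∑ p ∈ Finset.HasAntidiagonal.antidiagonal k, F p.1 p.2 := by
  rw [Finset.sum_add_distrib, Finset.Nat.sum_antidiagonal_succ, Finset.Nat.sum_antidiagonal_succ']
  simp only [Nat.cast_zero, zero_smul, zero_add, Nat.add_sub_cancel, Finset.smul_sum]
  rw [← Finset.sum_add_distrib]
  refine Finset.sum_congr rfl fun p hp => ?_
  rw [Finset.HasAntidiagonal.mem_antidiagonal] at hp
  rw [← hp]
  push_cast
  module

/-- The identity (k + 2) / (k + 2)! = 1 / (k + 1)! reproduces the same series shifted by one. The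
top term, which the shift loses, is the one that `hF` kills. -/
lemma sum_factorial_shift (N : ℕ) {h : Ext (Eucl d)} {F U : ℕ → Ext (Eucl d)} (h0 : U 0 = 0)
    (hU : ∀ k, U (k + 1) = ((k : ℂ) + 2) • F k) (hF : ∀ k, k + 1 = N → h * F k = 0) :
    ∑ k ∈ Finset.range N, (((k + 1).factorial : ℂ)⁻¹) • (h * U k) =
      h * ∑ k ∈ Finset.range N, (((k + 1).factorial : ℂ)⁻¹) • F k := by
  rcases N with _ | N
  · simp
  rw [Finset.sum_range_succ', h0, mul_zero, smul_zero, add_zero, Finset.sum_range_succ, mul_add,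
    mul_smul_comm, hF N rfl, smul_zero, add_zero, Finset.mul_sum]
  refine Finset.sum_congr rfl fun k _ => ?_
  rw [hU, mul_smul_comm, smul_smul, mul_smul_comm]
  congr 1
  rw [Nat.factorial_succ (k + 1)]
  have h1 : ((k + 1).factorial : ℂ) ≠ 0 := by exact_mod_cast Nat.factorial_ne_zero _
  have h2 : (k : ℂ) + 2 ≠ 0 := by exact_mod_cast (Nat.succ_ne_zero (k + 1))
  have h3 : (k : ℂ) + 1 + 1 ≠ 0 := by rwa [add_assoc, one_add_one_eq_two]
  push_cast
  field_simp
  ring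

variable {X : Type*} [TopologicalSpace X] [ChartedSpace (Eucl d) X] [IsManifold (𝓡 d) ∞ X]
  {S : Set X} {x : X} {B : X → Ext (Eucl d)} {Γ β γ : X → Matrix n n (Ext (Eucl d))}

/-- The word is even, so d becomes ∇ under the trace, and ∇ is expanded as a graded derivation. By
the Bianchi identity each factor K contributes -dB, which is then moved to the front. The word with
∇β is rotated cyclically to match the shape of `chThetaDeriv`. -/
lemma extD_trace_word (hS : IsOpen S) (hΓ : FormMatSmooth Γ S) (hΓ1 : ∀ x ∈ S, MatDeg 1 (Γ x))
    (hBs : IsSmoothOn B S) (hB : ∀ x ∈ S, B x ∈ deg (Eucl d) 2) (hβ : FormMatSmooth β S)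
    (hβ1 : ∀ x ∈ S, MatDeg 1 (β x)) (hγ : FormMatSmooth γ S) (hγ1 : ∀ x ∈ S, MatDeg 1 (γ x))
    (hx : x ∈ S) (a b : ℕ) :
    extD (fun y => (β y * twCurv B Γ y ^ a * γ y * twCurv B Γ y ^ b).trace) x =
      (γ x * (twCurv B Γ x ^ b * nabla Γ β x * twCurv B Γ x ^ a)).trace -
        (β x * (twCurv B Γ x ^ a * nabla Γ γ x * twCurv B Γ x ^ b)).trace -
        extD B x *
          ((a : ℂ) • (β x * twCurv B Γ x ^ (a - 1) * γ x * twCurv B Γ x ^ b).trace +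
            (b : ℂ) • (β x * twCurv B Γ x ^ a * γ x * twCurv B Γ x ^ (b - 1)).trace) := by
  set K := twCurv B Γ with hKdef
  have hKs : FormMatSmooth K S :=
    ((hΓ.extDMat hS).add (hΓ.mul hΓ)).sub (.diagonal hBs)
  have hK2 : ∀ x ∈ S, MatDeg 2 (K x) := fun y hy => twCurv_matDeg hS hΓ hΓ1 hB hy
  have hh := bianchi hS hΓ hΓ1 hBs hB hx
  have hh3 : extD B x ∈ deg (Eucl d) (2 * 1 + 1) := extD_mem_deg hS hBs hB hx
  have hK : ∀ k, MatDeg (2 * k) (K x ^ k) := fun k => (hK2 x hx).pow k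
  have hβo : sgnM (β x) = -β x := (show MatDeg (2 * 0 + 1) (β x) from hβ1 x hx).sgnM_odd
  have hγo : sgnM (γ x) = -γ x := (show MatDeg (2 * 0 + 1) (γ x) from hγ1 x hx).sgnM_odd
  have hdeg : MatDeg (2 * (a + b + 1)) (β x * K x ^ a * γ x * K x ^ b) := by
    have := (((hβ1 x hx).mul (hK a)).mul (hγ1 x hx)).mul (hK b)
    rwa [show 1 + 2 * a + 1 + 2 * b = 2 * (a + b + 1) by ring] at this
  rw [extD_trace_eq_nabla (Γ := Γ) hS (((hβ.mul (hKs.pow a)).mul hγ).mul (hKs.pow b)) hdeg hx,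
    nabla_mul hS ((hβ.mul (hKs.pow a)).mul hγ) (hKs.pow b) hx,
    nabla_mul hS (hβ.mul (hKs.pow a)) hγ hx, nabla_mul hS hβ (hKs.pow a) hx,
    nabla_pow hS hKs hK2 hh hx, nabla_pow hS hKs hK2 hh hx]
  simp only [sgnM_mul, hβo, hγo, (hK a).sgnM_even]
  set D : Matrix n n (Ext (Eucl d)) := Matrix.diagonal fun _ => extD B x with hD
  have hc1 : β x * D = -(D * β x) := by
    rw [hD, diagonal_mul_comm_sgn hh3, hβo, neg_mul, neg_neg]
  have hc2 : β x * K x ^ a * γ x * D = D * (β x * K x ^ a * γ x) := by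
    rw [hD, diagonal_mul_comm_sgn hh3, sgnM_mul, sgnM_mul, hβo, hγo, (hK a).sgnM_even]
    simp only [neg_mul, mul_neg, neg_neg]
  have e1 : β x * ((a : ℂ) • (D * K x ^ (a - 1))) * γ x * K x ^ b =
      -((a : ℂ) • (D * (β x * K x ^ (a - 1) * γ x * K x ^ b))) := by
    rw [mul_smul_comm, ← mul_assoc, hc1]
    simp only [neg_mul, smul_neg, smul_mul_assoc, mul_assoc]
  have e2 : β x * K x ^ a * γ x * ((b : ℂ) • (D * K x ^ (b - 1))) =
      (b : ℂ) • (D * (β x * K x ^ a * γ x * K x ^ (b - 1))) := by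
    rw [mul_smul_comm, ← mul_assoc, hc2, mul_assoc]
  have hβd : MatDeg (2 * 1) (nabla Γ β x) :=
    ((extDMat_matDeg hS hβ hβ1 hx).add ((hΓ1 x hx).mul (hβ1 x hx))).sub
      (by rw [hβo]; exact (hβ1 x hx).neg.mul (hΓ1 x hx))
  have e3 : (γ x * (K x ^ b * nabla Γ β x * K x ^ a)).trace =
      (nabla Γ β x * K x ^ a * γ x * K x ^ b).trace := by
    have h4 : MatDeg (2 * (1 + a)) (nabla Γ β x * K x ^ a) := by
      have := hβd.mul (hK a)
      rwa [← mul_add] at this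
    rw [mul_assoc (nabla Γ β x * K x ^ a), trace_mul_comm_even h4]
    simp only [mul_assoc]
  have e4 : β x * (K x ^ a * nabla Γ γ x * K x ^ b) = β x * K x ^ a * nabla Γ γ x * K x ^ b := by
    simp only [mul_assoc]
  rw [e3, e4]
  have e5 : (nabla Γ β x * K x ^ a + -β x * -((a : ℂ) • (D * K x ^ (a - 1)))) * γ x * K x ^ b =
      nabla Γ β x * K x ^ a * γ x * K x ^ b -
        (a : ℂ) • (D * (β x * K x ^ (a - 1) * γ x * K x ^ b)) := by
    rw [neg_mul_neg, add_mul, add_mul, e1, sub_eq_add_neg]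
  have e6 : ((nabla Γ β x * K x ^ a + -β x * -((a : ℂ) • (D * K x ^ (a - 1)))) * γ x +
      -β x * K x ^ a * nabla Γ γ x) * K x ^ b +
        -β x * K x ^ a * -γ x * -((b : ℂ) • (D * K x ^ (b - 1))) =
      nabla Γ β x * K x ^ a * γ x * K x ^ b -
        (a : ℂ) • (D * (β x * K x ^ (a - 1) * γ x * K x ^ b)) -
        β x * K x ^ a * nabla Γ γ x * K x ^ b -
        (b : ℂ) • (D * (β x * K x ^ a * γ x * K x ^ (b - 1))) := by
    rw [add_mul, e5, mul_neg, ← e2]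
    noncomm_ring
  rw [e6]
  simp only [Matrix.trace_sub, Matrix.trace_smul, hD, trace_diagonal_mul, mul_add, mul_smul_comm]
  abel

/-- The exterior derivative of `chEta` measures the failure of `chTheta` to be a closed one-form
on the space of connections. -/
lemma extD_chEta (hS : IsOpen S) (hΓ : FormMatSmooth Γ S) (hΓ1 : ∀ x ∈ S, MatDeg 1 (Γ x))
    (hBs : IsSmoothOn B S) (hB : ∀ x ∈ S, B x ∈ deg (Eucl d) 2) (hβ : FormMatSmooth β S)
    (hβ1 : ∀ x ∈ S, MatDeg 1 (β x)) (hγ : FormMatSmooth γ S) (hγ1 : ∀ x ∈ S, MatDeg 1 (γ x))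
    (hx : x ∈ S) :
    extD (fun y => chEta (twCurv B Γ y) (β y) (γ y)) x +
        extD B x * chEta (twCurv B Γ x) (β x) (γ x) =
      chThetaDeriv (twCurv B Γ x) (nabla Γ β x) (γ x) -
        chThetaDeriv (twCurv B Γ x) (nabla Γ γ x) (β x) := by
  have hKs : FormMatSmooth (twCurv B Γ) S :=
    ((hΓ.extDMat hS).add (hΓ.mul hΓ)).sub (.diagonal hBs)
  have hK2 : ∀ x ∈ S, MatDeg 2 (twCurv B Γ x) := fun y hy => twCurv_matDeg hS hΓ hΓ1 hB hy
  have hws : ∀ a b, IsSmoothOn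
      (fun y => (β y * twCurv B Γ y ^ a * γ y * twCurv B Γ y ^ b).trace) S := fun a b =>
    (((hβ.mul (hKs.pow a)).mul hγ).mul (hKs.pow b)).trace
  set F : ℕ → ℕ → Ext (Eucl d) := fun a b =>
    (β x * twCurv B Γ x ^ a * γ x * twCurv B Γ x ^ b).trace with hF
  have hFd : ∀ a b, F a b ∈ deg (Eucl d) (1 + 2 * a + 1 + 2 * b) := fun a b =>
    ((((hβ1 x hx).mul ((hK2 x hx).pow a)).mul (hγ1 x hx)).mul ((hK2 x hx).pow b)).trace
  have h1 : extD (fun y => chEta (twCurv B Γ y) (β y) (γ y)) x =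
      ∑ k ∈ Finset.range d, (((k + 1).factorial : ℂ)⁻¹) • ∑ p ∈ Finset.HasAntidiagonal.antidiagonal k,
        extD (fun y => (β y * twCurv B Γ y ^ p.1 * γ y * twCurv B Γ y ^ p.2).trace) x := by
    unfold chEta
    rw [extD_sum _ hS (fun k _ => (IsSmoothOn.sum _ fun p _ => hws _ _).const_smul _) hx]
    refine Finset.sum_congr rfl fun k _ => ?_
    rw [extD_const_smul hS _ (IsSmoothOn.sum _ fun p _ => hws _ _) hx,
      extD_sum _ hS (fun p _ => hws _ _) hx]
  have h2 : extD B x * chEta (twCurv B Γ x) (β x) (γ x) =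
      ∑ k ∈ Finset.range d, (((k + 1).factorial : ℂ)⁻¹) • (extD B x *
        ∑ p ∈ Finset.HasAntidiagonal.antidiagonal k,
          ((p.1 : ℂ) • F (p.1 - 1) p.2 + (p.2 : ℂ) • F p.1 (p.2 - 1))) := by
    refine (sum_factorial_shift d (F := fun k => ∑ p ∈ Finset.HasAntidiagonal.antidiagonal k, F p.1 p.2) (by simp)
      (fun k => sum_antidiagonal_lower F k) fun k hk => ?_).symm
    -- For k + 1 = d the product with dB has degree 3 + 2 + 2(d - 1) = 2d + 3, which exceeds the
    -- dimension, so the lost top term vanishes.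
    rw [Finset.mul_sum]
    refine Finset.sum_eq_zero fun p hp => ?_
    rw [Finset.HasAntidiagonal.mem_antidiagonal] at hp
    have := mul_deg (extD_mem_deg hS hBs hB hx) (hFd p.1 p.2)
    rw [deg_eq_bot (by omega)] at this
    exact (Submodule.mem_bot ℂ).1 this
  -- Rotating the trace exchanged the two exponents; the sum over all (p, q) with p + q = k is
  -- symmetric under this exchange.
  have h3 : ∀ k, ∑ p ∈ Finset.HasAntidiagonal.antidiagonal k,
      (γ x * (twCurv B Γ x ^ p.2 * nabla Γ β x * twCurv B Γ x ^ p.1)).trace =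
      ∑ p ∈ Finset.HasAntidiagonal.antidiagonal k,
        (γ x * (twCurv B Γ x ^ p.1 * nabla Γ β x * twCurv B Γ x ^ p.2)).trace := fun k =>
    (Finset.Nat.sum_antidiagonal_swap (f := fun p : ℕ × ℕ =>
      (γ x * (twCurv B Γ x ^ p.1 * nabla Γ β x * twCurv B Γ x ^ p.2)).trace))
  rw [h1, h2, chThetaDeriv, chThetaDeriv, ← Finset.sum_add_distrib, ← Finset.sum_sub_distrib]
  refine Finset.sum_congr rfl fun k _ => ?_
  rw [← smul_add, ← smul_sub, ← h3, Finset.mul_sum, ← Finset.sum_add_distrib,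
    ← Finset.sum_sub_distrib]
  congr 1
  refine Finset.sum_congr rfl fun p _ => ?_
  rw [extD_trace_word hS hΓ hΓ1 hBs hB hβ hβ1 hγ hγ1 hx]
  abel

end Eta

/-! ### Derivatives in a real parameter of matrices of forms. -/

section MatrixDerivative

variable {d : ℕ} {l m n : Type*}

/-- Entrywise differentiability of a path of matrices of forms. -/
def MatHasDeriv (M : ℝ → Matrix m n (Ext (Eucl d))) (M' : Matrix m n (Ext (Eucl d))) (t : ℝ) :
    Prop :=
  ∀ a b, HasDerivAt (fun s => M s a b) (M' a b) t

variable {t : ℝ} {M N : ℝ → Matrix m n (Ext (Eucl d))} {M' N' : Matrix m n (Ext (Eucl d))}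

lemma MatHasDeriv.const (M : Matrix m n (Ext (Eucl d))) : MatHasDeriv (fun _ => M) 0 t :=
  fun _ _ => hasDerivAt_const _ _

lemma MatHasDeriv.add (hM : MatHasDeriv M M' t) (hN : MatHasDeriv N N' t) :
    MatHasDeriv (fun s => M s + N s) (M' + N') t := fun a b => (hM a b).add (hN a b)

lemma MatHasDeriv.sub (hM : MatHasDeriv M M' t) (hN : MatHasDeriv N N' t) :
    MatHasDeriv (fun s => M s - N s) (M' - N') t := fun a b => (hM a b).sub (hN a b)

lemma MatHasDeriv.ofReal_smul (M : Matrix m n (Ext (Eucl d))) :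
    MatHasDeriv (fun s => (s : ℂ) • M) M t := fun a b => by
  have h : HasDerivAt (fun s : ℝ => (s : ℂ) • M a b) ((1 : ℂ) • M a b) t :=
    (Complex.ofRealCLM.hasDerivAt (x := t)).smul_const (M a b)
  rwa [one_smul] at h

lemma MatHasDeriv.mul [Fintype n] {N : ℝ → Matrix n l (Ext (Eucl d))}
    {N' : Matrix n l (Ext (Eucl d))} (hM : MatHasDeriv M M' t) (hN : MatHasDeriv N N' t) :
    MatHasDeriv (fun s => M s * N s) (M' * N t + M t * N') t := fun a b => by
  simp only [Matrix.add_apply, Matrix.mul_apply, ← Finset.sum_add_distrib]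
  exact HasDerivAt.fun_sum fun c _ => (hM a c).mul (hN c b)

lemma MatHasDeriv.trace [Fintype n] {M : ℝ → Matrix n n (Ext (Eucl d))}
    {M' : Matrix n n (Ext (Eucl d))} (hM : MatHasDeriv M M' t) :
    HasDerivAt (fun s => (M s).trace) M'.trace t :=
  HasDerivAt.fun_sum fun a _ => hM a a

variable [Fintype n] [DecidableEq n]

/-- K and its derivative need not commute, so the power rule retains the position of L. -/
lemma MatHasDeriv.pow_succ {K : ℝ → Matrix n n (Ext (Eucl d))} {L : Matrix n n (Ext (Eucl d))}
    (hK : MatHasDeriv K L t) (k : ℕ) :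
    MatHasDeriv (fun s => K s ^ (k + 1))
      (∑ p ∈ Finset.HasAntidiagonal.antidiagonal k, K t ^ p.1 * L * K t ^ p.2) t := by
  induction k with
  | zero => simpa using hK
  | succ k ih =>
    have h := ih.mul hK
    simp only [← _root_.pow_succ] at h
    rw [Finset.Nat.sum_antidiagonal_succ', pow_zero, mul_one, add_comm (_ * L)]
    simp only [Finset.sum_mul, mul_assoc, ← _root_.pow_succ] at h ⊢
    exact h

lemma hasDerivAt_chTheta {K β : ℝ → Matrix n n (Ext (Eucl d))} {L β' : Matrix n n (Ext (Eucl d))}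
    (hK : MatHasDeriv K L t) (hβ : MatHasDeriv β β' t) :
    HasDerivAt (fun s => chTheta (K s) (β s)) (chTheta (K t) β' + chThetaDeriv (K t) L (β t)) t := by
  -- The summand k = 0 does not contain K, hence the case distinction. The remaining ones, reindexed
  -- by k + 1, form the sum over `range d` in `chThetaDeriv`.
  have h : ∀ k ∈ Finset.range (d + 1), HasDerivAt
      (fun s => ((k.factorial : ℂ)⁻¹) • (β s * K s ^ k).trace)
      (((k.factorial : ℂ)⁻¹) • ((β' * K t ^ k).trace + if k = 0 then 0 else
        ∑ p ∈ Finset.HasAntidiagonal.antidiagonal (k - 1),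
          (β t * (K t ^ p.1 * L * K t ^ p.2)).trace)) t := by
    intro k _
    refine HasDerivAt.const_smul (R := ℂ) _ ?_
    rcases k with _ | k
    · simpa using hβ.trace
    · have := (hβ.mul (hK.pow_succ k)).trace
      simpa only [Matrix.trace_add, Finset.mul_sum, Matrix.trace_sum, Nat.add_sub_cancel,
        Nat.succ_ne_zero, if_false] using this
  refine (HasDerivAt.fun_sum h).congr_deriv ?_
  simp only [smul_add, Finset.sum_add_distrib]
  rw [chTheta, chThetaDeriv]
  congr 1
  rw [Finset.sum_range_succ']
  simp

end MatrixDerivative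

/-! ### Green's formula on the unit square. -/

section Square

variable {E : Type*} [NormedAddCommGroup E] [NormedSpace ℝ E] [CompleteSpace E]

/-- The fundamental theorem of calculus is applied to g' in t and, after Fubini, to f' in s.
Continuity on the compact square supplies the integrability. -/
lemma integral_square {f g f' g' : ℝ → ℝ → E}
    (hf : ∀ s t, HasDerivAt (fun s => f s t) (f' s t) s)
    (hg : ∀ s t, HasDerivAt (fun t => g s t) (g' s t) t)
    (hf' : Continuous fun q : ℝ × ℝ => f' q.1 q.2) (hg' : Continuous fun q : ℝ × ℝ => g' q.1 q.2) :
    ∫ s in (0 : ℝ)..1, ∫ t in (0 : ℝ)..1, (f' s t - g' s t) =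
      (∫ t in (0 : ℝ)..1, (f 1 t - f 0 t)) - ∫ s in (0 : ℝ)..1, (g s 1 - g s 0) := by
  have c1 : ∀ s, Continuous fun t => f' s t := fun s =>
    hf'.comp (f := fun t => (s, t)) (by fun_prop)
  have c2 : ∀ s, Continuous fun t => g' s t := fun s =>
    hg'.comp (f := fun t => (s, t)) (by fun_prop)
  have c3 : ∀ t, Continuous fun s => f' s t := fun t =>
    hf'.comp (f := fun s => (s, t)) (by fun_prop)
  have h1 : ∀ s, ∫ t in (0 : ℝ)..1, (f' s t - g' s t) =
      (∫ t in (0 : ℝ)..1, f' s t) - (g s 1 - g s 0) := fun s => by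
    rw [intervalIntegral.integral_sub ((c1 s).intervalIntegrable 0 1)
      ((c2 s).intervalIntegrable 0 1), intervalIntegral.integral_eq_sub_of_hasDerivAt
      (fun t _ => hg s t) ((c2 s).intervalIntegrable 0 1)]
  have h2 : Continuous fun s => ∫ t in (0 : ℝ)..1, f' s t :=
    intervalIntegral.continuous_parametric_intervalIntegral_of_continuous' (f := f') hf' 0 1
  have h3 : Continuous fun s => g s 1 - g s 0 := by
    have : Continuous fun s => ∫ t in (0 : ℝ)..1, g' s t :=
      intervalIntegral.continuous_parametric_intervalIntegral_of_continuous' (f := g') hg' 0 1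
    refine this.congr fun s => ?_
    rw [intervalIntegral.integral_eq_sub_of_hasDerivAt
      (fun t _ => hg s t) ((c2 s).intervalIntegrable 0 1)]
  simp only [h1]
  rw [intervalIntegral.integral_sub (h2.intervalIntegrable 0 1) (h3.intervalIntegrable 0 1)]
  congr 1
  have h4 : ∀ t, f 1 t - f 0 t = ∫ s in (0 : ℝ)..1, f' s t := fun t =>
    (intervalIntegral.integral_eq_sub_of_hasDerivAt (fun s _ => hf s t)
      ((c3 t).intervalIntegrable 0 1)).symm
  simp only [h4, intervalIntegral.integral_of_le (zero_le_one (α := ℝ))]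
  refine MeasureTheory.integral_integral_swap ?_
  rw [MeasureTheory.Measure.prod_restrict]
  exact (hf'.continuousOn.integrableOn_compact (isCompact_Icc.prod isCompact_Icc)).mono_set
    (Set.prod_mono Set.Ioc_subset_Icc_self Set.Ioc_subset_Icc_self)

end Square

/-! ### Replacing a family by one that agrees with it on S. -/

section Families

variable {d : ℕ} {X : Type*} [TopologicalSpace X] [ChartedSpace (Eucl d) X]
  {P : Type*} [TopologicalSpace P] {S : Set X} {f g : P → X → Ext (Eucl d)}

lemma SmoothFam.congr (hf : SmoothFam S f) (h : ∀ p, ∀ x ∈ S, g p x = f p x) : SmoothFam S g := by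
  obtain ⟨κ, _, ψ, c, hψ, hc, h'⟩ := hf
  exact ⟨κ, inferInstance, ψ, c, hψ, hc, fun p x hx => (h p x hx).trans (h' p x hx)⟩

end Families

/-! ### Stokes' theorem on a triangle of connections. -/

section Triangle

variable {d : ℕ} {X : Type*} [TopologicalSpace X] [ChartedSpace (Eucl d) X]
  [IsManifold (𝓡 d) ∞ X] {n : Type*} [Fintype n] [DecidableEq n]
  {S : Set X} {x : X} {B : X → Ext (Eucl d)} {Γ P Q Γ₀ Γ₁ Γ₂ : X → Matrix n n (Ext (Eucl d))}

/-- The derivative of the curvature in direction Q is dQ + ΓQ + QΓ, which is ∇Q because Q is odd. -/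
lemma twCurv_hasDeriv (hS : IsOpen S) (hP : FormMatSmooth P S) (hQ : FormMatSmooth Q S)
    (hQ1 : ∀ x ∈ S, MatDeg 1 (Q x)) (hx : x ∈ S) (t : ℝ) :
    MatHasDeriv (fun s : ℝ => twCurv B (fun y => P y + (s : ℂ) • Q y) x)
      (nabla (fun y => P y + (t : ℂ) • Q y) Q x) t := by
  have hQo : sgnM (Q x) = -Q x := (show MatDeg (2 * 0 + 1) (Q x) from hQ1 x hx).sgnM_odd
  have h0 : ∀ s : ℝ, extDMat (fun y => P y + (s : ℂ) • Q y) x =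
      extDMat P x + (s : ℂ) • extDMat Q x := fun s => by
    rw [extDMat_add hS hP (hQ.smul _) hx, extDMat_smul hS _ hQ hx]
  have h1 : MatHasDeriv (fun s : ℝ => P x + (s : ℂ) • Q x) (0 + Q x) t :=
    (MatHasDeriv.const _).add (.ofReal_smul _)
  have h := (((MatHasDeriv.const (extDMat P x)).add (.ofReal_smul (extDMat Q x))).add
    (h1.mul h1)).sub (MatHasDeriv.const (t := t) (Matrix.diagonal fun _ : n => B x))
  have e : nabla (fun y => P y + (t : ℂ) • Q y) Q x =
      0 + extDMat Q x + ((0 + Q x) * (P x + (t : ℂ) • Q x) + (P x + (t : ℂ) • Q x) * (0 + Q x)) -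
        0 := by
    rw [nabla, hQo, zero_add, zero_add, sub_zero, neg_mul, sub_neg_eq_add, add_assoc,
      add_comm (_ * Q x)]
  rw [e]
  refine fun a b => (h a b).congr_of_eventuallyEq (Filter.Eventually.of_forall fun s => ?_)
  change twCurv B (fun y => P y + (s : ℂ) • Q y) x a b = _
  rw [twCurv, h0]

lemma straightPath_eq (t : ℝ) :
    straightPath Γ₀ Γ₁ t = fun y => Γ₀ y + (t : ℂ) • (Γ₁ y - Γ₀ y) := by
  funext y
  rw [straightPath]
  module

lemma FormMatFam.nabla {R : Type*} [TopologicalSpace R] {Φ M : R → X → Matrix n n (Ext (Eucl d))}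
    (hS : IsOpen S) (hΦ : FormMatFam S Φ) (hM : FormMatFam S M)
    (hM1 : ∀ r, ∀ x ∈ S, MatDeg 1 (M r x)) : FormMatFam S (fun r => nabla (Φ r) (M r)) := fun a b =>
  (((hM.extDMat hS).add (hΦ.mul hM)).add (hM.mul hΦ) a b).congr fun r x hx => by
    have hMo : sgnM (M r x) = -M r x :=
      (show MatDeg (2 * 0 + 1) (M r x) from hM1 r x hx).sgnM_odd
    have h : TwistedK.nabla (Φ r) (M r) x =
        TwistedK.extDMat (M r) x + Φ r x * M r x + M r x * Φ r x := by
      unfold TwistedK.nabla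
      rw [hMo, neg_mul, sub_neg_eq_add]
    exact congrFun (congrFun h a) b

lemma FormMatFam.chThetaDeriv {R : Type*} [TopologicalSpace R]
    {K L β : R → X → Matrix n n (Ext (Eucl d))} (hK : FormMatFam S K) (hL : FormMatFam S L)
    (hβ : FormMatFam S β) : SmoothFam S (fun r x => chThetaDeriv (K r x) (L r x) (β r x)) :=
  SmoothFam.sum _ fun _ _ => (SmoothFam.sum _ fun p _ =>
    (hβ.mul (((hK.pow p.1).mul hL).mul (hK.pow p.2))).trace).smul continuous_const

lemma FormMatFam.chEta {R : Type*} [TopologicalSpace R]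
    {K β γ : R → X → Matrix n n (Ext (Eucl d))} (hK : FormMatFam S K) (hβ : FormMatFam S β)
    (hγ : FormMatFam S γ) : SmoothFam S (fun r x => chEta (K r x) (β r x) (γ r x)) :=
  SmoothFam.sum _ fun _ _ => (SmoothFam.sum _ fun p _ =>
    (((hβ.mul (hK.pow p.1)).mul hγ).mul (hK.pow p.2)).trace).smul continuous_const

/-- The straight triangle spanned by three connections, parametrized by the square. -/
def trianglePath (Γ₀ Γ₁ Γ₂ : X → Matrix n n (Ext (Eucl d))) (q : ℝ × ℝ) :
    X → Matrix n n (Ext (Eucl d)) :=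
  straightPath Γ₀ (straightPath Γ₁ Γ₂ q.1) q.2

/-- The integrand of `csTriangle`. -/
def etaTriangle (B : X → Ext (Eucl d)) (Γ₀ Γ₁ Γ₂ : X → Matrix n n (Ext (Eucl d))) (q : ℝ × ℝ)
    (x : X) : Ext (Eucl d) :=
  chEta (twCurv B (trianglePath Γ₀ Γ₁ Γ₂ q) x) ((q.2 : ℂ) • (Γ₂ x - Γ₁ x))
    (straightPath Γ₁ Γ₂ q.1 x - Γ₀ x)

/-- The integral of the second order transgression form over the triangle spanned by three
connections. -/
def csTriangle (B : X → Ext (Eucl d)) (Γ₀ Γ₁ Γ₂ : X → Matrix n n (Ext (Eucl d))) (x : X) :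
    Ext (Eucl d) :=
  ∫ s in (0 : ℝ)..1, ∫ t in (0 : ℝ)..1, etaTriangle B Γ₀ Γ₁ Γ₂ (s, t) x

lemma FormMatFam.edge (h₀ : FormMatSmooth Γ₀ S) (h₁ : FormMatSmooth Γ₁ S)
    (h₂ : FormMatSmooth Γ₂ S) :
    FormMatFam S (fun (q : ℝ × ℝ) x => TwistedK.straightPath Γ₁ Γ₂ q.1 x - Γ₀ x) :=
  FormMatFam.sub (fun a b => (FormMatFam.straightPath h₁ h₂ a b).comp continuous_fst) (.const h₀)

lemma FormMatFam.trianglePath (h₀ : FormMatSmooth Γ₀ S) (h₁ : FormMatSmooth Γ₁ S)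
    (h₂ : FormMatSmooth Γ₂ S) : FormMatFam S (trianglePath Γ₀ Γ₁ Γ₂) := by
  have h := (FormMatFam.const (P := ℝ × ℝ) h₀).add
    ((FormMatFam.edge h₀ h₁ h₂).smul (φ := fun q : ℝ × ℝ => (q.2 : ℂ)) (by fun_prop))
  refine fun a b => (h a b).congr fun q x _ => ?_
  rw [TwistedK.trianglePath, straightPath_eq]

lemma etaTriangle_smoothFam (hS : IsOpen S) (h₀ : FormMatSmooth Γ₀ S) (h₁ : FormMatSmooth Γ₁ S)
    (h₂ : FormMatSmooth Γ₂ S) (hBs : IsSmoothOn B S) : SmoothFam S (etaTriangle B Γ₀ Γ₁ Γ₂) :=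
  ((FormMatFam.trianglePath h₀ h₁ h₂).twCurv hS hBs).chEta
    ((FormMatFam.const (h₂.sub h₁)).smul (φ := fun q : ℝ × ℝ => (q.2 : ℂ)) (by fun_prop))
    (.edge h₀ h₁ h₂)

lemma csTriangle_isSmoothOn (hS : IsOpen S) (h₀ : FormMatSmooth Γ₀ S) (h₁ : FormMatSmooth Γ₁ S)
    (h₂ : FormMatSmooth Γ₂ S) (hBs : IsSmoothOn B S) : IsSmoothOn (csTriangle B Γ₀ Γ₁ Γ₂) S := by
  have h := SmoothFam.integral (F := fun s t => etaTriangle B Γ₀ Γ₁ Γ₂ (s, t))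
    (etaTriangle_smoothFam hS h₀ h₁ h₂ hBs)
  exact (SmoothFam.integral (F := fun (_ : Unit) s x =>
    ∫ t in (0 : ℝ)..1, etaTriangle B Γ₀ Γ₁ Γ₂ (s, t) x) (h.comp continuous_snd)).isSmoothOn ()

lemma trianglePath_matDeg (h₀ : MatDeg 1 (Γ₀ x)) (h₁ : MatDeg 1 (Γ₁ x)) (h₂ : MatDeg 1 (Γ₂ x))
    (q : ℝ × ℝ) : MatDeg 1 (trianglePath Γ₀ Γ₁ Γ₂ q x) :=
  straightPath_matDeg h₀ (straightPath_matDeg h₁ h₂ _) _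


lemma csTriangle_mem_parity (hS : IsOpen S) (h₀ : FormMatSmooth Γ₀ S) (h₁ : FormMatSmooth Γ₁ S)
    (h₂ : FormMatSmooth Γ₂ S) (hd₀ : ∀ x ∈ S, MatDeg 1 (Γ₀ x)) (hd₁ : ∀ x ∈ S, MatDeg 1 (Γ₁ x))
    (hd₂ : ∀ x ∈ S, MatDeg 1 (Γ₂ x)) (hBs : IsSmoothOn B S) (hB : ∀ x ∈ S, B x ∈ deg (Eucl d) 2)
    (hx : x ∈ S) :
    csTriangle B Γ₀ Γ₁ Γ₂ x ∈ parity (Eucl d) 0 := by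
  have hη := etaTriangle_smoothFam hS h₀ h₁ h₂ hBs
  have hi := SmoothFam.integral (F := fun s t => etaTriangle B Γ₀ Γ₁ Γ₂ (s, t)) hη
  refine integral_mem (hi.continuous hx) fun s => integral_mem
    ((hη.comp (q := fun t : ℝ => (s, t)) (by fun_prop)).continuous hx) fun t => ?_
  exact chEta_mem_parity (twCurv_matDeg hS ((FormMatFam.trianglePath h₀ h₁ h₂).formMatSmooth _)
    (fun y hy => trianglePath_matDeg (hd₀ y hy) (hd₁ y hy) (hd₂ y hy) _) hB hx)
    (((hd₂ x hx).sub (hd₁ x hx)).smul _)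
    ((straightPath_matDeg (hd₁ x hx) (hd₂ x hx) _).sub (hd₀ x hx))

/-- Stokes' theorem on the triangle spanned by three connections. -/
lemma csForm_triangle (hS : IsOpen S) (h₀ : FormMatSmooth Γ₀ S) (h₁ : FormMatSmooth Γ₁ S)
    (h₂ : FormMatSmooth Γ₂ S) (hd₀ : ∀ x ∈ S, MatDeg 1 (Γ₀ x)) (hd₁ : ∀ x ∈ S, MatDeg 1 (Γ₁ x))
    (hd₂ : ∀ x ∈ S, MatDeg 1 (Γ₂ x)) (hBs : IsSmoothOn B S) (hB : ∀ x ∈ S, B x ∈ deg (Eucl d) 2)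
    (hx : x ∈ S) :
    csForm B (straightPath Γ₀ Γ₁) x + csForm B (straightPath Γ₁ Γ₂) x -
        csForm B (straightPath Γ₀ Γ₂) x =
      extD (csTriangle B Γ₀ Γ₁ Γ₂) x + extD B x * csTriangle B Γ₀ Γ₁ Γ₂ x := by
  have hη := etaTriangle_smoothFam hS h₀ h₁ h₂ hBs
  have hi := SmoothFam.integral (F := fun s t => etaTriangle B Γ₀ Γ₁ Γ₂ (s, t)) hη
  have hΦ := FormMatFam.trianglePath h₀ h₁ h₂
  have hK := hΦ.twCurv hS hBs
  have hΦd : ∀ q, ∀ y ∈ S, MatDeg 1 (trianglePath Γ₀ Γ₁ Γ₂ q y) := fun q y hy =>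
    trianglePath_matDeg (hd₀ y hy) (hd₁ y hy) (hd₂ y hy) q
  have hξ := FormMatFam.edge h₀ h₁ h₂
  have hξd : ∀ q : ℝ × ℝ, ∀ y ∈ S, MatDeg 1 (straightPath Γ₁ Γ₂ q.1 y - Γ₀ y) := fun q y hy =>
    (straightPath_matDeg (hd₁ y hy) (hd₂ y hy) _).sub (hd₀ y hy)
  have hδ := (FormMatFam.const (P := ℝ × ℝ) (h₂.sub h₁)).smul
    (φ := fun q : ℝ × ℝ => (q.2 : ℂ)) (by fun_prop)
  have hδd : ∀ q : ℝ × ℝ, ∀ y ∈ S, MatDeg 1 ((q.2 : ℂ) • (Γ₂ y - Γ₁ y)) := fun q y hy =>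
    ((hd₂ y hy).sub (hd₁ y hy)).smul _
  have cη : ∀ s, Continuous fun t => etaTriangle B Γ₀ Γ₁ Γ₂ (s, t) x := fun s =>
    (hη.comp (q := fun t : ℝ => (s, t)) (by fun_prop)).continuous hx
  have cη' : ∀ s, Continuous fun t => extD (etaTriangle B Γ₀ Γ₁ Γ₂ (s, t)) x := fun s =>
    ((hη.extD hS).comp (q := fun t : ℝ => (s, t)) (by fun_prop)).continuous hx
  have mulInt : ∀ (w : Ext (Eucl d)) {f : ℝ → Ext (Eucl d)}, Continuous f →
      w * ∫ t in (0 : ℝ)..1, f t = ∫ t in (0 : ℝ)..1, w * f t := fun w f hf =>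
    ((ContinuousLinearMap.mul ℝ (Ext (Eucl d)) w).intervalIntegral_comp_comm
      (hf.intervalIntegrable 0 1)).symm
  -- Both d and multiplication by dB pass under the two integrals.
  have e1 : extD (csTriangle B Γ₀ Γ₁ Γ₂) x + extD B x * csTriangle B Γ₀ Γ₁ Γ₂ x =
      ∫ s in (0 : ℝ)..1, ∫ t in (0 : ℝ)..1, (extD (etaTriangle B Γ₀ Γ₁ Γ₂ (s, t)) x +
        extD B x * etaTriangle B Γ₀ Γ₁ Γ₂ (s, t) x) := by
    have a1 := SmoothFam.extD_integral (F := fun (_ : Unit) s x =>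
      ∫ t in (0 : ℝ)..1, etaTriangle B Γ₀ Γ₁ Γ₂ (s, t) x) hS (hi.comp continuous_snd) () hx
    have a2 : ∀ s, extD (fun y => ∫ t in (0 : ℝ)..1, etaTriangle B Γ₀ Γ₁ Γ₂ (s, t) y) x =
        ∫ t in (0 : ℝ)..1, extD (etaTriangle B Γ₀ Γ₁ Γ₂ (s, t)) x := fun s =>
      SmoothFam.extD_integral (F := fun s t => etaTriangle B Γ₀ Γ₁ Γ₂ (s, t)) hS hη s hx
    have c1 := (hi.extD hS).continuous hx
    rw [csTriangle, mulInt _ (hi.continuous hx)]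
    refine (congrArg (· + _) a1).trans ?_
    rw [← intervalIntegral.integral_add (c1.intervalIntegrable 0 1)
      (((hi.continuous hx).const_mul _).intervalIntegrable 0 1)]
    refine intervalIntegral.integral_congr fun s _ => ?_
    change extD (fun y => ∫ t in (0 : ℝ)..1, etaTriangle B Γ₀ Γ₁ Γ₂ (s, t) y) x + _ = _
    rw [a2, mulInt _ (cη s), ← intervalIntegral.integral_add ((cη' s).intervalIntegrable 0 1)
      (((cη s).const_mul _).intervalIntegrable 0 1)]
  -- With f = θ(∂Γ/∂t) and g = θ(∂Γ/∂s), the two bracketed expressions are ∂f/∂s and ∂g/∂t. The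
  -- mixed derivative Γ₂ - Γ₁ of the connection contributes the same term to each and cancels.
  have e2 : ∀ s t : ℝ, extD (etaTriangle B Γ₀ Γ₁ Γ₂ (s, t)) x +
      extD B x * etaTriangle B Γ₀ Γ₁ Γ₂ (s, t) x =
      (chTheta (twCurv B (trianglePath Γ₀ Γ₁ Γ₂ (s, t)) x) (Γ₂ x - Γ₁ x) +
        chThetaDeriv (twCurv B (trianglePath Γ₀ Γ₁ Γ₂ (s, t)) x)
        (nabla (trianglePath Γ₀ Γ₁ Γ₂ (s, t)) (fun y => (t : ℂ) • (Γ₂ y - Γ₁ y)) x)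
        (straightPath Γ₁ Γ₂ s x - Γ₀ x)) -
      (chTheta (twCurv B (trianglePath Γ₀ Γ₁ Γ₂ (s, t)) x) (Γ₂ x - Γ₁ x) +
        chThetaDeriv (twCurv B (trianglePath Γ₀ Γ₁ Γ₂ (s, t)) x)
        (nabla (trianglePath Γ₀ Γ₁ Γ₂ (s, t)) (fun y => straightPath Γ₁ Γ₂ s y - Γ₀ y) x)
        ((t : ℂ) • (Γ₂ x - Γ₁ x))) := fun s t => by
    rw [add_sub_add_left_eq_sub]
    exact extD_chEta hS (hΦ.formMatSmooth (s, t)) (hΦd (s, t)) hBs hB (hδ.formMatSmooth (s, t))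
      (hδd (s, t)) (hξ.formMatSmooth (s, t)) (hξd (s, t)) hx
  have cθ : SmoothFam S fun (q : ℝ × ℝ) x =>
      chTheta (twCurv B (trianglePath Γ₀ Γ₁ Γ₂ q) x) (Γ₂ x - Γ₁ x) :=
    hK.chTheta (.const (h₂.sub h₁))
  have ds : ∀ s t : ℝ, HasDerivAt (fun s => chTheta (twCurv B (trianglePath Γ₀ Γ₁ Γ₂ (s, t)) x)
      (straightPath Γ₁ Γ₂ s x - Γ₀ x))
      (chTheta (twCurv B (trianglePath Γ₀ Γ₁ Γ₂ (s, t)) x) (Γ₂ x - Γ₁ x) +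
        chThetaDeriv (twCurv B (trianglePath Γ₀ Γ₁ Γ₂ (s, t)) x)
        (nabla (trianglePath Γ₀ Γ₁ Γ₂ (s, t)) (fun y => (t : ℂ) • (Γ₂ y - Γ₁ y)) x)
        (straightPath Γ₁ Γ₂ s x - Γ₀ x)) s := fun s t =>
    hasDerivAt_chTheta (L := nabla (trianglePath Γ₀ Γ₁ Γ₂ (s, t))
      (fun y => (t : ℂ) • (Γ₂ y - Γ₁ y)) x) (β' := Γ₂ x - Γ₁ x)
      (by
        have e : ∀ s : ℝ, trianglePath Γ₀ Γ₁ Γ₂ (s, t) = fun y =>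
            straightPath Γ₀ Γ₁ t y + (s : ℂ) • ((t : ℂ) • (Γ₂ y - Γ₁ y)) := fun s => by
          funext y
          simp only [trianglePath, straightPath]
          module
        simp only [e]
        exact twCurv_hasDeriv hS ((FormMatFam.straightPath h₀ h₁).formMatSmooth t)
          (hδ.formMatSmooth (s, t)) (hδd (s, t)) hx s)
      (by
        have e : ∀ s : ℝ, straightPath Γ₁ Γ₂ s x - Γ₀ x =
            (Γ₁ x - Γ₀ x) + (s : ℂ) • (Γ₂ x - Γ₁ x) := fun s => by
          simp only [straightPath]
          module
        simp only [e]
        have := (MatHasDeriv.const (t := s) (Γ₁ x - Γ₀ x)).add (.ofReal_smul (Γ₂ x - Γ₁ x))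
        rwa [zero_add] at this)
  have dt : ∀ s t : ℝ, HasDerivAt (fun t : ℝ => chTheta (twCurv B (trianglePath Γ₀ Γ₁ Γ₂ (s, t)) x)
      ((t : ℂ) • (Γ₂ x - Γ₁ x)))
      (chTheta (twCurv B (trianglePath Γ₀ Γ₁ Γ₂ (s, t)) x) (Γ₂ x - Γ₁ x) +
        chThetaDeriv (twCurv B (trianglePath Γ₀ Γ₁ Γ₂ (s, t)) x)
        (nabla (trianglePath Γ₀ Γ₁ Γ₂ (s, t)) (fun y => straightPath Γ₁ Γ₂ s y - Γ₀ y) x)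
        ((t : ℂ) • (Γ₂ x - Γ₁ x))) t := fun s t =>
    hasDerivAt_chTheta (L := nabla (trianglePath Γ₀ Γ₁ Γ₂ (s, t))
      (fun y => straightPath Γ₁ Γ₂ s y - Γ₀ y) x) (β' := Γ₂ x - Γ₁ x)
      (by
        simp only [trianglePath, straightPath_eq (Γ₀ := Γ₀)]
        exact twCurv_hasDeriv hS h₀ (hξ.formMatSmooth (s, t)) (hξd (s, t)) hx t)
      (.ofReal_smul _)
  have cs := (cθ.add (hK.chThetaDeriv (hΦ.nabla hS hδ hδd) hξ)).continuous hx
  have ct := (cθ.add (hK.chThetaDeriv (hΦ.nabla hS hξ hξd) hδ)).continuous hx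
  have key := integral_square ds dt cs ct
  rw [e1]
  simp only [e2]
  refine Eq.trans ?_ key.symm
  -- The sides s = 1, s = 0 and t = 1 of the square are the three edges. The side t = 0 is collapsed
  -- to Γ₀, where ∂Γ/∂s = 0, and contributes nothing.
  have f1 : ∀ t : ℝ, trianglePath Γ₀ Γ₁ Γ₂ (1, t) = straightPath Γ₀ Γ₂ t := fun t => by
    funext y; simp [trianglePath, straightPath]
  have f0 : ∀ t : ℝ, trianglePath Γ₀ Γ₁ Γ₂ (0, t) = straightPath Γ₀ Γ₁ t := fun t => by
    funext y; simp [trianglePath, straightPath]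
  have g1 : ∀ s : ℝ, trianglePath Γ₀ Γ₁ Γ₂ (s, 1) = straightPath Γ₁ Γ₂ s := fun s => by
    funext y; simp [trianglePath, straightPath]
  have s1 : straightPath Γ₁ Γ₂ 1 x = Γ₂ x := by simp [straightPath]
  have s0 : straightPath Γ₁ Γ₂ 0 x = Γ₁ x := by simp [straightPath]
  have z : ∀ K : Matrix n n (Ext (Eucl d)), chTheta K 0 = 0 := fun K => by simp [chTheta]
  simp only [f1, f0, g1, s1, s0, Complex.ofReal_zero, Complex.ofReal_one, zero_smul, one_smul, z,
    sub_zero]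
  have i2 := (((FormMatFam.straightPath h₀ h₂).twCurv hS hBs).chTheta
    (.const (h₂.sub h₀))).continuous hx
  have i1 := (((FormMatFam.straightPath h₀ h₁).twCurv hS hBs).chTheta
    (.const (h₁.sub h₀))).continuous hx
  rw [intervalIntegral.integral_sub (i2.intervalIntegrable 0 1) (i1.intervalIntegrable 0 1),
    csForm_eq hS h₀ h₁ hd₀ hd₁ hBs hB hx, csForm_eq hS h₁ h₂ hd₁ hd₂ hBs hB hx,
    csForm_eq hS h₀ h₂ hd₀ hd₂ hBs hB hx]
  abel

end Triangle

/-! ### Gauge invariance of the triangle form. -/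

section GaugeTriangle

variable {d : ℕ} {m n : Type*} [Fintype m] [Fintype n] [DecidableEq m] [DecidableEq n]
  {X : Type*} [TopologicalSpace X] [ChartedSpace (Eucl d) X] [IsManifold (𝓡 d) ∞ X]
  {S : Set X} {x : X} {h : X → Matrix m n ℂ} {Γ₀ Γ₁ Γ₂ : X → Matrix m m (Ext (Eucl d))}

/-- Gauge invariance of `csTriangle`. -/
lemma csTriangle_gauge {B B' A : X → Ext (Eucl d)} {Γ₀' Γ₁' Γ₂' : X → Matrix n n (Ext (Eucl d))}
    (hS : IsOpen S) (hh : MatSmoothOn d h S) (hl : ∀ x ∈ S, (h x)ᴴ * h x = 1)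
    (hr : ∀ x ∈ S, h x * (h x)ᴴ = 1) (h₀ : FormMatSmooth Γ₀ S) (h₁ : FormMatSmooth Γ₁ S)
    (h₂ : FormMatSmooth Γ₂ S) (hd₀ : ∀ x ∈ S, MatDeg 1 (Γ₀ x)) (hd₁ : ∀ x ∈ S, MatDeg 1 (Γ₁ x))
    (hd₂ : ∀ x ∈ S, MatDeg 1 (Γ₂ x)) (hAs : IsSmoothOn A S) (hA : ∀ x ∈ S, A x ∈ deg (Eucl d) 1)
    (hB : ∀ x ∈ S, B x ∈ deg (Eucl d) 2) (hBB : ∀ x ∈ S, B x - B' x = extD A x)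
    (h₀' : ∀ x ∈ S, Γ₀' x = gauge h Γ₀ x - Matrix.diagonal fun _ => A x)
    (h₁' : ∀ x ∈ S, Γ₁' x = gauge h Γ₁ x - Matrix.diagonal fun _ => A x)
    (h₂' : ∀ x ∈ S, Γ₂' x = gauge h Γ₂ x - Matrix.diagonal fun _ => A x) (hx : x ∈ S) :
    csTriangle B' Γ₀' Γ₁' Γ₂' x = csTriangle B Γ₀ Γ₁ Γ₂ x := by
  have hab : toForm d (h x)ᴴ * toForm d (h x) = 1 := by rw [← toForm_mul, hl x hx, toForm_one]
  have hba : toForm d (h x) * toForm d (h x)ᴴ = 1 := by rw [← toForm_mul, hr x hx, toForm_one]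
  refine intervalIntegral.integral_congr fun s _ => intervalIntegral.integral_congr fun t _ => ?_
  -- Since gauge transformation is affine, the triangle of transformed connections is the transform
  -- of the triangle. Its curvature and both tangent directions are conjugated, and the trace is
  -- invariant.
  have hsp : ∀ y ∈ S, straightPath Γ₁' Γ₂' s y =
      gauge h (straightPath Γ₁ Γ₂ s) y - Matrix.diagonal fun _ => A y := fun y hy => by
    rw [gauge_straightPath, straightPath, straightPath, h₁' y hy, h₂' y hy]
  have hΦ : ∀ y ∈ S, trianglePath Γ₀' Γ₁' Γ₂' (s, t) y =
      gauge h (trianglePath Γ₀ Γ₁ Γ₂ (s, t)) y - Matrix.diagonal fun _ => A y := fun y hy => by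
    rw [trianglePath, trianglePath, gauge_straightPath, straightPath, hsp y hy, h₀' y hy]
    rfl
  have hβ : (t : ℂ) • (Γ₂' x - Γ₁' x) =
      toForm d (h x)ᴴ * ((t : ℂ) • (Γ₂ x - Γ₁ x)) * toForm d (h x) := by
    rw [h₂' x hx, h₁' x hx, gauge, gauge, Matrix.mul_smul, Matrix.smul_mul]
    simp only [Matrix.mul_sub, Matrix.sub_mul]
    congr 1
    abel
  have hγ : straightPath Γ₁' Γ₂' s x - Γ₀' x =
      toForm d (h x)ᴴ * (straightPath Γ₁ Γ₂ s x - Γ₀ x) * toForm d (h x) := by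
    rw [hsp x hx, h₀' x hx, gauge, gauge]
    simp only [Matrix.mul_sub, Matrix.sub_mul]
    abel
  rw [etaTriangle, etaTriangle, hβ, hγ, twCurv_gauge hS hh hl hr
    ((FormMatFam.trianglePath h₀ h₁ h₂).formMatSmooth (s, t))
    (fun y hy => trianglePath_matDeg (hd₀ y hy) (hd₁ y hy) (hd₂ y hy) _) hAs hA hB hBB hΦ hx,
    chEta_conj hab hba (.toForm _)]

end GaugeTriangle

/-! ### Gluing of the local Chern–Simons forms. -/

section Global

variable {d : ℕ} {X : Type*} [TopologicalSpace X] [ChartedSpace (Eucl d) X] {ι : Type*}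
  {C : OpenCover ι X} {T : GerbeConn d C}

lemma IsImagOneForm.mem_deg {V : Type} [AddCommGroup V] [Module ℝ V] {a : Ext V}
    (h : IsImagOneForm a) : a ∈ deg V 1 := by
  obtain ⟨α, -, rfl⟩ := h
  exact oneForm_mem α

lemma IsImagTwoForm.mem_deg {V : Type} [AddCommGroup V] [Module ℝ V] {b : Ext V}
    (h : IsImagTwoForm b) : b ∈ deg V 2 := by
  have : Submodule.span ℝ {c : Ext V | ∃ α β : V →ₗ[ℝ] ℂ, (∀ v, (α v).im = 0) ∧
      (∀ v, (β v).im = 0) ∧ c = Complex.I • (oneForm α * oneForm β)} ≤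
      (deg V 2).restrictScalars ℝ := by
    rw [Submodule.span_le]
    rintro c ⟨α, β, -, -, rfl⟩
    exact Submodule.smul_mem _ _ (mul_deg (oneForm_mem α) (oneForm_mem β))
  exact this h

/-- Smooth forms on the sets of an open cover that agree on the overlaps are the restrictions of
a global form. -/
lemma exists_forms_of_local {s : ZMod 2} {w : ι → X → Ext (Eucl d)}
    (hw : ∀ i, IsSmoothOn (w i) (C.U i)) (hs : ∀ i, ∀ x ∈ C.U i, w i x ∈ parity (Eucl d) s)
    (h : ∀ j i, ∀ x ∈ C.U j ∩ C.U i, w i x = w j x) :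
    ∃ u ∈ Forms d X s, ∀ i, ∀ x ∈ C.U i, u x = w i x := by
  have hu : ∀ i, ∀ x ∈ C.U i, w (C.exists_mem x).choose x = w i x := fun i x hx =>
    h i _ x ⟨hx, (C.exists_mem x).choose_spec⟩
  refine ⟨fun x => w (C.exists_mem x).choose x,
    ⟨fun x => hs _ x (C.exists_mem x).choose_spec, isSmoothOn_of_locally fun x _ => ?_⟩, hu⟩
  obtain ⟨i, hi⟩ := C.exists_mem x
  exact ⟨C.U i, C.isOpen i, hi, (hw i).congr (hu i)⟩

/-- Local forms of a connection on `E` compatible with the connection of the gerbe, not required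
to take values in the skew-Hermitian matrices. -/
structure IsConnection (E : TwistedBundle T.toGerbe)
    (Γ : ι → X → Matrix (Fin E.rank) (Fin E.rank) (Ext (Eucl d))) : Prop where
  matDeg : ∀ i, ∀ x ∈ C.U i, MatDeg 1 (Γ i x)
  smooth : ∀ i, FormMatSmooth (Γ i) (C.U i)
  compat : ∀ j i, ∀ x ∈ C.U j ∩ C.U i,
    Γ i x = gauge (E.g j i) (Γ j) x - Matrix.diagonal fun _ => T.A j i x

lemma Connection.isConnection {E : TwistedBundle T.toGerbe} (Γ : Connection E) :
    IsConnection E Γ.Γ where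
  matDeg i x hx := by
    obtain ⟨α, -, h⟩ := Γ.skew i x hx
    intro a b
    rw [h]
    exact oneForm_mem _
  smooth := Γ.smooth
  compat j i x hx := by
    have h := Γ.compat j i x hx
    rw [sub_sub, sub_eq_iff_eq_add] at h
    rw [h, gauge]
    abel

lemma TwistedBundle.conjTranspose_mul_self {L : Gerbe d C} (E : TwistedBundle L) {j i : ι} {x : X}
    (hx : x ∈ C.U j ∩ C.U i) : (E.g j i x)ᴴ * E.g j i x = 1 :=
  Matrix.mem_unitaryGroup_iff'.1 (E.unitary j i x hx)

lemma TwistedBundle.mul_conjTranspose_self {L : Gerbe d C} (E : TwistedBundle L) {j i : ι} {x : X}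
    (hx : x ∈ C.U j ∩ C.U i) : E.g j i x * (E.g j i x)ᴴ = 1 :=
  Matrix.mem_unitaryGroup_iff.1 (E.unitary j i x hx)

variable (C) in
lemma OpenCover.isOpen_inter (j i : ι) : IsOpen (C.U j ∩ C.U i) := (C.isOpen j).inter (C.isOpen i)

variable [IsManifold (𝓡 d) ∞ X] {E F : TwistedBundle T.toGerbe}

lemma MatSmoothOn.mono {m n : Type*} {f : X → Matrix m n ℂ} {S S' : Set X}
    (hf : MatSmoothOn d f S) (h : S' ⊆ S) : MatSmoothOn d f S' := fun a b => (hf a b).mono h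

lemma FormMatSmooth.mono {m n : Type*} {M : X → Matrix m n (Ext (Eucl d))} {S S' : Set X}
    (hM : FormMatSmooth M S) (h : S' ⊆ S) : FormMatSmooth M S' := fun a b => (hM a b).mono h

/-- Both sides of the compatibility are transforms of Γ_j by composites, h_ji φ_i and φ_j g_ji,
which agree because φ is an isomorphism. The scalar shift by A commutes with conjugation. -/
lemma IsConnection.pull {Γ : ι → X → Matrix (Fin F.rank) (Fin F.rank) (Ext (Eucl d))}
    (hΓ : IsConnection F Γ) (φ : Iso E F) : IsConnection E fun i => gauge (φ.f i) (Γ i) where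
  matDeg i x hx := gauge_matDeg (C.isOpen i) (φ.smooth i) (hΓ.matDeg i x hx) hx
  smooth i := gauge_formMatSmooth (C.isOpen i) (φ.smooth i) (hΓ.smooth i)
  compat j i x hx := by
    have hS := C.isOpen_inter j i
    have hi := (φ.smooth i).mono (Set.inter_subset_right (s := C.U j))
    have hj := (φ.smooth j).mono (Set.inter_subset_left (t := C.U i))
    rw [gauge_congr (Γ' := fun y => gauge (F.g j i) (Γ j) y - Matrix.diagonal fun _ => T.A j i y)
      (C.isOpen i) (fun _ _ => rfl) (hΓ.compat j i x hx) hx.2,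
      gauge_sub_diagonal (φ.unitary_left i x hx.2),
      gauge_gauge hS (F.smooth j i) hi (F.conjTranspose_mul_self hx) hx,
      gauge_gauge hS hj (E.smooth j i) (φ.unitary_left j x hx.1) hx,
      gauge_congr hS (fun y hy => (φ.comm j i y hy).symm) rfl hx]

variable {Γ₀ Γ₁ Γ₂ : ι → X → Matrix (Fin E.rank) (Fin E.rank) (Ext (Eucl d))}

/-- On overlaps the local data differ by the gauge transformation g_ji and the shift by A_ji, under
which cs is invariant; the local forms therefore glue. -/
lemma exists_isCS (h₀ : IsConnection E Γ₀) (h₁ : IsConnection E Γ₁) :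
    ∃ w : OddForms d X, IsCS T Γ₀ Γ₁ w := by
  have hB : ∀ i, ∀ x ∈ C.U i, T.B i x ∈ deg (Eucl d) 2 := fun i x hx => (T.B_imag i x hx).mem_deg
  obtain ⟨u, hu, h⟩ := exists_forms_of_local (C := C) (s := 1)
    (w := fun i => csForm (T.B i) (straightPath (Γ₀ i) (Γ₁ i)))
    (fun i => csForm_isSmoothOn (C.isOpen i) (h₀.smooth i) (h₁.smooth i) (h₀.matDeg i)
      (h₁.matDeg i) (T.B_smooth i) (hB i))
    (fun i x hx => csForm_mem_parity (C.isOpen i) (h₀.smooth i) (h₁.smooth i) (h₀.matDeg i)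
      (h₁.matDeg i) (T.B_smooth i) (hB i) hx)
    (fun j i x hx => by
      have sj : C.U j ∩ C.U i ⊆ C.U j := Set.inter_subset_left
      have si : C.U j ∩ C.U i ⊆ C.U i := Set.inter_subset_right
      exact csForm_gauge (C.isOpen_inter j i) (E.smooth j i)
        (fun y hy => E.conjTranspose_mul_self hy) (fun y hy => E.mul_conjTranspose_self hy)
        ((h₀.smooth j).mono sj) ((h₁.smooth j).mono sj) (fun y hy => h₀.matDeg j y hy.1)
        (fun y hy => h₁.matDeg j y hy.1) (T.A_smooth j i)
        (fun y hy => (T.A_imag j i y hy).mem_deg) ((T.B_smooth j).mono sj)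
        (fun y hy => hB j y hy.1) ((T.B_smooth i).mono si) (fun y hy => hB i y hy.2)
        (T.B_sub_B j i) (h₀.compat j i) (h₁.compat j i) hx)
  exact ⟨⟨u, hu⟩, h⟩

/-- The primitives `csTriangle` are gauge invariant as well, so they glue to one even form on X
whose image under d + H is the defect in each chart of the cover. -/
lemma IsCS.triangle (h₀ : IsConnection E Γ₀) (h₁ : IsConnection E Γ₁) (h₂ : IsConnection E Γ₂)
    {w₀₁ w₁₂ w₀₂ : OddForms d X} (h₀₁ : IsCS T Γ₀ Γ₁ w₀₁) (h₁₂ : IsCS T Γ₁ Γ₂ w₁₂)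
    (h₀₂ : IsCS T Γ₀ Γ₂ w₀₂) : w₀₁ + w₁₂ - w₀₂ ∈ exactForms T := by
  have hB : ∀ i, ∀ x ∈ C.U i, T.B i x ∈ deg (Eucl d) 2 := fun i x hx => (T.B_imag i x hx).mem_deg
  obtain ⟨u, hu, h⟩ := exists_forms_of_local (C := C) (s := 0)
    (w := fun i => csTriangle (T.B i) (Γ₀ i) (Γ₁ i) (Γ₂ i))
    (fun i => csTriangle_isSmoothOn (C.isOpen i) (h₀.smooth i) (h₁.smooth i) (h₂.smooth i)
      (T.B_smooth i))
    (fun i x hx => csTriangle_mem_parity (C.isOpen i) (h₀.smooth i) (h₁.smooth i) (h₂.smooth i)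
      (h₀.matDeg i) (h₁.matDeg i) (h₂.matDeg i) (T.B_smooth i) (hB i) hx)
    (fun j i x hx => by
      have sj : C.U j ∩ C.U i ⊆ C.U j := Set.inter_subset_left
      exact csTriangle_gauge (C.isOpen_inter j i) (E.smooth j i)
        (fun y hy => E.conjTranspose_mul_self hy) (fun y hy => E.mul_conjTranspose_self hy)
        ((h₀.smooth j).mono sj) ((h₁.smooth j).mono sj) ((h₂.smooth j).mono sj)
        (fun y hy => h₀.matDeg j y hy.1) (fun y hy => h₁.matDeg j y hy.1)
        (fun y hy => h₂.matDeg j y hy.1) (T.A_smooth j i)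
        (fun y hy => (T.A_imag j i y hy).mem_deg) (fun y hy => hB j y hy.1)
        (T.B_sub_B j i) (h₀.compat j i) (h₁.compat j i) (h₂.compat j i) hx)
  refine ⟨u, hu, fun x => ?_⟩
  have hi := (C.exists_mem x).choose_spec
  set i := (C.exists_mem x).choose with hi'
  -- The index i is the one chosen at x in the definition of H.
  have e : T.H x = extD (T.B i) x := rfl
  rw [e, h i x hi, extD_congr (C.isOpen i) (h i) hi,
    ← csForm_triangle (C.isOpen i) (h₀.smooth i) (h₁.smooth i) (h₂.smooth i)
      (h₀.matDeg i) (h₁.matDeg i) (h₂.matDeg i) (T.B_smooth i) (hB i) hi,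
    ← h₀₁ i x hi, ← h₁₂ i x hi, ← h₀₂ i x hi]
  rfl

lemma IsCS.self : IsCS T Γ₀ Γ₀ 0 := fun i x _ => by
  rw [straightPath_self, csForm_const]; rfl

lemma IsCS.pull {Γ₀ Γ₁ : ι → X → Matrix (Fin F.rank) (Fin F.rank) (Ext (Eucl d))}
    {Γ₀' Γ₁' : ι → X → Matrix (Fin E.rank) (Fin E.rank) (Ext (Eucl d))}
    (h₀ : IsConnection F Γ₀) (h₁ : IsConnection F Γ₁) (φ : Iso E F) {w : OddForms d X}
    (h : IsCS T Γ₀ Γ₁ w) (h₀' : ∀ i, ∀ x ∈ C.U i, Γ₀' i x = gauge (φ.f i) (Γ₀ i) x)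
    (h₁' : ∀ i, ∀ x ∈ C.U i, Γ₁' i x = gauge (φ.f i) (Γ₁ i) x) : IsCS T Γ₀' Γ₁' w :=
  fun i x hx => by
  have hB : ∀ i, ∀ x ∈ C.U i, T.B i x ∈ deg (Eucl d) 2 := fun i x hx => (T.B_imag i x hx).mem_deg
  rw [h i x hx]
  -- Over a single U_i an isomorphism is a gauge transformation with A = 0 and unchanged B.
  exact (csForm_gauge (A := fun _ => 0) (C.isOpen i) (φ.smooth i) (φ.unitary_left i)
    (φ.unitary_right i) (h₀.smooth i) (h₁.smooth i) (h₀.matDeg i) (h₁.matDeg i) (.zero _)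
    (fun _ _ => zero_mem _) (T.B_smooth i) (hB i) (T.B_smooth i) (hB i)
    (fun y _ => by rw [sub_self, extD_zero]) (fun y hy => by simp [h₀' i y hy])
    (fun y hy => by simp [h₁' i y hy]) hx).symm

end Global

/-! ### Skew-Hermitian matrices of one-forms. -/

section Skew

variable {V : Type} [AddCommGroup V] [Module ℝ V] {n : ℕ}
  {M N : Matrix (Fin n) (Fin n) (Ext V)}

lemma IsSkewOneForm.zero : IsSkewOneForm (0 : Matrix (Fin n) (Fin n) (Ext V)) :=
  ⟨0, fun v a b => by simp, by ext a b; simp⟩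

lemma IsSkewOneForm.add (hM : IsSkewOneForm M) (hN : IsSkewOneForm N) : IsSkewOneForm (M + N) := by
  obtain ⟨α, hα, rfl⟩ := hM
  obtain ⟨β, hβ, rfl⟩ := hN
  refine ⟨α + β, fun v a b => ?_, by ext a b; simp⟩
  simp only [Matrix.add_apply, LinearMap.add_apply, hα v a b, hβ v a b, map_add, neg_add]

lemma IsSkewOneForm.ofReal_smul (r : ℝ) (hM : IsSkewOneForm M) : IsSkewOneForm ((r : ℂ) • M) := by
  obtain ⟨α, hα, rfl⟩ := hM
  refine ⟨fun a b => (r : ℂ) • α a b, fun v a b => ?_, ?_⟩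
  · simp only [LinearMap.smul_apply, hα v a b, smul_eq_mul, map_mul, Complex.conj_ofReal, mul_neg]
  · ext a b
    exact (map_smul (ExteriorAlgebra.ι ℂ) (r : ℂ) (α a b)).symm

lemma IsSkewOneForm.sum {κ : Type*} (s : Finset κ) {M : κ → Matrix (Fin n) (Fin n) (Ext V)}
    (hM : ∀ k ∈ s, IsSkewOneForm (M k)) : IsSkewOneForm (∑ k ∈ s, M k) :=
  Finset.sum_induction _ _ (fun _ _ => .add) .zero hM

lemma IsImagOneForm.isSkewOneForm_neg_diagonal {a : Ext V} (ha : IsImagOneForm a) :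
    IsSkewOneForm (-Matrix.diagonal fun _ : Fin n => a) := by
  obtain ⟨α, hα, rfl⟩ := ha
  have hc : ∀ v, (starRingEnd ℂ) (α v) = -α v := fun v => by
    apply Complex.ext <;> simp [hα v]
  refine ⟨-Matrix.diagonal fun _ => α, fun v a b => ?_, ?_⟩
  · rcases eq_or_ne a b with rfl | h
    · simp [hc]
    · simp [Matrix.diagonal_apply_ne _ h, Matrix.diagonal_apply_ne _ h.symm]
  · ext a b
    rcases eq_or_ne a b with rfl | h
    · simp
    · simp [Matrix.diagonal_apply_ne _ h]

end Skew

/-! ### Maurer–Cartan forms and partitions of unity. -/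

section Flat

variable {d : ℕ} {X : Type*} [TopologicalSpace X] [ChartedSpace (Eucl d) X]
  [IsManifold (𝓡 d) ∞ X] {S U : Set X} {x : X}

lemma differentiableAt_comp_chart_symm {f : X → ℂ} (hS : IsOpen S)
    (hf : ContMDiffOn (𝓡 d) 𝓘(ℝ, ℂ) ∞ f S) (hx : x ∈ S) :
    DifferentiableAt ℝ (fun y => f ((extChartAt (𝓡 d) x).symm y)) (extChartAt (𝓡 d) x x) := by
  have h : ContDiffOn ℝ ∞ (fun y => f ((extChartAt (𝓡 d) x).symm y)) (chartDom x S) := by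
    rw [← contMDiffOn_iff_contDiffOn]
    exact hf.comp ((contMDiffOn_extChartAt_symm x).mono Set.inter_subset_left) fun y hy => hy.2
  exact (h.contDiffAt ((isOpen_chartDom x hS).mem_nhds (mem_chartDom_self hx))).differentiableAt
    (by simp)

lemma extD_algebraMap {f : X → ℂ} (hS : IsOpen S) (hf : ContMDiffOn (𝓡 d) 𝓘(ℝ, ℂ) ∞ f S)
    (hx : x ∈ S) : extD (fun y => algebraMap ℂ (Ext (Eucl d)) (f y)) x =
      oneForm (fderiv ℝ (fun y => f ((extChartAt (𝓡 d) x).symm y))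
        (extChartAt (𝓡 d) x x)).toLinearMap := by
  unfold extD
  rw [localRep_algebraMap]
  exact flatD_algebraMap (differentiableAt_comp_chart_symm hS hf hx)

/-- The Maurer–Cartan form `h⁻¹ dh` of a unitary matrix of functions is skew-Hermitian. -/
lemma isSkewOneForm_maurerCartan {m : Type*} [Fintype m] [DecidableEq m] {n : ℕ}
    {h : X → Matrix m (Fin n) ℂ} (hS : IsOpen S) (hh : MatSmoothOn d h S)
    (hl : ∀ x ∈ S, (h x)ᴴ * h x = 1) (hx : x ∈ S) :
    IsSkewOneForm (toForm d (h x)ᴴ * extDMat (fun y => toForm d (h y)) x) := by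
  set y₀ := extChartAt (𝓡 d) x x with hy₀
  set G : m → Fin n → Eucl d → ℂ := fun a b y => h ((extChartAt (𝓡 d) x).symm y) a b with hG
  have hGx : ∀ a b, G a b y₀ = h x a b := fun a b => by
    simp only [hG, hy₀, extChartAt_to_inv]
  set D : m → Fin n → Eucl d →L[ℝ] ℂ := fun a b => fderiv ℝ (G a b) y₀ with hD
  have hGd : ∀ a b, HasFDerivAt (G a b) (D a b) y₀ := fun a b =>
    (differentiableAt_comp_chart_symm hS (hh a b) hx).hasFDerivAt
  -- These are the entries of the derivative of hᴴ h = 1 at x, in the chart at x; they say that hᴴ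
  -- dh is skew-Hermitian.
  have hzero : ∀ a b v, ∑ c, ((starRingEnd ℂ) (h x c a) * D c b v +
      h x c b * (starRingEnd ℂ) (D c a v)) = 0 := fun a b v => by
    have h1 : HasFDerivAt (fun y => ∑ c, (starRingEnd ℂ) (G c a y) * G c b y)
        (∑ c, ((starRingEnd ℂ) (G c a y₀) • D c b +
          G c b y₀ • (Complex.conjCLE.toContinuousLinearMap.comp (D c a)))) y₀ :=
      HasFDerivAt.fun_sum fun c _ =>
        (Complex.conjCLE.hasFDerivAt.comp y₀ (hGd c a)).mul (hGd c b)
    have h2 : (fun y => ∑ c, (starRingEnd ℂ) (G c a y) * G c b y) =ᶠ[nhds y₀]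
        fun _ => (1 : Matrix (Fin n) (Fin n) ℂ) a b :=
      Filter.eventuallyEq_of_mem ((isOpen_chartDom x hS).mem_nhds (mem_chartDom_self hx))
        fun y hy => by
          rw [← hl _ hy.2, Matrix.mul_apply]
          rfl
    have h3 := congrArg (fun L : Eucl d →L[ℝ] ℂ => L v)
      (h1.unique ((hasFDerivAt_const _ y₀).congr_of_eventuallyEq h2))
    simpa [hGx] using h3
  refine ⟨fun a b => ∑ c, (starRingEnd ℂ) (h x c a) • (D c b).toLinearMap, fun v a b => ?_, ?_⟩
  · have h0 := hzero b a v
    rw [Finset.sum_add_distrib] at h0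
    simpa [LinearMap.sum_apply, map_sum, map_mul] using eq_neg_of_add_eq_zero_left h0
  · ext a b
    rw [Matrix.mul_apply]
    change _ = ExteriorAlgebra.ι ℂ (∑ c, (starRingEnd ℂ) (h x c a) • (D c b).toLinearMap)
    rw [map_sum]
    refine Finset.sum_congr rfl fun c _ => ?_
    rw [map_smul, Algebra.smul_def]
    exact congrArg _ (extD_algebraMap hS (hh c b) hx)

/-- The form is smooth only on part of S. The product extends by zero since its factor vanishes on
the complement of its support. -/
lemma IsSmoothOn.smul_of_tsupport {ρ : X → ℝ} {w : X → Ext (Eucl d)}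
    (hρ : ContMDiff (𝓡 d) 𝓘(ℝ, ℝ) ∞ ρ) (hU : IsOpen U) (hS : IsOpen S) (hρU : tsupport ρ ⊆ U)
    (hw : IsSmoothOn w (U ∩ S)) : IsSmoothOn (fun x => (ρ x : ℂ) • w x) S := by
  refine isSmoothOn_of_locally fun x hx => ?_
  by_cases hxU : x ∈ U
  · refine ⟨U ∩ S, hU.inter hS, ⟨hxU, hx⟩, ?_⟩
    have h : ContMDiffOn (𝓡 d) 𝓘(ℝ, ℂ) ∞ (fun x => (ρ x : ℂ)) (U ∩ S) :=
      (Complex.ofRealCLM.contDiff.contMDiff.comp hρ).contMDiffOn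
    exact ((IsSmoothOn.of_contMDiffOn h).mul hw).congr fun y _ => Algebra.smul_def _ _
  · refine ⟨(tsupport ρ)ᶜ, (isClosed_tsupport ρ).isOpen_compl, fun h => hxU (hρU h), ?_⟩
    refine (IsSmoothOn.zero _).congr fun y hy => ?_
    rw [image_eq_zero_of_notMem_tsupport hy, Complex.ofReal_zero, zero_smul]

/-- A finite smooth partition of unity subordinate to an open cover of a compact manifold. -/
lemma OpenCover.exists_partition [T2Space X] [CompactSpace X] {ι : Type*} (C : OpenCover ι X) :
    ∃ (s : Finset ι) (ρ : ι → X → ℝ), (∀ k, ContMDiff (𝓡 d) 𝓘(ℝ, ℝ) ∞ (ρ k)) ∧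
      (∀ k, tsupport (ρ k) ⊆ C.U k) ∧ ∀ x, ∑ k ∈ s, ρ k x = 1 := by
  obtain ⟨f, hf⟩ := SmoothPartitionOfUnity.exists_isSubordinate (𝓡 d) (isClosed_univ (X := X)) C.U
    C.isOpen fun x _ => Set.mem_iUnion.2 (C.exists_mem x)
  -- Compactness makes a locally finite family finite, so the connections can be averaged by a
  -- finite sum.
  have hfin := f.locallyFinite.finite_nonempty_of_compact
  refine ⟨hfin.toFinset, fun k => f k, fun k => (f k).contMDiff, hf, fun x => ?_⟩
  rw [← f.sum_eq_one (Set.mem_univ x)]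
  refine (finsum_eq_sum_of_support_subset _ fun k hk => ?_).symm
  exact hfin.mem_toFinset.2 ⟨x, hk⟩

end Flat

/-! ### Existence of compatible connections. -/

section Existence

variable {d : ℕ} {X : Type*} [TopologicalSpace X] [ChartedSpace (Eucl d) X]
  [IsManifold (𝓡 d) ∞ X] {ι : Type*} {C : OpenCover ι X} (T : GerbeConn d C) {x : X}

/-- The normalised cocycle is 1 when two indices coincide, so its logarithmic derivative vanishes.
With all three indices equal this reads 3 A_ii = 0. -/
lemma GerbeConn.dlog_eq_zero {k j i : ι} (h : k = j ∨ j = i ∨ k = i)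
    (hx : x ∈ C.U k ∩ C.U j ∩ C.U i) : T.A j i x + T.A i k x + T.A k j x = 0 := by
  rw [← T.dlog_lam k j i x hx, extD_congr (u := fun _ => algebraMap ℂ (Ext (Eucl d)) 1)
    ((C.isOpen_inter k j).inter (C.isOpen i)) (fun y hy => by rw [T.eq_one k j i h y hy]) hx,
    extD_const, mul_zero]

lemma GerbeConn.A_self {i : ι} (hx : x ∈ C.U i) : T.A i i x = 0 := by
  have h := T.dlog_eq_zero (k := i) (j := i) (i := i) (.inl rfl) ⟨⟨hx, hx⟩, hx⟩
  have h3 : (3 : ℂ) • T.A i i x = 0 := by rw [← h]; module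
  exact (smul_eq_zero.1 h3).resolve_left (by norm_num)

lemma GerbeConn.A_swap {j i : ι} (hx : x ∈ C.U j ∩ C.U i) : T.A i j x = -T.A j i x := by
  have h := T.dlog_eq_zero (k := j) (j := j) (i := i) (.inl rfl) ⟨⟨hx.1, hx.1⟩, hx.2⟩
  rw [T.A_self hx.1, add_zero] at h
  exact eq_neg_of_add_eq_zero_right h

/-- Rescaling a unitary frame change by l adds the scalar form l⁻¹ dl; |l| = 1 identifies the
conjugate of l with l⁻¹. Here l will be λ_kji. -/
lemma gauge_smul {m n : Type*} [Fintype m] [Fintype n] [DecidableEq m] [DecidableEq n] {S : Set X}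
    {h : X → Matrix m n ℂ} {l : X → ℂ} (hS : IsOpen S)
    (hh : MatSmoothOn d h S) (hl : ContMDiffOn (𝓡 d) 𝓘(ℝ, ℂ) ∞ l S)
    (h1 : (h x)ᴴ * h x = 1) (hl1 : ‖l x‖ = 1) (hx : x ∈ S) :
    gauge (fun y => l y • h y) (fun _ => 0) x = gauge h (fun _ => 0) x +
      Matrix.diagonal fun _ => algebraMap ℂ (Ext (Eucl d)) (l x)⁻¹ *
        extD (fun y => algebraMap ℂ (Ext (Eucl d)) (l y)) x := by
  have hab : toForm d (h x)ᴴ * toForm d (h x) = 1 := by rw [← toForm_mul, h1, toForm_one]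
  have hf : ∀ y, toForm d (l y • h y) =
      (Matrix.diagonal fun _ : m => algebraMap ℂ (Ext (Eucl d)) (l y)) * toForm d (h y) := fun y => by
    ext a b
    simp [Matrix.diagonal_mul]
  have hls : IsSmoothOn (fun y => algebraMap ℂ (Ext (Eucl d)) (l y)) S := .of_contMDiffOn hl
  have hd : extDMat (fun y => toForm d (l y • h y)) x =
      (Matrix.diagonal fun _ : m => extD (fun y => algebraMap ℂ (Ext (Eucl d)) (l y)) x) *
        toForm d (h x) + l x • extDMat (fun y => toForm d (h y)) x := by
    simp only [hf]
    rw [extDMat_mul hS (.diagonal hls) hh.toForm hx, extDMat_diagonal,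
      (show MatDeg (2 * 0) (Matrix.diagonal fun _ : m => algebraMap ℂ (Ext (Eucl d)) (l x)) from
        .diagonal (algebraMap_mem_deg _)).sgnM_even]
    congr 1
    ext a b
    rw [Matrix.diagonal_mul, Matrix.smul_apply, Algebra.smul_def]
  have ht : toForm d (l x • h x)ᴴ = (l x)⁻¹ • toForm d (h x)ᴴ := by
    rw [Matrix.conjTranspose_smul, Complex.inv_eq_conj hl1]
    ext a b
    simp only [Matrix.map_apply, Matrix.smul_apply, smul_eq_mul, map_mul, Algebra.smul_def]
    rfl
  have hl0 : l x ≠ 0 := fun h => by simp [h] at hl1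
  simp only [gauge, Matrix.mul_zero, Matrix.zero_mul, zero_add]
  rw [ht, hd, Matrix.smul_mul, Matrix.mul_add, smul_add, Matrix.mul_smul, smul_smul,
    inv_mul_cancel₀ hl0, one_smul, ← Matrix.mul_assoc, conj_diagonal_of_deg_zero hab (.toForm _),
    add_comm]
  congr 1
  ext a b
  rcases eq_or_ne a b with rfl | hne
  · simp [Algebra.smul_def]
  · simp [Matrix.diagonal_apply_ne _ hne]

variable {T} (E : TwistedBundle T.toGerbe)

/-- The local forms of the connection on `E` that is trivial in the frame over `U_k`. -/
def TwistedBundle.flatForm (k i : ι) (x : X) : Matrix (Fin E.rank) (Fin E.rank) (Ext (Eucl d)) :=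
  gauge (E.g k i) (fun _ => 0) x - Matrix.diagonal fun _ => T.A k i x

lemma TwistedBundle.flatForm_skew {k i : ι} (hx : x ∈ C.U k ∩ C.U i) :
    IsSkewOneForm (E.flatForm k i x) := by
  rw [flatForm, sub_eq_add_neg]
  refine IsSkewOneForm.add ?_ (T.A_imag k i x hx).isSkewOneForm_neg_diagonal
  simp only [gauge, Matrix.mul_zero, Matrix.zero_mul, zero_add]
  exact isSkewOneForm_maurerCartan (C.isOpen_inter k i) (E.smooth k i)
    (fun y hy => E.conjTranspose_mul_self hy) hx

lemma TwistedBundle.flatForm_smooth (k i : ι) :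
    FormMatSmooth (E.flatForm k i) (C.U k ∩ C.U i) :=
  (gauge_formMatSmooth (C.isOpen_inter k i) (E.smooth k i) (fun _ _ => .zero _)).sub
    (.diagonal (T.A_smooth k i))

/-- The relation g_kj g_ji = λ_kji g_ki produces the extra term dlog λ_kji = A_ji + A_ik + A_kj.
With A_ik = -A_ki this is exactly what the shifts by A_kj, A_ji and A_ki require. -/
lemma TwistedBundle.flatForm_compat {k j i : ι} (hx : x ∈ C.U k ∩ C.U j ∩ C.U i) :
    E.flatForm k i x = gauge (E.g j i) (E.flatForm k j) x - Matrix.diagonal fun _ => T.A j i x := by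
  have hS : IsOpen (C.U k ∩ C.U j ∩ C.U i) := (C.isOpen_inter k j).inter (C.isOpen i)
  have hkj : C.U k ∩ C.U j ∩ C.U i ⊆ C.U k ∩ C.U j := Set.inter_subset_left
  have hji : C.U k ∩ C.U j ∩ C.U i ⊆ C.U j ∩ C.U i := fun y hy => ⟨hy.1.2, hy.2⟩
  have hki : C.U k ∩ C.U j ∩ C.U i ⊆ C.U k ∩ C.U i := fun y hy => ⟨hy.1.1, hy.2⟩
  have e1 : gauge (E.g j i) (E.flatForm k j) x =
      gauge (E.g k i) (fun _ => 0) x + Matrix.diagonal (fun _ => T.A j i x + T.A i k x + T.A k j x) -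
        Matrix.diagonal fun _ => T.A k j x := by
    have h := gauge_sub_diagonal (Γ := gauge (E.g k j) fun _ => 0) (A := T.A k j)
      (E.conjTranspose_mul_self (hji hx))
    refine h.trans ?_
    rw [gauge_gauge hS ((E.smooth k j).mono hkj) ((E.smooth j i).mono hji)
      (E.conjTranspose_mul_self (hkj hx)) hx,
      gauge_congr (Γ' := fun _ => 0) hS (fun y hy => E.g_mul k j i y hy) rfl hx,
      gauge_smul hS ((E.smooth k i).mono hki) (T.smooth k j i) (E.conjTranspose_mul_self (hki hx))
        (T.norm_eq_one k j i x hx) hx]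
    simp only [T.dlog_lam k j i x hx]
  have e2 : Matrix.diagonal (fun _ : Fin E.rank => T.A j i x + T.A i k x + T.A k j x) =
      (Matrix.diagonal fun _ => T.A j i x) - (Matrix.diagonal fun _ => T.A k i x) +
        Matrix.diagonal fun _ => T.A k j x := by
    rw [T.A_swap (hki hx), Matrix.diagonal_sub, Matrix.diagonal_add]
    simp only [sub_eq_add_neg]
  rw [e1, e2, flatForm]
  abel

/-- Every twisted vector bundle on a compact manifold has a compatible connection. -/
lemma exists_connection [T2Space X] [CompactSpace X] : Nonempty (Connection E) := by
  obtain ⟨s, ρ, hρ, ht, h1⟩ := C.exists_partition (d := d)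
  -- Outside U_k the weight vanishes, so the unspecified values of `flatForm k i` there do not
  -- matter.
  have h0 : ∀ k y, y ∉ C.U k → (ρ k y : ℂ) = 0 := fun k y hy => by
    rw [image_eq_zero_of_notMem_tsupport fun h => hy (ht k h), Complex.ofReal_zero]
  have h1' : ∀ y, ∑ k ∈ s, (ρ k y : ℂ) = 1 := fun y => by exact_mod_cast h1 y
  refine ⟨⟨fun i x => ∑ k ∈ s, (ρ k x : ℂ) • E.flatForm k i x, fun i x hx => ?_, fun i a b => ?_,
    fun j i x hx => ?_⟩⟩
  · refine IsSkewOneForm.sum s fun k _ => ?_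
    by_cases hk : x ∈ C.U k
    · exact (E.flatForm_skew ⟨hk, hx⟩).ofReal_smul _
    · rw [h0 k x hk, zero_smul]
      exact .zero
  · simp only [Matrix.sum_apply]
    exact IsSmoothOn.sum s fun k _ => IsSmoothOn.smul_of_tsupport (hρ k) (C.isOpen k) (C.isOpen i)
      (ht k) (E.flatForm_smooth k i a b)
  -- The compatibility condition is affine, so it survives averaging with weights of sum 1.
  · have e : ∑ k ∈ s, (ρ k x : ℂ) • E.flatForm k i x = ∑ k ∈ s, (ρ k x : ℂ) •
        (gauge (E.g j i) (E.flatForm k j) x - Matrix.diagonal fun _ => T.A j i x) :=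
      Finset.sum_congr rfl fun k _ => by
        by_cases hk : x ∈ C.U k
        · rw [E.flatForm_compat ⟨⟨hk, hx.1⟩, hx.2⟩]
        · rw [h0 k x hk, zero_smul, zero_smul]
    rw [e]
    simp only [gauge, smul_sub, smul_add, Finset.sum_sub_distrib, Finset.sum_add_distrib,
      ← Finset.sum_smul, h1', one_smul, Finset.mul_sum, Finset.sum_mul, Matrix.mul_smul,
      Matrix.smul_mul]
    abel

end Existence

/-! ### The relation on generators and the two homomorphisms. -/

section Relations

variable {d : ℕ} {X : Type*} [TopologicalSpace X] [ChartedSpace (Eucl d) X]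
  [IsManifold (𝓡 d) ∞ X] {ι : Type*} {C : OpenCover ι X} {T : GerbeConn d C}

lemma Connection.isConnection_pullConn {E F : TwistedBundle T.toGerbe} (Γ : Connection F)
    (φ : Iso E F) : IsConnection E (φ.pullConn Γ) := Γ.isConnection.pull φ

/-- Equivalence of generators through an isomorphism of the bundles themselves. -/
def Generator.StrictRel (a b : Generator T) : Prop :=
  ∃ (φ : Iso a.E b.E) (cs : OddForms d X), IsCS T a.Γ.Γ (φ.pullConn b.Γ) cs ∧
    (QuotientAddGroup.mk cs : OddForms d X ⧸ exactForms T) = a.w - b.w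

/-- A form carried by the stabilising generator cancels from the difference, so stabilising by
bundles or by generators is the same. -/
lemma Generator.rel_iff {a b : Generator T} :
    a.Rel b ↔ ∃ f : Generator T, (a.sum f).StrictRel (b.sum f) := by
  constructor
  · rintro ⟨F, Θ, φ, cs, h, hw⟩
    exact ⟨⟨F, Θ, 0⟩, φ, cs, h, hw.trans (add_sub_add_right_eq_sub _ _ _).symm⟩
  · rintro ⟨⟨F, Θ, u⟩, φ, cs, h, hw⟩
    exact ⟨F, Θ, φ, cs, h, hw.trans (add_sub_add_right_eq_sub _ _ _)⟩

lemma Generator.StrictRel.of_equiv {a b : Generator T} (e : Fin b.E.rank ≃ Fin a.E.rank)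
    (hg : ∀ j i x, b.E.g j i x = (a.E.g j i x).submatrix e e)
    (hΓ : ∀ i x, b.Γ.Γ i x = (a.Γ.Γ i x).submatrix e e) (hw : a.w = b.w) : a.StrictRel b := by
  have h : (Iso.ofEquiv e hg).pullConn b.Γ = a.Γ.Γ := by
    funext i x
    exact ((Iso.refl a.E).pullConn_reindex (Equiv.refl _) e (fun _ _ _ => rfl) hg a.Γ b.Γ hΓ i
      x).trans (Iso.pullConn_refl a.Γ i x)
  refine ⟨Iso.ofEquiv e hg, 0, ?_, ?_⟩
  · rw [h]
    exact IsCS.self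
  · rw [hw, sub_self]
    rfl

lemma Iso.pullConn_symm {E F : TwistedBundle T.toGerbe} (φ : Iso E F) (Γ : Connection F) (i : ι)
    {x : X} (hx : x ∈ C.U i) : Γ.Γ i x = gauge (φ.symm.f i) (φ.pullConn Γ i) x := by
  have h : gauge (φ.symm.f i) (gauge (φ.f i) (Γ.Γ i)) x = _ :=
    gauge_gauge (C.isOpen i) (φ.smooth i) (φ.symm.smooth i) (φ.unitary_left i x hx) hx
  have h1 : gauge (fun y => φ.f i y * φ.symm.f i y) (Γ.Γ i) x =
      gauge (fun _ => 1) (Γ.Γ i) x :=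
    gauge_congr (C.isOpen i) (fun y hy => φ.unitary_right i y hy) rfl hx
  exact ((h.trans h1).trans (Iso.pullConn_refl Γ i x)).symm

/-- Transport along φ⁻¹ gives cs(φ⁻¹^*Γ_a, Γ_b) = cs(Γ_a, φ^*Γ_b). The degenerate triangle Γ_b,
φ⁻¹^*Γ_a, Γ_b then shows that the reversed class is its negative. -/
lemma Generator.StrictRel.symm {a b : Generator T} (h : a.StrictRel b) : b.StrictRel a := by
  obtain ⟨φ, cs, hcs, hw⟩ := h
  have hb := b.Γ.isConnection
  have ha := a.Γ.isConnection_pullConn φ.symm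
  obtain ⟨cs', hcs'⟩ := exists_isCS hb ha
  have hp : IsCS T (φ.symm.pullConn a.Γ) b.Γ.Γ cs :=
    hcs.pull a.Γ.isConnection (b.Γ.isConnection_pullConn φ) φ.symm (fun _ _ _ => rfl)
      fun i x hx => φ.pullConn_symm b.Γ i hx
  have ht := (QuotientAddGroup.eq_zero_iff _).2 (IsCS.triangle hb ha hb hcs' hp IsCS.self)
  rw [sub_zero, QuotientAddGroup.mk_add, hw] at ht
  refine ⟨φ.symm, cs', hcs', ?_⟩
  rw [eq_neg_of_add_eq_zero_left ht, neg_sub]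

lemma Iso.pullConn_trans {E F G : TwistedBundle T.toGerbe} (φ : Iso E F) (ψ : Iso F G)
    (Γ : Connection G) (i : ι) {x : X} (hx : x ∈ C.U i) :
    (φ.trans ψ).pullConn Γ i x = gauge (φ.f i) (ψ.pullConn Γ i) x :=
  (gauge_gauge (C.isOpen i) (ψ.smooth i) (φ.smooth i) (ψ.unitary_left i x hx) hx).symm

/-- The second Chern–Simons form is pulled back along φ, which does not change it, and the triangle
identity adds it to the first. -/
lemma Generator.StrictRel.trans {a b c : Generator T} (hab : a.StrictRel b)
    (hbc : b.StrictRel c) : a.StrictRel c := by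
  obtain ⟨φ, cs, hcs, hw⟩ := hab
  obtain ⟨ψ, cs', hcs', hw'⟩ := hbc
  have ha := a.Γ.isConnection
  have hb := b.Γ.isConnection_pullConn φ
  have hc := c.Γ.isConnection_pullConn (φ.trans ψ)
  obtain ⟨cs'', hcs''⟩ := exists_isCS ha hc
  have hp : IsCS T (φ.pullConn b.Γ) ((φ.trans ψ).pullConn c.Γ) cs' :=
    hcs'.pull b.Γ.isConnection (c.Γ.isConnection_pullConn ψ) φ (fun _ _ _ => rfl)
      fun i x hx => φ.pullConn_trans ψ c.Γ i hx
  have ht := (QuotientAddGroup.eq_zero_iff _).2 (IsCS.triangle ha hb hc hcs hp hcs'')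
  rw [QuotientAddGroup.mk_sub, QuotientAddGroup.mk_add, hw, hw', sub_eq_zero] at ht
  exact ⟨φ.trans ψ, cs'', hcs'', by rw [← ht]; abel⟩

lemma Generator.StrictRel.sum_right {a b : Generator T} (h : a.StrictRel b) (c : Generator T) :
    (a.sum c).StrictRel (b.sum c) := by
  obtain ⟨φ, cs, hcs, hw⟩ := h
  refine ⟨φ.sum (Iso.refl _), cs, fun i x hx => ?_, hw.trans (add_sub_add_right_eq_sub _ _ _).symm⟩
  have h1 : (φ.sum (Iso.refl c.E)).pullConn (b.Γ.sum c.Γ) i =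
      fun y => blockSum (φ.pullConn b.Γ i y) (c.Γ.Γ i y) := by
    funext y
    rw [Iso.pullConn_sum, Iso.pullConn_refl]
  have h2 := congrArg (fun γ => csForm (T.B i) γ x)
    (straightPath_blockSum (a.Γ.Γ i) (φ.pullConn b.Γ i) (c.Γ.Γ i))
  have h3 := csForm_blockSum_const (T.B i) (straightPath (a.Γ.Γ i) (φ.pullConn b.Γ i)) (c.Γ.Γ i) x
  have h4 := congrArg (fun Q => csForm (T.B i) (straightPath
    (fun y => blockSum (a.Γ.Γ i y) (c.Γ.Γ i y)) Q) x) h1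
  exact (hcs i x hx).trans (h4.trans (h2.trans h3)).symm

lemma Generator.strictRel_assoc (a b c : Generator T) :
    ((a.sum b).sum c).StrictRel (a.sum (b.sum c)) :=
  .of_equiv (assocEquiv _ _ _).symm (fun _ _ _ => blockSum_assoc _ _ _)
    (fun _ _ => blockSum_assoc _ _ _) (add_assoc _ _ _)

lemma Generator.strictRel_swap (a b c : Generator T) :
    ((a.sum b).sum c).StrictRel ((a.sum c).sum b) :=
  .of_equiv (swapEquiv _ _ _) (fun _ _ _ => blockSum_swap _ _ _)
    (fun _ _ => blockSum_swap _ _ _) (add_right_comm _ _ _)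

/-- For transitivity, two equivalences stabilised by f and by g are both stabilised by f ⊕ g and
composed there. -/
lemma Generator.rel_equivalence : Equivalence (Generator.Rel (T := T)) where
  refl a := Generator.rel_iff.2 ⟨a, .of_equiv (Equiv.refl _) (fun _ _ _ => rfl) (fun _ _ => rfl) rfl⟩
  symm h := by
    obtain ⟨f, hf⟩ := Generator.rel_iff.1 h
    exact Generator.rel_iff.2 ⟨f, hf.symm⟩
  trans {a b c} hab hbc := by
    obtain ⟨f, hf⟩ := Generator.rel_iff.1 hab
    obtain ⟨g, hg⟩ := Generator.rel_iff.1 hbc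
    have h1 := (a.strictRel_assoc f g).symm.trans ((hf.sum_right g).trans (b.strictRel_swap f g))
    exact Generator.rel_iff.2 ⟨f.sum g, h1.trans ((hg.sum_right f).trans
      ((c.strictRel_swap g f).trans (c.strictRel_assoc f g)))⟩

lemma Generator.Rel.cancel {a b c : Generator T} (h : (a.sum c).Rel (b.sum c)) : a.Rel b := by
  obtain ⟨f, hf⟩ := Generator.rel_iff.1 h
  exact Generator.rel_iff.2 ⟨c.sum f,
    (a.strictRel_assoc c f).symm.trans (hf.trans (b.strictRel_assoc c f))⟩

lemma GrothendieckAddGroup.of_eq_iff {M : Type*} [AddCommMonoid M] {a b : M} :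
    Algebra.GrothendieckAddGroup.of a = Algebra.GrothendieckAddGroup.of b ↔
      ∃ c, a + c = b + c := by
  refine ((AddLocalization.addMonoidOf (⊤ : AddSubmonoid M)).eq_iff_exists).trans ?_
  constructor
  · rintro ⟨c, h⟩
    exact ⟨c, by rwa [add_comm, add_comm b]⟩
  · rintro ⟨c, h⟩
    exact ⟨⟨c, AddSubmonoid.mem_top c⟩, by rwa [add_comm _ a, add_comm _ b]⟩

lemma GrothendieckAddGroup.exists_of_sub {M : Type*} [AddCommMonoid M]
    (x : Algebra.GrothendieckAddGroup M) :
    ∃ a b : M, x = Algebra.GrothendieckAddGroup.of a - Algebra.GrothendieckAddGroup.of b := by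
  obtain ⟨⟨a, b⟩, h⟩ := (AddLocalization.addMonoidOf (⊤ : AddSubmonoid M)).surj x
  exact ⟨a, b, eq_sub_of_add_eq h⟩

/-- Equality in a group completion means equality after adding some c. Here c can be absorbed into
the stabilising bundle of the relation, so nothing is lost on passing to the group. -/
lemma KHat.mk_eq_iff {a b : Generator T} : KHat.mk a = KHat.mk b ↔ a.Rel b := by
  refine GrothendieckAddGroup.of_eq_iff.trans ⟨?_, fun h => ⟨0, by rw [GenMonoid.mk, Quot.sound h]; rfl⟩⟩
  rintro ⟨c, h⟩
  induction c using Quot.ind with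
  | mk c =>
    exact ((Generator.rel_equivalence.quot_mk_eq_iff (a.sum c) (b.sum c)).1 h).cancel

lemma KHat.mk_sum (a b : Generator T) : KHat.mk (a.sum b) = KHat.mk a + KHat.mk b :=
  map_add Algebra.GrothendieckAddGroup.of (GenMonoid.mk a) (GenMonoid.mk b)

lemma KHat.mk_ofForm_add (u : OddForms d X ⧸ exactForms T) (g : Generator T) :
    KHat.mk (Generator.ofForm T u) + KHat.mk g = KHat.mk ⟨g.E, g.Γ, u + g.w⟩ := by
  rw [← KHat.mk_sum]
  exact (KHat.mk_eq_iff.2 (Generator.Rel.of_equiv (a := (Generator.ofForm T u).sum g)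
    (b := ⟨g.E, g.Γ, u + g.w⟩) (zeroEquiv _).symm (fun _ _ _ => blockSum_zero_left _ _)
    (fun _ _ => blockSum_zero_left _ _) rfl))

lemma KHat.exists_mk_sub (x : KHat T) : ∃ a b : Generator T, x = KHat.mk a - KHat.mk b := by
  obtain ⟨a, b, h⟩ := GrothendieckAddGroup.exists_of_sub x
  induction a using Quot.ind with
  | mk a =>
    induction b using Quot.ind with
    | mk b => exact ⟨a, b, h⟩

lemma K0.exists_mk_sub {L : Gerbe d C} (x : K0 L) :
    ∃ E F : TwistedBundle L, x = K0.mk E - K0.mk F := by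
  obtain ⟨a, b, h⟩ := GrothendieckAddGroup.exists_of_sub x
  induction a using Quotient.ind with
  | _ E =>
    induction b using Quotient.ind with
    | _ F => exact ⟨E, F, h⟩

lemma K0.mk_sum {L : Gerbe d C} (E F : TwistedBundle L) : K0.mk (E.sum F) = K0.mk E + K0.mk F :=
  map_add Algebra.GrothendieckAddGroup.of (Vect.mk E) (Vect.mk F)

lemma K0.mk_eq_iff {L : Gerbe d C} {E F : TwistedBundle L} :
    K0.mk E = K0.mk F ↔ ∃ G : TwistedBundle L, Nonempty (Iso (E.sum G) (F.sum G)) := by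
  refine GrothendieckAddGroup.of_eq_iff.trans ⟨?_, ?_⟩
  · rintro ⟨c, h⟩
    induction c using Quotient.ind with
    | _ G => exact ⟨G, Quotient.exact h⟩
  · rintro ⟨G, h⟩
    exact ⟨Vect.mk G, Quotient.sound h⟩

lemma Generator.Rel.mk_eq {a b : Generator T} (h : a.Rel b) : K0.mk a.E = K0.mk b.E := by
  obtain ⟨F, -, φ, -⟩ := h
  exact K0.mk_eq_iff.2 ⟨F, ⟨φ⟩⟩

variable (T) in
/-- The class of the bundle underlying a generator. -/
def bundleHom : GenMonoid T →+ K0 T.toGerbe where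
  toFun := Quot.lift (fun g : Generator T => K0.mk g.E) fun _ _ h => h.mk_eq
  map_zero' := map_zero Algebra.GrothendieckAddGroup.of
  map_add' := by
    rintro ⟨a⟩ ⟨b⟩
    exact K0.mk_sum a.E b.E

variable (T) in
/-- The map `I` that forgets connections and forms. -/
def forgetHom : KHat T →+ K0 T.toGerbe :=
  Algebra.GrothendieckAddGroup.lift (bundleHom T)

lemma forgetHom_mk (g : Generator T) : forgetHom T (KHat.mk g) = K0.mk g.E :=
  DFunLike.congr_fun (Algebra.GrothendieckAddGroup.lift.symm_apply_apply (bundleHom T))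
    (GenMonoid.mk g)

variable (T) in
/-- The homomorphism `θ ↦ [(O, 0, θ)]` on odd forms. -/
def formHom : OddForms d X →+ KHat T where
  toFun θ := KHat.mk (Generator.ofForm T (QuotientAddGroup.mk θ))
  map_zero' := map_zero Algebra.GrothendieckAddGroup.of
  map_add' θ η := (KHat.mk_ofForm_add (QuotientAddGroup.mk θ)
    (Generator.ofForm T (QuotientAddGroup.mk η))).symm

lemma formHom_eq_zero_of_mem_exactForms {θ : OddForms d X} (h : θ ∈ exactForms T) :
    formHom T θ = 0 := by
  have : (QuotientAddGroup.mk θ : OddForms d X ⧸ exactForms T) = QuotientAddGroup.mk 0 :=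
    (QuotientAddGroup.eq_zero_iff θ).2 h
  change KHat.mk (Generator.ofForm T (QuotientAddGroup.mk θ)) = 0
  rw [this]
  exact map_zero (formHom T)

/-- The automorphism itself is an equivalence between (E, Γ, θ) and (E, Γ, 0), and [(E, Γ, 0)]
cancels in the group. -/
lemma formHom_eq_zero_of_mem_oddChernForms {θ : OddForms d X} (h : θ ∈ oddChernForms T) :
    formHom T θ = 0 := by
  obtain ⟨E, φ, Γ, hcs⟩ := h
  have h1 := KHat.mk_ofForm_add (QuotientAddGroup.mk θ) (⟨E, Γ, 0⟩ : Generator T)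
  have h2 : Generator.StrictRel (⟨E, Γ, QuotientAddGroup.mk θ + 0⟩ : Generator T) ⟨E, Γ, 0⟩ :=
    ⟨φ, θ, hcs, by rw [add_zero, sub_zero]⟩
  have h3 := KHat.mk_eq_iff.2 (Generator.rel_iff.2
    ⟨(⟨E, Γ, 0⟩ : Generator T), h2.sum_right _⟩)
  rw [h3] at h1
  exact add_eq_right.1 h1

/-- An equivalence between (O, 0, θ) and (O, 0, 0) is an automorphism of O ⊕ F. Its odd Chern
character form differs from θ by an exact form. -/
lemma mem_OmegaHCh_of_formHom_eq_zero {θ : OddForms d X} (h : formHom T θ = 0) :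
    θ ∈ OmegaHCh T := by
  obtain ⟨F, Θ, φ, cs, hcs, hw⟩ := KHat.mk_eq_iff.1 (h.trans (map_zero (formHom T)).symm)
  have h1 : cs ∈ oddChernForms T := ⟨_, φ, _, hcs⟩
  have h2 : (QuotientAddGroup.mk cs : OddForms d X ⧸ exactForms T) = QuotientAddGroup.mk θ :=
    hw.trans (sub_zero _)
  have h3 := QuotientAddGroup.eq.1 h2
  have : θ = cs + (-cs + θ) := by abel
  rw [this]
  exact add_mem ((le_sup_left : _ ≤ OmegaHCh T) (AddSubgroup.subset_closure h1))
    ((le_sup_right : _ ≤ OmegaHCh T) h3)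

lemma OmegaHCh_le_ker : OmegaHCh T ≤ (formHom T).ker :=
  sup_le ((AddSubgroup.closure_le _).2 fun _ h => formHom_eq_zero_of_mem_oddChernForms h)
    fun _ h => formHom_eq_zero_of_mem_exactForms h

variable [T2Space X] [CompactSpace X]

lemma exists_formHom_of_mk_eq {x y : Generator T} (h : K0.mk x.E = K0.mk y.E) :
    ∃ θ, formHom T θ = KHat.mk x - KHat.mk y := by
  obtain ⟨G, ⟨φ⟩⟩ := K0.mk_eq_iff.1 h
  obtain ⟨Θ⟩ := exists_connection G
  obtain ⟨cs, hcs⟩ := exists_isCS (x.Γ.sum Θ).isConnection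
    ((y.Γ.sum Θ).isConnection_pullConn φ)
  -- This θ is forced by the relation: CS must equal the form of x minus that of y shifted by θ.
  obtain ⟨θ, hθ⟩ := QuotientAddGroup.mk_surjective (x.w - y.w - QuotientAddGroup.mk cs)
  refine ⟨θ, eq_sub_of_add_eq ?_⟩
  change KHat.mk (Generator.ofForm T (QuotientAddGroup.mk θ)) + _ = _
  rw [KHat.mk_ofForm_add]
  refine ((KHat.mk_eq_iff (a := x) (b := ⟨y.E, y.Γ, QuotientAddGroup.mk θ + y.w⟩)).2
    ⟨G, Θ, φ, cs, hcs, ?_⟩).symm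
  change _ = x.w - (QuotientAddGroup.mk θ + y.w)
  rw [hθ]
  abel

end Relations

end TwistedK

end

/-! ### The exact sequence. -/

theorem mainTheorem2 {d : ℕ} {X : Type*} [TopologicalSpace X]
    [ChartedSpace (TwistedK.Eucl d) X] [IsManifold (𝓡 d) ∞ X]
    [T2Space X] [CompactSpace X] [ConnectedSpace X]
    {ι : Type*} (C : TwistedK.OpenCover ι X) (T : TwistedK.GerbeConn d C) :
    ∃ (a : (TwistedK.OddForms d X ⧸ TwistedK.OmegaHCh T) →+ TwistedK.KHat T)
      (I : TwistedK.KHat T →+ TwistedK.K0 T.toGerbe),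
      (∀ θ : TwistedK.OddForms d X,
        a (QuotientAddGroup.mk θ) =
          TwistedK.KHat.mk (TwistedK.Generator.ofForm T (QuotientAddGroup.mk θ))) ∧
      (∀ x y : TwistedK.Generator T,
        I (TwistedK.KHat.mk x - TwistedK.KHat.mk y) = TwistedK.K0.mk x.E - TwistedK.K0.mk y.E) ∧
      Function.Injective a ∧ Function.Exact a I ∧ Function.Surjective I := by
  have hI : ∀ x y : TwistedK.Generator T, TwistedK.forgetHom T
      (TwistedK.KHat.mk x - TwistedK.KHat.mk y) = TwistedK.K0.mk x.E - TwistedK.K0.mk y.E :=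
    fun x y => by rw [map_sub, TwistedK.forgetHom_mk, TwistedK.forgetHom_mk]
  refine ⟨QuotientAddGroup.lift _ (TwistedK.formHom T) TwistedK.OmegaHCh_le_ker,
    TwistedK.forgetHom T, fun _ => rfl, hI, ?_, ?_, ?_⟩
  · rw [injective_iff_map_eq_zero]
    intro θ hθ
    obtain ⟨θ, rfl⟩ := QuotientAddGroup.mk_surjective θ
    exact (QuotientAddGroup.eq_zero_iff θ).2 (TwistedK.mem_OmegaHCh_of_formHom_eq_zero hθ)
  · intro z
    constructor
    · intro hz
      obtain ⟨x, y, rfl⟩ := TwistedK.KHat.exists_mk_sub z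
      rw [hI, sub_eq_zero] at hz
      obtain ⟨θ, hθ⟩ := TwistedK.exists_formHom_of_mk_eq hz
      exact ⟨QuotientAddGroup.mk θ, hθ⟩
    · rintro ⟨θ, rfl⟩
      obtain ⟨θ, rfl⟩ := QuotientAddGroup.mk_surjective θ
      -- The bundle underlying a(θ) has rank zero, and its class is 0.
      exact (TwistedK.forgetHom_mk _).trans (map_zero Algebra.GrothendieckAddGroup.of)
  · intro z
    obtain ⟨E, F, rfl⟩ := TwistedK.K0.exists_mk_sub z
    obtain ⟨Γ⟩ := TwistedK.exists_connection E
    obtain ⟨Δ⟩ := TwistedK.exists_connection F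
    -- Any choice of connections, with zero forms, gives a preimage.
    exact ⟨_, hI ⟨E, Γ, 0⟩ ⟨F, Δ, 0⟩⟩
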